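/- Let $r\ge 2$ be an integer. For a positive integer $N$ put $h=1/N$, $x_i=ih$ $(0\le i\le N)$, and let $$S_h=\{\phi\in C^{r-2}(\mathbb R)\ :\ \phi\ \text{is 1-periodic and}\ \phi|_{[x_{i-1},x_i]}\ \text{is a polynomial of degree at most } r-1,\ 1\le i\le N\}$$ be the space of smooth 1-periodic splines of order $r$ on the uniform mesh (continuous piecewise linear functions if $r=2$). Let $(\cdot,\cdot)$ and $\|\cdot\|$ denote the inner product and the norm of $L^2(0,1)$. Let $T>0$ and let $(m,u)$ be a solution, 1-periodic in $x$, of the Camassa–Holm system $$m=u-u_{xx},\qquad m_t+(mu)_x+mu_x=0,\qquad 0\le t\le T,$$ with $u(x,0)=u_0(x)$ and $m(x,0)=u_0(x)-u_0''(x)$. The modified Galerkin semidiscretization seeks $m_h,u_h:[0,T]\to S_h$, with $m_h$ differentiable in $t$, such that for $0\le t\le T$ $$(m_h,\phi)=(u_h,\phi)+(u_{hx},\phi')\quad\forall\phi\in S_h,$$ $$(m_{ht},\phi)+\bigl((m_hu_h)_x,\phi\bigr)+(m_hu_{hx},\phi)=0\quad\forall\phi\in S_h,$$ $$(m_h(0),\phi)=(u_0,\phi)+(u_0',\phi')\quad\forall\phi\in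 S_h,$$ the last condition saying that $m_h(0)$ is the $L^2$ projection of $m(\cdot,0)$ on $S_h$. Then, if $(m,u)$ is sufficiently smooth (that is, $m$ and $u$ are of class $C^k$ on $\mathbb R\times[0,T]$, for some integer $k$ that depends only on $r$), there are constants $C$ and $h_0>0$, independent of $h$, such that for every $h=1/N\le h_0$ the semidiscrete problem has a unique solution $(m_h,u_h)$ on $[0,T]$, and $$\max_{0\le t\le T}\bigl(\|m(t)-m_h(t)\|+\|u(t)-u_h(t)\|\bigr)\le C\,h^r.$$ -/

import Mathlib

open Set

noncomputable section

namespace CamassaHolm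

/-- The inner product `(f, g) = ∫₀¹ f g dx` of `L²(0,1)`. -/
def l2Inner (f g : ℝ → ℝ) : ℝ := ∫ x in (0 : ℝ)..1, f x * g x

/-- The norm `‖f‖ = (f, f)^{1/2}` of `L²(0,1)`. -/
def l2Norm (f : ℝ → ℝ) : ℝ := Real.sqrt (l2Inner f f)

/-- The space `S_h`, `h = 1/N`, of smooth 1-periodic splines of order `r ≥ 2` on the uniform mesh
`x_i = i/N`: the 1-periodic functions of class `C^{r-2}` whose restriction to each mesh interval
is a polynomial of degree at most `r - 1` (i.e. less than `r`). -/
def splineSpace (r N : ℕ) : Submodule ℝ (ℝ → ℝ) where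
  carrier := {φ | Function.Periodic φ 1 ∧ ContDiff ℝ ((r - 2 : ℕ) : WithTop ℕ∞) φ ∧
    ∀ i : ℕ, i < N → ∃ p ∈ Polynomial.degreeLT ℝ r,
      ∀ x ∈ Icc ((i : ℝ) / N) (((i : ℝ) + 1) / N), φ x = p.eval x}
  zero_mem' := ⟨fun _ => rfl, contDiff_const, fun _ _ => ⟨0, Submodule.zero_mem _, by simp⟩⟩
  add_mem' := by
    rintro f g ⟨hf, hf', hf''⟩ ⟨hg, hg', hg''⟩
    refine ⟨hf.add hg, hf'.add hg', fun i hi => ?_⟩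
    obtain ⟨p, hp, hpx⟩ := hf'' i hi
    obtain ⟨q, hq, hqx⟩ := hg'' i hi
    exact ⟨p + q, Submodule.add_mem _ hp hq, fun x hx => by simp [hpx x hx, hqx x hx]⟩
  smul_mem' := by
    rintro c f ⟨hf, hf', hf''⟩
    refine ⟨hf.smul c, contDiff_const.smul hf', fun i hi => ?_⟩
    obtain ⟨p, hp, hpx⟩ := hf'' i hi
    exact ⟨c • p, Submodule.smul_mem _ c hp, fun x hx => by simp [hpx x hx]⟩

/-- `(m, u)` is a classical solution, of class `C^k` on `ℝ × [0, T]` and 1-periodic in `x`, of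
`m = u - u_xx`, `m_t + (m u)_x + m u_x = 0`, `u(x,0) = u₀(x)`, `m(x,0) = u₀(x) - u₀''(x)`.
Here `u t x` stands for `u(x,t)`; at `t = 0, T` the time derivative is one-sided. -/
structure IsSolution (k : ℕ) (T : ℝ) (u₀ : ℝ → ℝ) (m u : ℝ → ℝ → ℝ) : Prop where
  smooth_u : ContDiffOn ℝ k (fun z : ℝ × ℝ => u z.2 z.1) (univ ×ˢ Icc 0 T)
  smooth_m : ContDiffOn ℝ k (fun z : ℝ × ℝ => m z.2 z.1) (univ ×ˢ Icc 0 T)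
  periodic_u : ∀ t ∈ Icc 0 T, Function.Periodic (u t) 1
  periodic_m : ∀ t ∈ Icc 0 T, Function.Periodic (m t) 1
  m_eq : ∀ t ∈ Icc 0 T, ∀ x, m t x = u t x - deriv (deriv (u t)) x
  evolution : ∀ t ∈ Icc 0 T, ∀ x,
    derivWithin (fun s => m s x) (Icc 0 T) t + deriv (fun y => m t y * u t y) x
      + m t x * deriv (u t) x = 0
  initial_u : ∀ x, u 0 x = u₀ x
  initial_m : ∀ x, m 0 x = u₀ x - deriv (deriv u₀) x

/-- `(m_h, u_h) : [0, T] → S_h × S_h` solves the modified Galerkin semidiscretization with initial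
datum `m_h(0)`, the `L²` projection of `u₀ - u₀''` (written in the weak form). The space
derivatives of the splines exist off the mesh points, and the values of `deriv` at the mesh points
do not affect the integrals. As `S_h` is finite-dimensional, differentiability of
`t ↦ m_h(t) ∈ S_h` is differentiability of `t ↦ m_h(x,t)` for each `x`. -/
structure IsModifiedGalerkin (r N : ℕ) (T : ℝ) (u₀ : ℝ → ℝ) (mh uh : ℝ → ℝ → ℝ) : Prop where
  mem_m : ∀ t ∈ Icc 0 T, mh t ∈ splineSpace r N
  mem_u : ∀ t ∈ Icc 0 T, uh t ∈ splineSpace r N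
  differentiable_m : ∀ x, DifferentiableOn ℝ (fun s => mh s x) (Icc 0 T)
  m_eq : ∀ t ∈ Icc 0 T, ∀ φ ∈ splineSpace r N,
    l2Inner (mh t) φ = l2Inner (uh t) φ + l2Inner (deriv (uh t)) (deriv φ)
  evolution : ∀ t ∈ Icc 0 T, ∀ φ ∈ splineSpace r N,
    l2Inner (fun x => derivWithin (fun s => mh s x) (Icc 0 T) t) φ
      + l2Inner (deriv (fun x => mh t x * uh t x)) φ
      + l2Inner (fun x => mh t x * deriv (uh t) x) φ = 0
  initial : ∀ φ ∈ splineSpace r N,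
    l2Inner (mh 0) φ = l2Inner u₀ φ + l2Inner (deriv u₀) (deriv φ)

end CamassaHolm

end

/-! Write `r = n + 2`. The solution is compared with a spline quasi-interpolant `Q`, and everything
rests on a superconvergence property of `Q`.

Solvability. The nonlinearity is `F(m, u, φ) = (m_x u + 2 m u_x, φ)`, and `F(m, u, u)` is the
integral of `(m u²)_x` over a period, hence zero (`fluxForm_eq_zero`). After elimination of `m_h`,
the scheme is a quadratic ODE for `u_h` whose velocity is orthogonal to `u_h` in the `H¹` inner
product. The `H¹` norm is conserved, so solutions exist on all of `[0, T]`, and they are unique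
because the field is locally Lipschitz (`IsGalerkin.exists_unique`).

Quasi-interpolation. On the unit mesh let `S` sample at the integers and then average repeatedly
over the preceding unit interval. On polynomials of degree at most that of the splines, `S` keeps
the leading term, so `D = 1 - S` lowers the degree, and a sufficiently high power of `D` annihilates
them all. Thus `Q = 1 - D^r` is local, spline-valued and exact on polynomials of degree below `r`,
and `v - Q v = O(h^r)`. The derivative of the error is only `O(h^(r-1))`, but its leading part on a
cell is `h^(r-1) v^(r)(x_i) b'(s)` with `b(0) = b(1)` (`exists_hasDerivAt_splineErr`): it oscillates
with mean zero on every cell.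

Superconvergence. Tested against a spline, such an oscillation gains a factor `h`. Repeated
integration by parts replaces `b'` by mean-zero antiderivatives and differentiates the spline until
it is piecewise constant; spline smoothness makes the boundary terms telescope, each derivative
falling on the smooth weight is worth a factor `h` in the cell variable, and derivatives of the
spline are absorbed by an inverse inequality on the unit cell, at no cost in `h`
(`exists_abs_sum_integral_le`, `exists_abs_l2Inner_deriv_sub_le`). Hence `(Q m, Q u)` satisfies both
discrete equations up to `O(h^r)` (`exists_evolution_consistency`, `exists_elliptic_consistency`).

Stability. Put `θ = m_h - Q m` and `ξ = u_h - Q u`. The elliptic equation gives `‖ξ‖_{H¹} ≤ ‖θ‖ +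
O(h^r)`. In the energy identity for `θ` the derivative of `θ` disappears, since `F(θ, w, θ) =
(3/2)(w_x θ, θ)` (`fluxForm_self`). The only term beyond Grönwall is `F(θ, ξ, θ)`; an inverse
estimate bounds it by `C h⁻¹ ‖ξ_x‖ ‖θ‖²`, which is harmless because `h⁻¹ h^r ≤ h` for `r ≥ 2`. A
barrier argument closes the estimate (`IsGalerkin.error_le`). -/

noncomputable section

namespace CamassaHolm

/-! ### Quadratic differential equations with a conserved norm. -/

section GlobalODE

open scoped InnerProductSpace

variable {E : Type*} [NormedAddCommGroup E] [InnerProductSpace ℝ E] [FiniteDimensional ℝ E]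

theorem contDiff_quadratic (B : E →ₗ[ℝ] E →ₗ[ℝ] E) : ContDiff ℝ 1 fun v => B v v := by
  let L : E →L[ℝ] E →L[ℝ] E := LinearMap.toContinuousLinearMap
    ((LinearMap.toContinuousLinearMap : (E →ₗ[ℝ] E) ≃ₗ[ℝ] (E →L[ℝ] E)).toLinearMap ∘ₗ B)
  have h : (fun v => B v v) = fun v => L v v := by
    ext v; simp [L]
  rw [h]
  exact (L.contDiff).clm_apply contDiff_id

/-- A quadratic vector field orthogonal to the position vector has global solutions. -/
theorem exists_solution_of_inner_eq_zero (B : E →ₗ[ℝ] E →ₗ[ℝ] E)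
    (hB : ∀ v, ⟪B v v, v⟫_ℝ = 0) {T : ℝ} (hT : 0 < T) (x₀ : E) :
    ∃ u : ℝ → E, u 0 = x₀ ∧
      ∀ t ∈ Icc 0 T, HasDerivWithinAt u (B (u t) (u t)) (Icc 0 T) t := by
  have hpos : 0 < ‖x₀‖ + 1 := by positivity
  -- The cut-off field is bounded and globally Lipschitz, so Picard–Lindelöf reaches all of `[0, T]`
  -- at once. Multiplication by a scalar preserves orthogonality to the position, so the norm stays
  -- equal to that of `x₀` and the solution never leaves the ball where the cut-off is 1.
  let χ : ContDiffBump (0 : E) := ⟨‖x₀‖ + 1, ‖x₀‖ + 2, hpos, by linarith⟩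
  let f : E → E := fun v => χ v • B v v
  have hf : ContDiff ℝ 1 f := χ.contDiff.smul (contDiff_quadratic B)
  have hc : HasCompactSupport f := χ.hasCompactSupport.smul_right
  obtain ⟨K, hK⟩ := hf.lipschitzWith_of_hasCompactSupport hc one_ne_zero
  obtain ⟨M, hM⟩ := hc.exists_bound_of_continuous hf.continuous
  have hM0 : 0 ≤ M := (norm_nonneg _).trans (hM 0)
  have hPL : IsPicardLindelof (fun _ => f) (⟨0, by simp [hT.le]⟩ : Icc (0 : ℝ) T) x₀
      (⟨M * T, by positivity⟩) 0 ⟨M, hM0⟩ K := by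
    refine IsPicardLindelof.of_time_independent (fun x _ => hM x) hK.lipschitzOnWith ?_
    change M * max (T - 0) (0 - 0) ≤ M * T - 0
    simp [hT.le]
  obtain ⟨u, hu0, hu⟩ := hPL.exists_eq_forall_mem_Icc_hasDerivWithinAt₀
  have hu0 : u 0 = x₀ := hu0
  have hnorm : ∀ t ∈ Icc 0 T, ‖u t‖ ^ 2 = ‖x₀‖ ^ 2 := by
    have hd : ∀ t ∈ Icc 0 T, HasDerivWithinAt (fun t => ‖u t‖ ^ 2) 0 (Icc 0 T) t := by
      intro t ht
      have := (hu t ht).norm_sq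
      have hz : ⟪u t, f (u t)⟫_ℝ = 0 := by
        simp only [f, inner_smul_right]
        rw [real_inner_comm, hB, mul_zero]
      simpa [hz] using this
    intro t ht
    have := constant_of_has_deriv_right_zero (fun t ht => (hd t ht).continuousWithinAt)
      (fun t ht => (hd t (Ico_subset_Icc_self ht)).mono_of_mem_nhdsWithin
        (Icc_mem_nhdsGE_of_mem ht)) t ht
    simpa [hu0] using this
  refine ⟨u, hu0, fun t ht => ?_⟩
  have h1 : χ (u t) = 1 := by
    apply χ.one_of_mem_closedBall
    rw [mem_closedBall_zero_iff]
    have := (pow_left_inj₀ (norm_nonneg _) (norm_nonneg _) two_ne_zero).1 (hnorm t ht)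
    change ‖u t‖ ≤ ‖x₀‖ + 1
    linarith
  have := hu t ht
  simpa [f, h1] using this

/-- Both curves are continuous on a compact interval, hence lie in a common closed ball, on which
the quadratic field is Lipschitz; Grönwall uniqueness then applies. -/
theorem eqOn_of_quadratic_ode (B : E →ₗ[ℝ] E →ₗ[ℝ] E) {T : ℝ} {u v : ℝ → E} (h0 : u 0 = v 0)
    (hu : ∀ t ∈ Icc 0 T, HasDerivWithinAt u (B (u t) (u t)) (Icc 0 T) t)
    (hv : ∀ t ∈ Icc 0 T, HasDerivWithinAt v (B (v t) (v t)) (Icc 0 T) t) :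
    EqOn u v (Icc 0 T) := by
  have cu : ContinuousOn u (Icc 0 T) := fun t ht => (hu t ht).continuousWithinAt
  have cv : ContinuousOn v (Icc 0 T) := fun t ht => (hv t ht).continuousWithinAt
  obtain ⟨R, hR⟩ := isCompact_Icc.exists_bound_of_continuousOn cu
  obtain ⟨R', hR'⟩ := isCompact_Icc.exists_bound_of_continuousOn cv
  obtain ⟨K, hK⟩ := (contDiff_quadratic B).contDiffOn.exists_lipschitzOnWith one_ne_zero
    (convex_closedBall (0 : E) (max R R')) (isCompact_closedBall _ _)
  exact ODE_solution_unique_of_mem_Icc_right (v := fun _ x => B x x)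
    (s := fun _ => Metric.closedBall 0 (max R R')) (fun _ _ => hK) cu
    (fun t ht => (hu t (Ico_subset_Icc_self ht)).mono_of_mem_nhdsWithin
        (Icc_mem_nhdsGE_of_mem ht))
    (fun t ht => mem_closedBall_zero_iff.2
      ((hR t (Ico_subset_Icc_self ht)).trans (le_max_left _ _))) cv
    (fun t ht => (hv t (Ico_subset_Icc_self ht)).mono_of_mem_nhdsWithin
        (Icc_mem_nhdsGE_of_mem ht))
    (fun t ht => mem_closedBall_zero_iff.2
      ((hR' t (Ico_subset_Icc_self ht)).trans (le_max_right _ _))) h0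

end GlobalODE

/-! ### Abstract Galerkin systems: solvability and error estimate. -/

section AbstractGalerkin

variable {V : Type*} [AddCommGroup V] [Module ℝ V]

/-- `θ' ` is the derivative of the curve `θ` at `t` within `s`, tested with all linear forms. -/
def HasWeakDerivWithinAt (θ : ℝ → V) (θ' : V) (s : Set ℝ) (t : ℝ) : Prop :=
  ∀ l : V →ₗ[ℝ] ℝ, HasDerivWithinAt (fun τ => l (θ τ)) (l θ') s t

theorem HasWeakDerivWithinAt.sub {θ η : ℝ → V} {θ' η' : V} {s : Set ℝ} {t : ℝ}
    (h : HasWeakDerivWithinAt θ θ' s t) (k : HasWeakDerivWithinAt η η' s t) :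
    HasWeakDerivWithinAt (fun τ => θ τ - η τ) (θ' - η') s t := fun l => by
  simp only [map_sub]
  exact (h l).sub (k l)

/-- Expanding the first argument in a basis reduces this to the scalar product rule; no norm on `V`
has to be chosen. -/
theorem HasWeakDerivWithinAt.apply₂ [FiniteDimensional ℝ V] (B : V →ₗ[ℝ] V →ₗ[ℝ] ℝ)
    {θ η : ℝ → V} {θ' η' : V} {s : Set ℝ} {t : ℝ}
    (h : HasWeakDerivWithinAt θ θ' s t) (k : HasWeakDerivWithinAt η η' s t) :
    HasDerivWithinAt (fun τ => B (θ τ) (η τ)) (B θ' (η t) + B (θ t) η') s t := by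
  let b := Module.finBasis ℝ V
  have key : ∀ x y, B x y = ∑ i, b.coord i x * B (b i) y := fun x y => by
    conv_lhs => rw [← b.sum_repr x]
    simp only [map_sum, map_smul, LinearMap.sum_apply, LinearMap.smul_apply, smul_eq_mul,
      Module.Basis.coord_apply]
  rw [show (fun τ => B (θ τ) (η τ)) = fun τ => ∑ i, b.coord i (θ τ) * B (b i) (η τ) from
    funext fun τ => key _ _, key θ', key (θ t), ← Finset.sum_add_distrib]
  exact HasDerivWithinAt.fun_sum fun i _ => (h (b.coord i)).mul (k (B (b i)))

/-- Cauchy-Schwarz for a positive semidefinite symmetric form. -/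
theorem abs_le_sqrt_mul_sqrt (B : V →ₗ[ℝ] V →ₗ[ℝ] ℝ) (hs : ∀ x y, B x y = B y x)
    (hp : ∀ x, 0 ≤ B x x) (x y : V) : |B x y| ≤ √(B x x) * √(B y y) := by
  rw [← Real.sqrt_mul (hp x)]
  apply Real.abs_le_sqrt
  have h : ∀ t : ℝ, 0 ≤ B y y * (t * t) + (2 * B x y) * t + B x x := fun t => by
    have := hp (x + t • y)
    simp only [map_add, map_smul, LinearMap.add_apply, LinearMap.smul_apply, smul_eq_mul] at this
    rw [hs y x] at this
    linarith
  have := discrim_le_zero h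
  rw [discrim] at this
  nlinarith

variable [FiniteDimensional ℝ V]

/-- Positivity makes the map into the dual injective, and the dimensions agree. This
finite-dimensional Riesz theorem inverts the mass and energy forms. -/
theorem exists_linearEquiv_dual (B : V →ₗ[ℝ] V →ₗ[ℝ] ℝ) (hp : ∀ x ≠ 0, 0 < B x x) :
    ∃ e : V ≃ₗ[ℝ] Module.Dual ℝ V, ∀ x y, e x y = B x y := by
  have hinj : Function.Injective B := by
    rw [injective_iff_map_eq_zero]
    intro x hx
    by_contra h
    have := hp x h
    simp [hx] at this
  exact ⟨LinearMap.linearEquivOfInjective B hinj Subspace.dual_finrank_eq.symm,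
    fun x y => by simp⟩

/-- A semidiscrete Galerkin system `I(m, ·) = a(u, ·)`, `I(m', ·) + F(m, u, ·) = 0`,
`I(m(0), ·) = ℓ` on `[0, T]`. -/
structure IsGalerkin (I a : V →ₗ[ℝ] V →ₗ[ℝ] ℝ) (F : V →ₗ[ℝ] V →ₗ[ℝ] V →ₗ[ℝ] ℝ) (ℓ : V →ₗ[ℝ] ℝ)
    (T : ℝ) (m u m' : ℝ → V) : Prop where
  deriv : ∀ t ∈ Icc 0 T, HasWeakDerivWithinAt m (m' t) (Icc 0 T) t
  eq : ∀ t ∈ Icc 0 T, ∀ φ, I (m t) φ = a (u t) φ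
  evolution : ∀ t ∈ Icc 0 T, ∀ φ, I (m' t) φ + F (m t) (u t) φ = 0
  initial : ∀ φ, I (m 0) φ = ℓ φ

section Existence

variable {I a : V →ₗ[ℝ] V →ₗ[ℝ] ℝ} {F : V →ₗ[ℝ] V →ₗ[ℝ] V →ₗ[ℝ] ℝ} {ℓ : V →ₗ[ℝ] ℝ} {T : ℝ}

/-- Let `A` be defined by `I(A u, ·) = a(u, ·)`, so that `m = A u`. Then `I(m', ·) = a(u', ·)` and
the system becomes `u' = G(u, u)` with `a(G(u, v), ·) = -F(A u, v, ·)`. The condition `hF` says that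
`G(u, u)` is `a`-orthogonal to `u`, which excludes blow-up. -/
theorem IsGalerkin.exists_unique (hI : ∀ x ≠ 0, 0 < I x x) (ha : ∀ x ≠ 0, 0 < a x x)
    (has : ∀ x y, a x y = a y x) (hF : ∀ m u, F m u u = 0) (hT : 0 < T) :
    (∃ m u m', IsGalerkin I a F ℓ T m u m') ∧
    ∀ m u m' n v n', IsGalerkin I a F ℓ T m u m' → IsGalerkin I a F ℓ T n v n' →
      EqOn m n (Icc 0 T) ∧ EqOn u v (Icc 0 T) := by
  obtain ⟨eI, heI⟩ := exists_linearEquiv_dual I hI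
  obtain ⟨ea, hea⟩ := exists_linearEquiv_dual a ha
  let A : V ≃ₗ[ℝ] V := ea.trans eI.symm
  have hA : ∀ u φ, I (A u) φ = a u φ := fun u φ => by
    rw [← heI, ← hea]; simp [A]
  have hAiff : ∀ m u, (∀ φ, I m φ = a u φ) → m = A u := fun m u h => by
    apply eI.injective
    ext φ
    rw [heI, heI, hA, h]
  let G : V →ₗ[ℝ] V →ₗ[ℝ] V := (F.comp A.toLinearMap).compr₂ (-ea.symm.toLinearMap)
  have hG : ∀ u v φ, a (G u v) φ = -F (A u) v φ := fun u v φ => by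
    rw [← hea]; simp [G]
  -- The energy form becomes the inner product of `V`, so the conserved norm is `√(a u u)`. In this
  -- finite-dimensional space weak and strong derivatives coincide.
  let core : InnerProductSpace.Core ℝ V :=
    { inner := fun x y => a x y
      conj_inner_symm := fun x y => by simp [has y x]
      re_inner_nonneg := fun x => by
        by_cases h : x = 0
        · simp [h]
        · simpa using (ha x h).le
      add_left := fun x y z => by simp
      smul_left := fun x y r => by simp
      definite := fun x h => by
        by_contra hx
        exact (ha x hx).ne' h }
  let : NormedAddCommGroup V := core.toNormedAddCommGroup
  let : InnerProductSpace ℝ V := InnerProductSpace.ofCore core.toCore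
  have hinner : ∀ x y : V, inner ℝ x y = a x y := fun _ _ => rfl
  have hlin : ∀ (θ : ℝ → V) (θ' : V) (s : Set ℝ) (t : ℝ),
      HasWeakDerivWithinAt θ θ' s t ↔ HasDerivWithinAt θ θ' s t := fun θ θ' s t => by
    constructor
    · intro h
      let b := Module.finBasis ℝ V
      have : θ = fun τ => ∑ i, b.coord i (θ τ) • b i := by
        ext τ; exact (b.sum_repr _).symm
      rw [this, ← b.sum_repr θ']
      exact HasDerivWithinAt.fun_sum fun i _ => (h (b.coord i)).smul_const (b i)
    · intro h l
      exact (LinearMap.toContinuousLinearMap l).hasFDerivAt.comp_hasDerivWithinAt t h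
  refine ⟨?_, ?_⟩
  · obtain ⟨u, hu0, hu⟩ := exists_solution_of_inner_eq_zero G
      (fun v => by rw [hinner, hG, hF, neg_zero]) hT (A.symm (eI.symm ℓ))
    refine ⟨fun t => A (u t), u, fun t => A (G (u t) (u t)), ?_, fun t _ φ => hA _ _, ?_, ?_⟩
    · intro t ht l
      exact (hlin _ _ _ _).2 (hu t ht) (l ∘ₗ A.toLinearMap)
    · intro t ht φ
      rw [hA, hG]; simp
    · intro φ
      rw [hu0, ← heI]; simp
  · have aux : ∀ m u m', IsGalerkin I a F ℓ T m u m' → u 0 = A.symm (eI.symm ℓ) ∧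
        (∀ t ∈ Icc 0 T, m t = A (u t)) ∧
        ∀ t ∈ Icc 0 T, HasDerivWithinAt u (G (u t) (u t)) (Icc 0 T) t := by
      intro m u m' h
      have hm : ∀ t ∈ Icc 0 T, m t = A (u t) := fun t ht => hAiff _ _ (h.eq t ht)
      refine ⟨?_, hm, fun t ht => ?_⟩
      · rw [← A.symm_apply_apply (u 0), ← hm 0 ⟨le_rfl, hT.le⟩]
        congr 1
        apply eI.injective
        ext φ
        rw [heI, h.initial]; simp
      · have h1 : HasDerivWithinAt (fun τ => A.symm (m τ)) (A.symm (m' t)) (Icc 0 T) t :=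
          (hlin _ _ _ _).1 fun l => h.deriv t ht (l ∘ₗ A.symm.toLinearMap)
        have h2 : A.symm (m' t) = G (u t) (u t) := by
          rw [LinearEquiv.symm_apply_eq]
          apply hAiff
          intro φ
          rw [hG, ← hm t ht]
          linarith [h.evolution t ht φ]
        rw [← h2]
        exact h1.congr (fun τ hτ => by simp [hm τ hτ]) (by simp [hm t ht])
    intro m u m' n v n' h k
    obtain ⟨h0, h1, h2⟩ := aux _ _ _ h
    obtain ⟨k0, k1, k2⟩ := aux _ _ _ k
    have huv := eqOn_of_quadratic_ode G (h0.trans k0.symm) h2 k2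
    exact ⟨fun t ht => by rw [h1 t ht, k1 t ht, huv ht], huv⟩

end Existence

/-- Error estimate for a semidiscrete Galerkin system: consistency of order `ε` and the weak
inverse estimate `hFH` give an error of order `ε`, provided that `H ε` is small. -/
theorem IsGalerkin.error_le {I a : V →ₗ[ℝ] V →ₗ[ℝ] ℝ} {F : V →ₗ[ℝ] V →ₗ[ℝ] V →ₗ[ℝ] ℝ}
    {ℓ : V →ₗ[ℝ] ℝ} {T : ℝ} {m u m' : ℝ → V} (h : IsGalerkin I a F ℓ T m u m')
    (hIs : ∀ x y, I x y = I y x) (hI : ∀ x, 0 ≤ I x x) (hIa : ∀ x, I x x ≤ a x x)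
    {M U M' : ℝ → V} {K H ε : ℝ} (hK : 0 ≤ K) (hH : 0 ≤ H) (hε : 0 < ε)
    (hM' : ∀ t ∈ Icc 0 T, HasWeakDerivWithinAt M (M' t) (Icc 0 T) t)
    (hU : ∀ t ∈ Icc 0 T, ∀ φ, |a (U t) φ - I (M t) φ| ≤ ε * √(a φ φ))
    (hM : ∀ t ∈ Icc 0 T, ∀ φ, |I (M' t) φ + F (M t) (U t) φ| ≤ ε * √(I φ φ))
    (hFU : ∀ t ∈ Icc 0 T, ∀ θ, |F θ (U t) θ| ≤ K * I θ θ)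
    (hFM : ∀ t ∈ Icc 0 T, ∀ ξ θ, |F (M t) ξ θ| ≤ K * √(a ξ ξ) * √(I θ θ))
    (hFH : ∀ ξ θ, |F θ ξ θ| ≤ H * √(a ξ ξ) * I θ θ)
    (h0 : √(I (m 0 - M 0) (m 0 - M 0)) ≤ ε)
    (hsmall : H * (ε * (Real.exp ((3 * K + 3) * T) + 1)) ≤ 1) :
    ∀ t ∈ Icc 0 T, √(I (m t - M t) (m t - M t)) ≤ ε * Real.exp ((3 * K + 3) * T) ∧
      √(a (u t - U t) (u t - U t)) ≤ ε * (Real.exp ((3 * K + 3) * T) + 1) := by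
  -- The terms `F θ U θ`, `F M ξ θ`, `F θ ξ θ` and the consistency error contribute `K`, `2K`, `1`
  -- and `1`; the remaining unit makes the inequality at a contact point strict.
  set L := 3 * K + 3 with hL
  have hL0 : 0 < L := by positivity
  have ha : ∀ x, 0 ≤ a x x := fun x => (hI x).trans (hIa x)
  -- Subtract the two elliptic equations, test with `ξ` itself, and divide by `√(a ξ ξ)`.
  have hξ : ∀ t ∈ Icc 0 T, √(a (u t - U t) (u t - U t)) ≤
      √(I (m t - M t) (m t - M t)) + ε := by
    intro t ht
    set ξ := u t - U t
    set θ := m t - M t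
    have e1 : a ξ ξ = I θ ξ - (a (U t) ξ - I (M t) ξ) := by
      have := h.eq t ht ξ
      have e2 : a ξ ξ = a (u t) ξ - a (U t) ξ := by
        conv_lhs => rw [show a ξ = a (u t) - a (U t) from map_sub _ _ _]
        rfl
      have e3 : I θ ξ = I (m t) ξ - I (M t) ξ := by
        rw [show I θ = I (m t) - I (M t) from map_sub _ _ _]; rfl
      linarith
    have e2 := abs_le_sqrt_mul_sqrt I hIs hI θ ξ
    have e3 := hU t ht ξ
    have e4 : √(I ξ ξ) ≤ √(a ξ ξ) := Real.sqrt_le_sqrt (hIa ξ)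
    have e5 := Real.mul_self_sqrt (ha ξ)
    have e6 : √(a ξ ξ) * √(a ξ ξ) ≤ (√(I θ θ) + ε) * √(a ξ ξ) := by
      rw [e5]
      have := mul_le_mul_of_nonneg_left e4 (Real.sqrt_nonneg (I θ θ))
      linarith [abs_le.1 e2, abs_le.1 e3]
    by_contra hcon
    push Not at hcon
    have : 0 < √(a ξ ξ) := lt_of_le_of_lt (by positivity) hcon
    nlinarith
  have hy : ∀ t ∈ Icc 0 T, I (m t - M t) (m t - M t) ≤ ε ^ 2 * Real.exp (2 * L * t) := by
    have hd : ∀ t ∈ Icc 0 T, HasDerivWithinAt (fun t => I (m t - M t) (m t - M t))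
        (2 * I (m' t - M' t) (m t - M t)) (Icc 0 T) t := by
      intro t ht
      have hs := (h.deriv t ht).sub (hM' t ht)
      have := hs.apply₂ I hs
      rwa [hIs (m t - M t) (m' t - M' t), ← two_mul] at this
    -- Barrier argument with `ε² exp(2 L t)`: the differential inequality is needed only at times
    -- where `I θ θ` equals the barrier. There `√(I θ θ)` is known exactly, lies between `ε` and `ε
    -- exp(L T)`, and the smallness assumption is available without a continuation argument.
    refine image_le_of_deriv_right_lt_deriv_boundary
      (f' := fun t => 2 * I (m' t - M' t) (m t - M t))
      (B' := fun t => ε ^ 2 * (Real.exp (2 * L * t) * (2 * L)))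
      (fun t ht => (hd t ht).continuousWithinAt)
      (fun t ht => (hd t (Ico_subset_Icc_self ht)).mono_of_mem_nhdsWithin
        (Icc_mem_nhdsGE_of_mem ht)) ?_ ?_ ?_
    · have := (Real.sqrt_le_left hε.le).1 h0
      simpa using this
    · intro t
      have : HasDerivAt (fun t => 2 * L * t) (2 * L) t := by
        simpa using (hasDerivAt_id t).const_mul (2 * L)
      exact this.exp.const_mul _
    · intro t ht' hyt
      have ht := Ico_subset_Icc_self ht'
      set θ := m t - M t with hθ
      set ξ := u t - U t with hξdef
      set s := √(I θ θ) with hs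
      have hss : s * s = I θ θ := Real.mul_self_sqrt (hI θ)
      have hsexp : s = ε * Real.exp (L * t) := by
        rw [hs, hyt, show ε ^ 2 * Real.exp (2 * L * t) = (ε * Real.exp (L * t)) ^ 2 by
          rw [mul_pow, ← Real.exp_nat_mul]; congr 2; push_cast; ring]
        exact Real.sqrt_sq (by positivity)
      have hεs : ε ≤ s := by
        rw [hsexp]
        have : 1 ≤ Real.exp (L * t) := Real.one_le_exp (mul_nonneg hL0.le ht.1)
        nlinarith
      have hsT : s ≤ ε * Real.exp (L * T) := by
        rw [hsexp]
        have : Real.exp (L * t) ≤ Real.exp (L * T) :=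
          Real.exp_le_exp.2 (mul_le_mul_of_nonneg_left ht.2 hL0.le)
        nlinarith
      have hspos : 0 < s := hε.trans_le hεs
      -- Expansion of `F (M + θ) (U + ξ)` by bilinearity: two terms linear in the error, one
      -- quadratic, and the residual of `(M, U)`.
      have e1 : I (m' t - M' t) θ =
          -(F θ (U t) θ + F (M t) ξ θ + F θ ξ θ) - (I (M' t) θ + F (M t) (U t) θ) := by
        have e := h.evolution t ht θ
        have hm : m t = M t + θ := by simp [hθ]
        have hu : u t = U t + ξ := by simp [hξdef]
        rw [hm, hu] at e
        simp only [map_add, LinearMap.add_apply] at e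
        simp only [map_sub, LinearMap.sub_apply]
        linarith
      have b1 := hFU t ht θ
      have b2 := hFM t ht ξ θ
      have b3 := hFH ξ θ
      have b4 := hM t ht θ
      have bξ := hξ t ht
      rw [← hξdef, ← hθ, ← hs] at bξ
      rw [← hs] at b2 b4
      rw [← hss] at b1 b3
      have c2 : K * √(a ξ ξ) * s ≤ K * (2 * s) * s := by
        gcongr; linarith
      -- The quadratic term, controlled by `hsmall` since `√(a ξ ξ) ≤ s + ε ≤ ε (exp(L T) + 1)`.
      have c3 : H * √(a ξ ξ) * (s * s) ≤ 1 * (s * s) := by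
        gcongr
        refine le_trans ?_ hsmall
        gcongr
        linarith
      have c4 : ε * s ≤ s * s := by gcongr
      have e3 : ε ^ 2 * (Real.exp (2 * L * t) * (2 * L)) = 2 * (L * (s * s)) := by
        rw [hss, hyt]; ring
      change 2 * I (m' t - M' t) θ < ε ^ 2 * (Real.exp (2 * L * t) * (2 * L))
      rw [e3, e1]
      have := mul_pos hspos hspos
      rw [hL]
      linarith [abs_le.1 b1, abs_le.1 b2, abs_le.1 b3, abs_le.1 b4]
  intro t ht
  have h1 : √(I (m t - M t) (m t - M t)) ≤ ε * Real.exp (L * T) := by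
    rw [Real.sqrt_le_left (by positivity), mul_pow, ← Real.exp_nat_mul]
    refine (hy t ht).trans (mul_le_mul_of_nonneg_left (Real.exp_le_exp.2 ?_) (sq_nonneg _))
    push_cast
    nlinarith [mul_le_mul_of_nonneg_left ht.2 hL0.le]
  exact ⟨h1, (hξ t ht).trans (by linarith)⟩

end AbstractGalerkin

section

open MeasureTheory intervalIntegral

/-! ### Polynomials of bounded degree and backward differences. -/

section PolynomialLemmas

open Polynomial

theorem mem_degreeLT_iff_coeff {k : ℕ} {p : ℝ[X]} :
    p ∈ degreeLT ℝ k ↔ ∀ m, k ≤ m → p.coeff m = 0 := by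
  rw [mem_degreeLT, degree_lt_iff_coeff_zero]

theorem mem_degreeLT_succ_of_derivative {k : ℕ} {p : ℝ[X]} (h : derivative p ∈ degreeLT ℝ k) :
    p ∈ degreeLT ℝ (k + 1) := by
  rw [mem_degreeLT_iff_coeff] at h ⊢
  intro m hm
  obtain ⟨j, rfl⟩ : ∃ j, m = j + 1 := ⟨m - 1, by omega⟩
  have := h j (by omega)
  rw [coeff_derivative] at this
  have h2 : ((j : ℝ) + 1) ≠ 0 := by positivity
  exact (mul_eq_zero.1 this).resolve_right h2

theorem derivative_mem_degreeLT {k : ℕ} {p : ℝ[X]} (h : p ∈ degreeLT ℝ (k + 1)) :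
    derivative p ∈ degreeLT ℝ k := by
  rw [mem_degreeLT_iff_coeff] at h ⊢
  intro m hm
  rw [coeff_derivative, h (m + 1) (by omega), zero_mul]

theorem exists_antiderivative {k : ℕ} {p : ℝ[X]} (h : p ∈ degreeLT ℝ k) (c : ℝ) :
    ∃ q ∈ degreeLT ℝ (k + 1), derivative q = p ∧ q.eval 0 = c := by
  have key : ∃ q : ℝ[X], derivative q = p := by
    refine ⟨∑ i ∈ p.support, monomial (i + 1) (p.coeff i / (i + 1)), ?_⟩
    conv_rhs => rw [p.as_sum_support]
    rw [derivative_sum]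
    refine Finset.sum_congr rfl fun i _ => ?_
    rw [derivative_monomial]
    congr 1
    push_cast
    field_simp
  obtain ⟨q, hq⟩ := key
  have hd : derivative (q + C (c - q.eval 0)) = p := by simp [hq]
  exact ⟨q + C (c - q.eval 0), mem_degreeLT_succ_of_derivative (hd ▸ h), hd, by simp⟩

theorem comp_X_sub_C_mem_degreeLT {k : ℕ} {p : ℝ[X]} (h : p ∈ degreeLT ℝ k) (a : ℝ) :
    p.comp (X - C a) ∈ degreeLT ℝ k := by
  induction k generalizing p with
  | zero =>
    have : p = 0 := by simpa [degreeLT] using (mem_degreeLT.1 h)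
    simp [this]
  | succ k ih =>
    apply mem_degreeLT_succ_of_derivative
    rw [derivative_comp]
    simpa using ih (derivative_mem_degreeLT h)

theorem exists_eq_C_of_mem_degreeLT_one {p : ℝ[X]} (h : p ∈ degreeLT ℝ 1) : ∃ a, p = C a := by
  refine ⟨p.coeff 0, ?_⟩
  ext m
  rw [coeff_C]
  split_ifs with hm
  · rw [hm]
  · exact mem_degreeLT_iff_coeff.1 h m (by omega)

/-- The backward difference of a polynomial agrees with its derivative up to lower order. -/
theorem derivative_sub_backwardDiff_mem {k : ℕ} {p : ℝ[X]} (h : p ∈ degreeLT ℝ (k + 2)) :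
    derivative p - (p - p.comp (X - C 1)) ∈ degreeLT ℝ k := by
  induction k generalizing p with
  | zero =>
    have h2 : derivative p ∈ degreeLT ℝ 1 := derivative_mem_degreeLT h
    obtain ⟨a, ha⟩ := exists_eq_C_of_mem_degreeLT_one h2
    have hp : p = C a * X + C (p.eval 0) := by
      have hd : derivative (p - (C a * X + C (p.eval 0))) = 0 := by simp [ha]
      have hc := derivative_eq_zero.1 hd
      rw [← sub_eq_zero, eq_C_of_natDegree_eq_zero hc, coeff_zero_eq_eval_zero]
      simp
    have : derivative p - (p - p.comp (X - C 1)) = 0 := by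
      rw [ha, hp]
      simp
      ring
    rw [this]; exact Submodule.zero_mem _
  -- Differentiation commutes with the backward difference, so the claim for the derivative of `p`
  -- is the derivative of the claim for `p`.
  | succ k ih =>
    apply mem_degreeLT_succ_of_derivative
    have := ih (derivative_mem_degreeLT h)
    convert this using 1
    simp [derivative_comp]

end PolynomialLemmas

/-! ### The spline operator on the unit mesh. -/

section UnitScale

/-- Piecewise constant interpolation at the integers. -/
def sample (f : ℝ → ℝ) : ℝ → ℝ := fun x => f ⌊x⌋

/-- The average over the preceding unit interval. -/
def movingAverage (f : ℝ → ℝ) : ℝ → ℝ := fun x => ∫ y in (x - 1)..x, f y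

theorem measurable_sample (f : ℝ → ℝ) : Measurable (sample f) :=
  (measurable_from_top (f := fun n : ℤ => f n)).comp Int.measurable_floor

theorem intervalIntegrable_sample (f : ℝ → ℝ) (a b : ℝ) :
    IntervalIntegrable (sample f) volume a b := by
  rw [intervalIntegrable_iff]
  refine Measure.integrableOn_of_bounded (M := ∑ j ∈ Finset.Icc ⌊min a b⌋ ⌊max a b⌋, |f j|)
    (by simp [uIoc]) (measurable_sample f).aestronglyMeasurable ?_
  refine (ae_restrict_iff' measurableSet_uIoc).2 (Filter.Eventually.of_forall fun x hx => ?_)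
  have : ⌊x⌋ ∈ Finset.Icc ⌊min a b⌋ ⌊max a b⌋ :=
    Finset.mem_Icc.2 ⟨Int.floor_le_floor hx.1.le, Int.floor_le_floor hx.2⟩
  exact Finset.single_le_sum (f := fun j : ℤ => |f j|) (fun _ _ => abs_nonneg _) this

theorem movingAverage_eq {f : ℝ → ℝ} (hf : ∀ a b, IntervalIntegrable f volume a b) (c x : ℝ) :
    movingAverage f x = (∫ y in c..x, f y) - ∫ y in c..(x - 1), f y :=
  (integral_interval_sub_left (hf _ _) (hf _ _)).symm

theorem continuous_movingAverage {f : ℝ → ℝ} (hf : ∀ a b, IntervalIntegrable f volume a b) :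
    Continuous (movingAverage f) := by
  have h := continuous_primitive hf 0
  rw [show movingAverage f = fun x => (∫ y in (0 : ℝ)..x, f y) - ∫ y in (0 : ℝ)..(x - 1), f y from
    funext fun x => movingAverage_eq hf 0 x]
  exact h.sub (h.comp (continuous_id.sub continuous_const))

theorem hasDerivAt_movingAverage {f : ℝ → ℝ} (hf : ∀ a b, IntervalIntegrable f volume a b)
    (hm : Measurable f) {x : ℝ} (h1 : ContinuousAt f x) (h2 : ContinuousAt f (x - 1)) :
    HasDerivAt (movingAverage f) (f x - f (x - 1)) x := by
  rw [show movingAverage f = fun x => (∫ y in (0 : ℝ)..x, f y) - ∫ y in (0 : ℝ)..(x - 1), f y from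
    funext fun x => movingAverage_eq hf 0 x]
  have a1 := integral_hasDerivAt_right (hf 0 x) hm.stronglyMeasurable.stronglyMeasurableAtFilter h1
  have a2 := integral_hasDerivAt_right (hf 0 (x - 1))
    hm.stronglyMeasurable.stronglyMeasurableAtFilter h2
  have a3 : HasDerivAt (fun x : ℝ => x - 1) 1 x := (hasDerivAt_id x).sub_const 1
  have := a1.sub (a2.comp x a3)
  rw [mul_one] at this
  exact this

theorem intervalIntegrable_iterate_movingAverage (n : ℕ) (f : ℝ → ℝ) :
    Measurable (movingAverage^[n] (sample f)) ∧
      ∀ a b, IntervalIntegrable (movingAverage^[n] (sample f)) volume a b := by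
  induction n with
  | zero => exact ⟨measurable_sample f, intervalIntegrable_sample f⟩
  | succ n ih =>
    rw [Function.iterate_succ_apply']
    have := continuous_movingAverage ih.2
    exact ⟨this.measurable, fun a b => this.intervalIntegrable a b⟩

/-- The spline of degree `n` with integer knots obtained by averaging the piecewise constant
interpolant `n` times. -/
def splineOp (n : ℕ) : (ℝ → ℝ) →ₗ[ℝ] (ℝ → ℝ) where
  toFun f := movingAverage^[n] (sample f)
  map_add' f g := by
    induction n with
    | zero => rfl
    | succ n ih =>
      simp only [Function.iterate_succ_apply']
      ext x
      rw [ih]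
      exact integral_add ((intervalIntegrable_iterate_movingAverage n f).2 _ _)
        ((intervalIntegrable_iterate_movingAverage n g).2 _ _)
  map_smul' c f := by
    induction n with
    | zero => rfl
    | succ n ih =>
      simp only [Function.iterate_succ_apply']
      ext x
      rw [ih]
      exact integral_const_mul _ _

theorem splineOp_zero (f : ℝ → ℝ) : splineOp 0 f = sample f := rfl

theorem splineOp_succ (n : ℕ) (f : ℝ → ℝ) :
    splineOp (n + 1) f = movingAverage (splineOp n f) :=
  Function.iterate_succ_apply' _ _ _

theorem measurable_splineOp (n : ℕ) (f : ℝ → ℝ) : Measurable (splineOp n f) :=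
  (intervalIntegrable_iterate_movingAverage n f).1

theorem intervalIntegrable_splineOp (n : ℕ) (f : ℝ → ℝ) (a b : ℝ) :
    IntervalIntegrable (splineOp n f) volume a b :=
  (intervalIntegrable_iterate_movingAverage n f).2 a b

theorem continuous_splineOp_succ (n : ℕ) (f : ℝ → ℝ) : Continuous (splineOp (n + 1) f) := by
  rw [splineOp_succ]
  exact continuous_movingAverage (intervalIntegrable_splineOp n f)

theorem splineOp_congr {n : ℕ} {f g : ℝ → ℝ} (h : ∀ j : ℤ, f j = g j) :
    splineOp n f = splineOp n g := by
  have : sample f = sample g := funext fun x => h _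
  exact congrArg (fun g => movingAverage^[n] g) this

/-- The derivative of a moving average is a backward difference, so each averaging gains one
derivative; the first merely turns a step function into a continuous one. -/
theorem contDiff_splineOp_succ (n : ℕ) (f : ℝ → ℝ) : ContDiff ℝ n (splineOp (n + 1) f) := by
  induction n with
  | zero => exact contDiff_zero.2 (continuous_splineOp_succ 0 f)
  | succ n ih =>
    have hd : ∀ x, HasDerivAt (splineOp (n + 2) f)
        (splineOp (n + 1) f x - splineOp (n + 1) f (x - 1)) x := fun x => by
      rw [splineOp_succ]
      exact hasDerivAt_movingAverage (intervalIntegrable_splineOp _ f) (measurable_splineOp _ f)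
        (continuous_splineOp_succ n f).continuousAt (continuous_splineOp_succ n f).continuousAt
    have h1 : ((n + 1 : ℕ) : WithTop ℕ∞) = (n : WithTop ℕ∞) + 1 := by push_cast; rfl
    rw [h1, contDiff_succ_iff_deriv]
    refine ⟨fun x => (hd x).differentiableAt, by simp, ?_⟩
    rw [show deriv (splineOp (n + 1 + 1) f) = _ from funext fun x => (hd x).deriv]
    exact ih.sub (ih.comp (contDiff_id.sub contDiff_const))

theorem continuousAt_sample (f : ℝ → ℝ) {i : ℤ} {s : ℝ} (hs : s ∈ Ioo (0 : ℝ) 1) :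
    ContinuousAt (sample f) (i + s) := by
  have : sample f =ᶠ[nhds (i + s)] fun _ => f i := by
    filter_upwards [Ioo_mem_nhds (show (i : ℝ) < i + s by linarith [hs.1])
      (show (i : ℝ) + s < i + 1 by linarith [hs.2])] with y hy
    have : ⌊y⌋ = i := Int.floor_eq_iff.2 ⟨hy.1.le, hy.2⟩
    simp [sample, this]
  exact continuousAt_const.congr this.symm

/-- The restriction to cell interiors is needed only for `n = 0`, where the averaged function is a
step function that may jump at the integers. -/
theorem hasDerivAt_splineOp_succ (n : ℕ) (f : ℝ → ℝ) {i : ℤ} {s : ℝ} (hs : s ∈ Ioo (0 : ℝ) 1) :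
    HasDerivAt (splineOp (n + 1) f) (splineOp n f (i + s) - splineOp n f (i + s - 1)) (i + s) := by
  rw [splineOp_succ]
  cases n with
  | zero =>
    refine hasDerivAt_movingAverage (intervalIntegrable_splineOp _ f) (measurable_splineOp _ f)
      (continuousAt_sample f hs) ?_
    have := continuousAt_sample f (i := i - 1) hs
    push_cast at this
    rwa [show (i : ℝ) + s - 1 = i - 1 + s by ring]
  | succ n =>
    exact hasDerivAt_movingAverage (intervalIntegrable_splineOp _ f) (measurable_splineOp _ f)
        (continuous_splineOp_succ n f).continuousAt (continuous_splineOp_succ n f).continuousAt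

theorem splineOp_shift (n : ℕ) (f : ℝ → ℝ) (k : ℤ) (x : ℝ) :
    splineOp n (fun y => f (y + k)) x = splineOp n f (x + k) := by
  induction n generalizing x with
  | zero => simp [splineOp_zero, sample]
  | succ n ih =>
    simp only [splineOp_succ, movingAverage, ih]
    rw [integral_comp_add_right]
    congr 1; ring

/-- Averaging is a contraction in the sup norm. The window has length `n + 1`: one unit for each of
the `n` averages and one for the floor. -/
theorem abs_splineOp_le {n : ℕ} {f : ℝ → ℝ} {ε x : ℝ}
    (h : ∀ y ∈ Icc (x - (n + 1)) x, |f y| ≤ ε) : |splineOp n f x| ≤ ε := by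
  induction n generalizing x with
  | zero =>
    exact h _ ⟨by push_cast; linarith [Int.lt_floor_add_one x], Int.floor_le x⟩
  | succ n ih =>
    rw [splineOp_succ]
    have : ∀ y ∈ uIoc (x - 1) x, ‖splineOp n f y‖ ≤ ε := fun y hy => by
      rw [uIoc_of_le (by linarith)] at hy
      refine ih fun z hz => h z ⟨?_, hz.2.trans hy.2⟩
      push_cast
      linarith [hz.1, hy.1]
    simpa [movingAverage] using norm_integral_le_of_norm_le_const this

open Polynomial in
-- The interval of length one ending at `i + s` is split at the knot `i`. With `P`, `Q` the
-- antiderivatives of the polynomials on the previous and the present cell, the average is `P(1) -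
-- P(s) + Q(s)`. The cell is half-open because sampling by the floor is right-continuous.
theorem exists_splineOp_eq_eval (n : ℕ) (f : ℝ → ℝ) (i : ℤ) :
    ∃ q ∈ degreeLT ℝ (n + 1), ∀ s ∈ Ico (0 : ℝ) 1, splineOp n f (i + s) = q.eval s := by
  induction n generalizing i with
  | zero =>
    refine ⟨C (f i), mem_degreeLT.2 (degree_C_le.trans_lt (by norm_num)), fun s hs => ?_⟩
    have : ⌊(i : ℝ) + s⌋ = i := Int.floor_eq_iff.2 ⟨by linarith [hs.1], by linarith [hs.2]⟩
    simp [splineOp_zero, sample, this]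
  | succ n ih =>
    obtain ⟨q, hq, hqe⟩ := ih i
    obtain ⟨p, hp, hpe⟩ := ih (i - 1)
    obtain ⟨Q, hQ, hQd, hQ0⟩ := exists_antiderivative hq 0
    obtain ⟨P, hP, hPd, hP0⟩ := exists_antiderivative hp 0
    have hint := intervalIntegrable_splineOp n f
    have primitive : ∀ (R r : ℝ[X]) (j : ℤ), derivative R = r → R.eval 0 = 0 →
        (∀ s ∈ Ico (0 : ℝ) 1, splineOp n f (j + s) = r.eval s) → ∀ s ∈ Icc (0 : ℝ) 1,
        ∫ y in (j : ℝ)..(j + s), splineOp n f y = R.eval s := by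
      intro R r j hR hR0 hr s hs
      have h1 : ∫ y in (j : ℝ)..(j + s), splineOp n f y = ∫ y in (0 : ℝ)..s, r.eval y := by
        rw [show (∫ y in (0 : ℝ)..s, r.eval y) = ∫ y in (0 : ℝ)..s, splineOp n f (j + y) from ?_]
        · rw [integral_comp_add_left]; simp
        · refine integral_congr_ae ?_
          have : ∀ᵐ y : ℝ, y ≠ 1 := by simp [ae_iff]
          filter_upwards [this] with y hy1 hy
          rw [uIoc_of_le hs.1] at hy
          exact (hr y ⟨hy.1.le, lt_of_le_of_ne (hy.2.trans hs.2) hy1⟩).symm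
      rw [h1, integral_eq_sub_of_hasDerivAt (f := fun y => R.eval y)
        (fun y _ => hR ▸ R.hasDerivAt y) (r.continuous.intervalIntegrable _ _), hR0, sub_zero]
    refine ⟨Q + C (P.eval 1) - P, ?_, fun s hs => ?_⟩
    · refine Submodule.sub_mem _ (Submodule.add_mem _ hQ ?_) hP
      exact mem_degreeLT.2 (degree_C_le.trans_lt (by exact_mod_cast Nat.succ_pos _))
    · have hs' := Ico_subset_Icc_self hs
      rw [splineOp_succ, movingAverage_eq hint (((i - 1 : ℤ)) : ℝ)]
      have e1 := primitive P p (i - 1) hPd hP0 hpe 1 ⟨zero_le_one, le_rfl⟩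
      have e2 := primitive P p (i - 1) hPd hP0 hpe s hs'
      have e3 := primitive Q q i hQd hQ0 hqe s hs'
      have e4 := integral_add_adjacent_intervals (hint ((i - 1 : ℤ) : ℝ) (i : ℝ)) (hint i (i + s))
      rw [show (((i - 1 : ℤ)) : ℝ) + 1 = i by push_cast; ring] at e1
      rw [← e4, e1, e3, show (i : ℝ) + s - 1 = ((i - 1 : ℤ) : ℝ) + s by push_cast; ring, e2]
      simp
      ring

open Polynomial in
theorem exists_splineOp_succ_eq_eval (n : ℕ) (f : ℝ → ℝ) (i : ℤ) :
    ∃ q ∈ degreeLT ℝ (n + 2), ∀ s ∈ Icc (0 : ℝ) 1, splineOp (n + 1) f (i + s) = q.eval s := by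
  obtain ⟨q, hq, hqe⟩ := exists_splineOp_eq_eval (n + 1) f i
  refine ⟨q, hq, ?_⟩
  have h1 : Continuous fun s : ℝ => splineOp (n + 1) f (i + s) :=
    (continuous_splineOp_succ n f).comp (continuous_const.add continuous_id)
  have h0 : EqOn (fun s : ℝ => splineOp (n + 1) f (i + s)) (fun s => q.eval s)
      (Ico (0 : ℝ) 1) := fun s hs => hqe s hs
  have := h0.closure h1 q.continuous
  rwa [closure_Ico zero_ne_one] at this

theorem splineOp_const (n : ℕ) (c : ℝ) : splineOp n (fun _ => c) = fun _ => c := by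
  induction n with
  | zero => rfl
  | succ n ih => rw [splineOp_succ, ih]; ext x; simp [movingAverage]

/-- An integrated form of the rule that the derivative of a spline of degree `n + 1` is the spline
of degree `n` of the backward differences. Integrating avoids any statement at the knots. -/
theorem splineOp_succ_eq_integral (n : ℕ) (f : ℝ → ℝ) (x : ℝ) :
    splineOp (n + 1) f x =
      splineOp (n + 1) f 0 + ∫ y in (0 : ℝ)..x, splineOp n (fun y => f y - f (y - 1)) y := by
  have hint := intervalIntegrable_splineOp n f
  have h1 : ∀ y, splineOp n (fun y => f y - f (y - 1)) y = splineOp n f y - splineOp n f (y - 1) := by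
    intro y
    have := splineOp_shift n f (-1) y
    simp only [Int.reduceNeg, Int.cast_neg, Int.cast_one, ← sub_eq_add_neg] at this
    rw [← this, ← Pi.sub_apply, ← map_sub]
    rfl
  simp only [h1]
  have h2 : IntervalIntegrable (fun y => splineOp n f (y - 1)) volume 0 x :=
    (hint (0 - 1) (x - 1)).comp_sub_right 1 |> fun h => by simpa using h
  rw [integral_sub (hint _ _) h2, integral_comp_sub_right (fun y => splineOp n f y) 1,
    splineOp_succ, movingAverage_eq hint 0 x, movingAverage_eq hint 0 0]
  have := integral_add_adjacent_intervals (hint 0 (0 - 1)) (hint (0 - 1) (x - 1))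
  simp only [integral_same]
  linarith

open Polynomial in
-- The operator preserves the leading term. Indeed the derivative of `S p` is the lower-degree
-- operator applied to the backward difference of `p`; by induction this is the difference itself up
-- to lower order, and the difference is `p'` up to lower order.
theorem exists_splineOp_eval (n : ℕ) : ∀ d ≤ n, ∀ p ∈ degreeLT ℝ (d + 1),
    ∃ q ∈ degreeLT ℝ d, splineOp n (fun x => p.eval x) = fun x => p.eval x - q.eval x := by
  induction n with
  | zero =>
    intro d hd p hp
    obtain rfl : d = 0 := by omega
    obtain ⟨c, rfl⟩ := exists_eq_C_of_mem_degreeLT_one hp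
    exact ⟨0, Submodule.zero_mem _, by simp [splineOp_const]⟩
  | succ n ih =>
    intro d hd p hp
    rcases d with _ | e
    · obtain ⟨c, rfl⟩ := exists_eq_C_of_mem_degreeLT_one hp
      exact ⟨0, Submodule.zero_mem _, by simp [splineOp_const]⟩
    · have hD := derivative_sub_backwardDiff_mem hp
      have hN : p - p.comp (X - C 1) ∈ degreeLT ℝ (e + 1) := by
        have h1 := derivative_mem_degreeLT hp
        have h2 := degreeLT_mono (R := ℝ) (Nat.le_succ e) hD
        simpa using Submodule.sub_mem _ h1 h2
      obtain ⟨q, hq, hqe⟩ := ih e (by omega) _ hN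
      -- `R` is to be `p - S p`: its derivative is prescribed by the two lower-order corrections,
      -- and the constant is fixed by the value at 0.
      obtain ⟨R, hR, hRd, hR0⟩ := exists_antiderivative (Submodule.add_mem _ hD hq)
        (p.eval 0 - splineOp (n + 1) (fun x => p.eval x) 0)
      refine ⟨R, hR, funext fun x => ?_⟩
      rw [splineOp_succ_eq_integral]
      have e1 : (fun y => p.eval y - p.eval (y - 1)) = fun y => (p - p.comp (X - C 1)).eval y := by
        ext y; simp
      rw [e1, hqe]
      rw [integral_eq_sub_of_hasDerivAt (f := fun y => (p - R).eval y)]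
      · simp only [eval_sub, hR0]; ring
      · intro y _
        refine ((p - R).hasDerivAt y).congr_deriv ?_
        simp only [derivative_sub, hRd, eval_sub, eval_add]
        ring
      · exact (((p - p.comp (X - C 1)).continuous).sub q.continuous).intervalIntegrable _ _

end UnitScale

end

section

open MeasureTheory intervalIntegral

/-! ### Taylor polynomials with simultaneous control of the derivative. -/

section Taylor

open Polynomial

theorem abs_le_of_abs_deriv_le_pow {g g' : ℝ → ℝ} {K x₀ : ℝ} {m : ℕ}
    (hg : ∀ z, HasDerivAt g (g' z) z) (h0 : g x₀ = 0) (hb : ∀ z, |g' z| ≤ K * |z - x₀| ^ m)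
    (hK : 0 ≤ K) (y : ℝ) : |g y| ≤ K * |y - x₀| ^ (m + 1) := by
  have := (convex_uIcc x₀ y).norm_image_sub_le_of_norm_hasDerivWithin_le
    (f := g) (f' := g') (C := K * |y - x₀| ^ m) (fun z _ => (hg z).hasDerivWithinAt)
    (fun z hz => (hb z).trans (mul_le_mul_of_nonneg_left
      (pow_le_pow_left₀ (abs_nonneg _) (abs_sub_left_of_mem_uIcc hz) m) hK)) left_mem_uIcc right_mem_uIcc
  rw [h0, sub_zero] at this
  calc |g y| ≤ K * |y - x₀| ^ m * |y - x₀| := this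
    _ = _ := by ring

/-- The polynomial is obtained by integrating the one for `f'`, so the same polynomial approximates
`f` and, after differentiation, `f'`. The top coefficient is recorded because it carries the leading
error term. The factorial in the remainder is given up. -/
theorem exists_taylor (m : ℕ) {f : ℝ → ℝ} {K : ℝ} (hf : ContDiff ℝ (m + 1 : ℕ) f)
    (hK : ∀ y, |iteratedDeriv (m + 1) f y| ≤ K) (x₀ : ℝ) :
    ∃ p ∈ degreeLT ℝ (m + 1), (∀ y, |f y - p.eval (y - x₀)| ≤ K * |y - x₀| ^ (m + 1)) ∧
      (∀ y, |deriv f y - (derivative p).eval (y - x₀)| ≤ K * |y - x₀| ^ m) ∧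
      p.coeff m = iteratedDeriv m f x₀ / m.factorial := by
  have hK0 : 0 ≤ K := (abs_nonneg _).trans (hK 0)
  have shift : ∀ (p : ℝ[X]) y, HasDerivAt (fun y => p.eval (y - x₀))
      ((derivative p).eval (y - x₀)) y := fun p y => by
    have := (p.hasDerivAt (y - x₀)).comp y ((hasDerivAt_id y).sub_const x₀)
    rw [mul_one] at this
    exact this
  induction m generalizing f with
  | zero =>
    have hd : ∀ y, HasDerivAt f (deriv f y) y := fun y =>
      (hf.differentiable (by simp)).differentiableAt.hasDerivAt
    have hb : ∀ y, |deriv f y - (derivative (C (f x₀))).eval (y - x₀)| ≤ K * |y - x₀| ^ 0 := by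
      intro y
      simpa using hK y
    refine ⟨C (f x₀), mem_degreeLT.2 (degree_C_le.trans_lt (by norm_num)), ?_, hb, by simp⟩
    exact abs_le_of_abs_deriv_le_pow (fun z => (hd z).sub (shift _ z)) (by simp) hb hK0
  | succ m ih =>
    have hd : ∀ y, HasDerivAt f (deriv f y) y := fun y =>
      (hf.differentiable (by simp)).differentiableAt.hasDerivAt
    have hf' : ContDiff ℝ (m + 1 : ℕ) (deriv f) := by
      have h1 : ((m + 1 + 1 : ℕ) : WithTop ℕ∞) = ((m + 1 : ℕ) : WithTop ℕ∞) + 1 := by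
        push_cast; rfl
      rw [h1, contDiff_succ_iff_deriv] at hf
      exact hf.2.2
    obtain ⟨p, hp, hpb, -, hpc⟩ := ih hf' (fun y => by rw [← iteratedDeriv_succ']; exact hK y)
    obtain ⟨P, hP, hPd, hP0⟩ := exists_antiderivative hp (f x₀)
    rw [← hPd] at hpb
    refine ⟨P, hP, ?_, hpb, ?_⟩
    · exact abs_le_of_abs_deriv_le_pow (fun z => (hd z).sub (shift _ z)) (by simp [hP0]) hpb hK0
    · rw [← hPd, coeff_derivative, ← iteratedDeriv_succ'] at hpc
      have h2 : ((m : ℝ) + 1) ≠ 0 := by positivity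
      rw [eq_div_iff (by positivity)] at hpc ⊢
      rw [← hpc, Nat.factorial_succ]
      push_cast
      ring

end Taylor

/-! ### Error of the quasi-interpolant on the unit mesh. -/

section SplineError

open Polynomial

/-- The defect `1 - S` of the spline operator. -/
def splineDefect (n : ℕ) : Module.End ℝ (ℝ → ℝ) := 1 - (splineOp n : Module.End ℝ (ℝ → ℝ))

/-- The error `(1 - S)^(n+1)` of the quasi-interpolant of degree `n`. -/
def splineErr (n : ℕ) : Module.End ℝ (ℝ → ℝ) := splineDefect n ^ (n + 1)

/-- The quasi-interpolant of degree `n` with integer knots. -/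
def quasi (n : ℕ) : Module.End ℝ (ℝ → ℝ) := 1 - splineErr n

theorem splineDefect_apply (n : ℕ) (f : ℝ → ℝ) (x : ℝ) :
    splineDefect n f x = f x - splineOp n f x := rfl

theorem splineDefect_pow_succ (n j : ℕ) (f : ℝ → ℝ) :
    (splineDefect n ^ (j + 1)) f = splineDefect n ((splineDefect n ^ j) f) := by
  rw [pow_succ']; rfl

theorem splineErr_eq (n : ℕ) (f : ℝ → ℝ) (x : ℝ) : splineErr n f x = f x - quasi n f x := by
  simp [quasi]

/-- With `D = 1 - S`, the factorisation `1 - D^(n+1) = S ∑ D^j` with `S` on the left puts every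
value in the range of the spline operator. -/
theorem quasi_eq_splineOp (n : ℕ) (f : ℝ → ℝ) : ∃ g, quasi n f = splineOp n g := by
  have h := mul_neg_geom_sum (splineDefect n) (n + 1)
  rw [show 1 - splineDefect n = (splineOp n : Module.End ℝ (ℝ → ℝ)) from sub_sub_cancel _ _] at h
  exact ⟨_, (DFunLike.congr_fun h f).symm⟩

/-- The same factorisation with `S` on the right: since `S` samples first, only the values at the
integers matter. -/
theorem quasi_congr {n : ℕ} {f g : ℝ → ℝ} (hfg : ∀ j : ℤ, f j = g j) :
    quasi n f = quasi n g := by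
  have h := geom_sum_mul_neg (splineDefect n) (n + 1)
  rw [show 1 - splineDefect n = (splineOp n : Module.End ℝ (ℝ → ℝ)) from sub_sub_cancel _ _] at h
  have h1 := DFunLike.congr_fun h f
  have h2 := DFunLike.congr_fun h g
  rw [Module.End.mul_apply] at h1 h2
  rw [splineOp_congr hfg] at h1
  exact h1.symm.trans h2

theorem splineDefect_pow_shift (n j : ℕ) (f : ℝ → ℝ) (k : ℤ) (x : ℝ) :
    (splineDefect n ^ j) (fun y => f (y + k)) x = (splineDefect n ^ j) f (x + k) := by
  induction j generalizing x with
  | zero => rfl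
  | succ j ih =>
    simp only [splineDefect_pow_succ, splineDefect_apply]
    rw [ih, ← splineOp_shift, show (splineDefect n ^ j) (fun y => f (y + k)) =
      fun y => (splineDefect n ^ j) f (y + k) from funext ih]

theorem quasi_shift (n : ℕ) (f : ℝ → ℝ) (k : ℤ) (x : ℝ) :
    quasi n (fun y => f (y + k)) x = quasi n f (x + k) := by
  have := splineDefect_pow_shift n (n + 1) f k x
  have h1 := splineErr_eq n (fun y => f (y + k)) x
  have h2 := splineErr_eq n f (x + k)
  rw [splineErr] at h1 h2
  linarith

theorem contDiff_quasi (n : ℕ) (f : ℝ → ℝ) : ContDiff ℝ n (quasi (n + 1) f) := by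
  obtain ⟨g, hg⟩ := quasi_eq_splineOp (n + 1) f
  rw [hg]; exact contDiff_splineOp_succ n g

theorem exists_quasi_eq_eval (n : ℕ) (f : ℝ → ℝ) (i : ℤ) :
    ∃ q ∈ degreeLT ℝ (n + 2), ∀ s ∈ Icc (0 : ℝ) 1, quasi (n + 1) f (i + s) = q.eval s := by
  obtain ⟨g, hg⟩ := quasi_eq_splineOp (n + 1) f
  rw [hg]; exact exists_splineOp_succ_eq_eval n g i

/-- Each factor `1 - S` cancels the leading term, lowering the degree by one, as long as the degree
is at most `n`. -/
theorem splineDefect_pow_eval (n : ℕ) : ∀ j ≤ n + 1, ∀ p ∈ degreeLT ℝ j,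
    (splineDefect n ^ j) (fun x => p.eval x) = 0 := by
  intro j
  induction j with
  | zero =>
    intro _ p hp
    have : p = 0 := by simpa [degreeLT] using (mem_degreeLT.1 hp)
    simp [this]; rfl
  | succ j ih =>
    intro hj p hp
    obtain ⟨q, hq, hqe⟩ := exists_splineOp_eval n j (by omega) p hp
    have : splineDefect n (fun x => p.eval x) = fun x => q.eval x := by
      ext x
      rw [splineDefect_apply, hqe]; simp
    rw [pow_succ, Module.End.mul_apply, this]
    exact ih (by omega) q hq

theorem splineErr_eval {n : ℕ} {p : ℝ[X]} (hp : p ∈ degreeLT ℝ (n + 1)) :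
    splineErr n (fun x => p.eval x) = 0 := splineDefect_pow_eval n (n + 1) le_rfl p hp

/-- Each factor at most doubles the bound and looks `n + 1` units further to the left. -/
theorem abs_splineDefect_pow_le {n j : ℕ} {f : ℝ → ℝ} {ε x : ℝ}
    (h : ∀ y ∈ Icc (x - j * (n + 1)) x, |f y| ≤ ε) : |(splineDefect n ^ j) f x| ≤ 2 ^ j * ε := by
  induction j generalizing x with
  | zero => simpa using h x (by simp)
  | succ j ih =>
    rw [splineDefect_pow_succ, splineDefect_apply]
    push_cast at h
    have hn : (0 : ℝ) ≤ n := n.cast_nonneg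
    have h1 : |(splineDefect n ^ j) f x| ≤ 2 ^ j * ε :=
      ih fun y hy => h y ⟨by linarith [hy.1], hy.2⟩
    have h2 : |splineOp n ((splineDefect n ^ j) f) x| ≤ 2 ^ j * ε := by
      refine abs_splineOp_le fun y hy => ih fun z hz => h z ⟨?_, hz.2.trans hy.2⟩
      linarith [hz.1, hy.1]
    calc _ ≤ _ := abs_sub _ _
      _ ≤ _ := add_le_add h1 h2
      _ = _ := by ring

/-- The spline part differentiates to a backward difference, which is bounded by values of the
function. Hence `f'` is needed only at the point itself. -/
theorem exists_hasDerivAt_splineDefect_pow {n : ℕ} (j : ℕ) {f : ℝ → ℝ} {f' ε : ℝ} {i : ℤ} {s : ℝ}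
    (hs : s ∈ Ioo (0 : ℝ) 1) (hf : HasDerivAt f f' (i + s)) (hε : 0 ≤ ε)
    (h : ∀ y ∈ Icc ((i : ℝ) + s - j * (n + 2)) (i + s), |f y| ≤ ε) :
    ∃ d, HasDerivAt ((splineDefect (n + 1) ^ j) f) d (i + s) ∧ |d| ≤ |f'| + 2 ^ (j + 1) * ε := by
  induction j with
  | zero => exact ⟨f', hf, by simp [hε]⟩
  | succ j ih =>
    push_cast at h
    have hn : (0 : ℝ) ≤ n := n.cast_nonneg
    obtain ⟨d, hd, hdb⟩ := ih fun y hy => h y ⟨by linarith [hy.1], hy.2⟩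
    have hg := hasDerivAt_splineOp_succ n ((splineDefect (n + 1) ^ j) f) hs (i := i)
    have bound : ∀ x, (i : ℝ) + s - 1 ≤ x → x ≤ i + s →
        |splineOp n ((splineDefect (n + 1) ^ j) f) x| ≤ 2 ^ j * ε := by
      intro x hx1 hx2
      refine abs_splineOp_le fun y hy => abs_splineDefect_pow_le fun z hz => h z ⟨?_, ?_⟩
      · have := hz.1
        push_cast at this
        linarith [hy.1]
      · linarith [hz.2, hy.2]
    refine ⟨d - (splineOp n ((splineDefect (n + 1) ^ j) f) (i + s) -
        splineOp n ((splineDefect (n + 1) ^ j) f) (i + s - 1)), ?_, ?_⟩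
    · rw [splineDefect_pow_succ]
      exact hd.sub hg
    · have b1 := bound (i + s) (by linarith) le_rfl
      have b2 := bound (i + s - 1) le_rfl (by linarith)
      calc _ ≤ |d| + |_| := abs_sub _ _
        _ ≤ (|f'| + 2 ^ (j + 1) * ε) + (2 ^ j * ε + 2 ^ j * ε) :=
            add_le_add hdb ((abs_sub _ _).trans (add_le_add b1 b2))
        _ = _ := by ring

/-- Order of accuracy of the quasi-interpolant. -/
theorem exists_abs_splineErr_le (n : ℕ) : ∃ C, 0 ≤ C ∧ ∀ (f : ℝ → ℝ) (K : ℝ),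
    ContDiff ℝ (n + 1 : ℕ) f → (∀ y, |iteratedDeriv (n + 1) f y| ≤ K) →
    ∀ x, |splineErr n f x| ≤ C * K := by
  refine ⟨2 ^ (n + 1) * ((n + 1 : ℕ) * (n + 1)) ^ (n + 1), by positivity, fun f K hf hK x => ?_⟩
  have hK0 : 0 ≤ K := (abs_nonneg _).trans (hK 0)
  -- The Taylor polynomial at the point of evaluation is annihilated, and the remainder is bounded
  -- on a window of length `(n + 1)²`.
  obtain ⟨p, hp, hpb, -, -⟩ := exists_taylor n hf hK x
  have h1 : f = (fun y => f y - p.eval (y - x)) + fun y => (p.comp (X - C x)).eval y := by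
    ext y; simp
  rw [h1, map_add, splineErr_eval (comp_X_sub_C_mem_degreeLT hp x), add_zero, mul_assoc]
  refine abs_splineDefect_pow_le fun y hy => (hpb y).trans ?_
  rw [mul_comm]
  gcongr
  rw [abs_le]
  constructor <;> linarith [hy.1, hy.2]

/-- Leading term of the derivative of the error of the quasi-interpolant. -/
theorem exists_hasDerivAt_splineErr (n : ℕ) : ∃ (C : ℝ) (b : ℝ[X]), 0 ≤ C ∧ b.eval 0 = b.eval 1 ∧
    ∀ (f : ℝ → ℝ) (K : ℝ), ContDiff ℝ (n + 3 : ℕ) f → (∀ y, |iteratedDeriv (n + 3) f y| ≤ K) →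
    ∀ (i : ℤ), ∀ s ∈ Ioo (0 : ℝ) 1, ∃ d, HasDerivAt (splineErr (n + 1) f) d (i + s) ∧
      |d - iteratedDeriv (n + 2) f i * (derivative b).eval s| ≤ C * K := by
  -- `β` is the error for the first monomial that is not reproduced; it becomes the universal
  -- profile of the leading error term.
  set β := splineErr (n + 1) (fun x => (X ^ (n + 2) : ℝ[X]).eval x) with hβ
  have hper : ∀ (i : ℤ) x, β (x + i) = β x := by
    -- The backward difference of `X ^ (n + 2)` has degree at most `n + 1`, so it is annihilated,
    -- and `β` is 1-periodic.
    have h1 : ∀ x, β (x - 1) = β x := by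
      intro x
      have h2 := splineDefect_pow_shift (n + 1) (n + 2) (fun x => (X ^ (n + 2) : ℝ[X]).eval x) (-1) x
      have hX : (X ^ (n + 2) : ℝ[X]) ∈ degreeLT ℝ (n + 1 + 2) :=
        mem_degreeLT.2 ((degree_X_pow_le _).trans_lt (by exact_mod_cast Nat.lt_succ_self _))
      have hN : (X ^ (n + 2) : ℝ[X]) - (X ^ (n + 2) : ℝ[X]).comp (X - C 1) ∈
          degreeLT ℝ (n + 2) := by
        have h1 := derivative_mem_degreeLT hX
        have h2 := degreeLT_mono (R := ℝ) (Nat.le_succ (n + 1))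
          (derivative_sub_backwardDiff_mem hX)
        simpa using Submodule.sub_mem _ h1 h2
      have h3 := congrFun (splineErr_eval (n := n + 1) hN) x
      have h4 : (fun x => ((X ^ (n + 2) : ℝ[X]) - (X ^ (n + 2) : ℝ[X]).comp (X - C 1)).eval x) =
          (fun x => (X ^ (n + 2) : ℝ[X]).eval x) -
            fun x => (X ^ (n + 2) : ℝ[X]).eval (x + ((-1 : ℤ) : ℝ)) := by
        ext y; simp [sub_eq_add_neg]
      rw [h4, map_sub, Pi.sub_apply] at h3
      have h5 : splineErr (n + 1)
          (fun x => (X ^ (n + 2) : ℝ[X]).eval (x + ((-1 : ℤ) : ℝ))) x = β (x + ((-1 : ℤ) : ℝ)) := h2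
      rw [h5] at h3
      rw [show x - 1 = x + ((-1 : ℤ) : ℝ) by push_cast; ring]
      exact (sub_eq_zero.1 h3).symm
    have hp : Function.Periodic β 1 := fun x => by
      rw [← h1 (x + 1)]; simp
    intro i x
    have := hp.int_mul i x
    rwa [mul_one] at this
  obtain ⟨q, hq, hqe⟩ := exists_quasi_eq_eval n (fun x => (X ^ (n + 2) : ℝ[X]).eval x) 0
  have hβs : ∀ (i : ℤ), ∀ s ∈ Icc (0 : ℝ) 1, β (i + s) = (X ^ (n + 2) - q).eval s := by
    intro i s hs
    have := hqe s hs
    rw [Int.cast_zero, zero_add] at this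
    rw [add_comm, hper, hβ, splineErr_eq, this, eval_sub]
  -- The monomial enters the Taylor polynomial with coefficient `f^(n+2)(i) / (n+2)!`; the factorial
  -- is put into `b`.
  set c : ℝ := ((n + 2).factorial : ℝ)⁻¹ with hc
  refine ⟨((n + 2 : ℕ) * (n + 2)) ^ (n + 2) + 2 ^ (n + 3) * ((n + 2 : ℕ) * (n + 2)) ^ (n + 3),
    C c * (X ^ (n + 2) - q), by positivity, ?_, ?_⟩
  · have h0 := hβs 0 0 (by simp)
    have h1 := hβs 0 1 (by simp)
    have := hper 1 0
    rw [eval_mul, eval_mul, ← h0, ← h1]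
    simp only [eval_C, Int.cast_zero, add_zero, zero_add]
    rw [← this]; simp
  intro f K hf hK i s hs
  have hK0 : 0 ≤ K := (abs_nonneg _).trans (hK 0)
  -- Taylor expansion at the knot `i` to degree `n + 2`: the lower part is annihilated, the top term
  -- gives `a • β`, and the remainder `R` goes into the error constant.
  obtain ⟨p, hp, hpb, hpd, hpc⟩ := exists_taylor (n + 2) hf hK i
  set a := p.coeff (n + 2) with ha
  have hlow : p - C a * X ^ (n + 2) ∈ degreeLT ℝ (n + 2) := by
    rw [mem_degreeLT_iff_coeff] at hp ⊢
    intro m hm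
    rw [coeff_sub, coeff_C_mul, coeff_X_pow]
    split_ifs with h
    · rw [h, ← ha]; ring
    · rw [hp m (by omega)]; ring
  set R : ℝ → ℝ := fun y => f y - p.eval (y - i) with hR
  have hdecomp : splineErr (n + 1) f = splineErr (n + 1) R + a • β := by
    have h1 : f = R + ((fun y => ((p - C a * X ^ (n + 2)).comp (X - C (i : ℝ))).eval y) +
        a • fun y => (X ^ (n + 2) : ℝ[X]).eval (y + ((-i : ℤ) : ℝ))) := by
      ext y; simp [R, sub_eq_add_neg]
    conv_lhs => rw [h1]
    rw [map_add, map_add, splineErr_eval (comp_X_sub_C_mem_degreeLT hlow _), zero_add, map_smul]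
    congr 2
    ext y
    have := splineDefect_pow_shift (n + 1) (n + 2) (fun x => (X ^ (n + 2) : ℝ[X]).eval x) (-i) y
    exact this.trans (hper (-i) y)
  have hβd : HasDerivAt β ((derivative (X ^ (n + 2) - q)).eval s) (i + s) := by
    have h1 : HasDerivAt (fun y => (X ^ (n + 2) - q).eval (y - i))
        ((derivative (X ^ (n + 2) - q)).eval s) (i + s) := by
      have h2 : HasDerivAt (fun y => (X ^ (n + 2) - q).eval y)
        ((derivative (X ^ (n + 2) - q)).eval s) (i + s - i) := by
        rw [add_sub_cancel_left]; exact (X ^ (n + 2) - q).hasDerivAt s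
      have := h2.comp (i + s : ℝ) ((hasDerivAt_id (i + s : ℝ)).sub_const (i : ℝ))
      rw [mul_one] at this
      exact this
    refine h1.congr_of_eventuallyEq ?_
    filter_upwards [Ioo_mem_nhds (show (i : ℝ) < i + s by linarith [hs.1])
      (show (i : ℝ) + s < i + 1 by linarith [hs.2])] with y hy
    rw [← hβs i (y - i) ⟨by linarith [hy.1], by linarith [hy.2]⟩]
    congr 1; ring
  have hRd : HasDerivAt R (deriv f (i + s) - (derivative p).eval (i + s - i)) (i + s) := by
    have hfd := (hf.differentiable (by simp)).differentiableAt.hasDerivAt (x := (i : ℝ) + s)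
    have := (p.hasDerivAt (i + s - i)).comp (i + s : ℝ)
      ((hasDerivAt_id (i + s : ℝ)).sub_const (i : ℝ))
    rw [mul_one] at this
    exact hfd.sub this
  have hn : (0 : ℝ) ≤ n := n.cast_nonneg
  obtain ⟨d, hd, hdb⟩ := exists_hasDerivAt_splineDefect_pow (n := n) (n + 2) hs hRd
    (ε := ((n + 2 : ℕ) * (n + 2)) ^ (n + 3) * K) (by positivity) (fun y hy => by
      refine (hpb y).trans ?_
      rw [mul_comm]
      gcongr
      have h1 := hy.1
      push_cast at h1 ⊢
      rw [abs_le]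
      constructor
      · linarith [hs.1]
      · nlinarith [hy.2, hs.2])
  refine ⟨d + a * (derivative (X ^ (n + 2) - q)).eval s, ?_, ?_⟩
  · rw [hdecomp]
    exact hd.add (hβd.const_mul a)
  · have h1 : d + a * (derivative (X ^ (n + 2) - q)).eval s - iteratedDeriv (n + 2) f i *
        (derivative (C c * (X ^ (n + 2) - q))).eval s = d := by
      rw [hpc, derivative_C_mul, eval_mul, eval_C, hc]
      ring
    rw [h1]
    have h2 := hpd (i + s)
    have h3 : K * |(i : ℝ) + s - i| ^ (n + 2) ≤ ((n + 2 : ℕ) * (n + 2)) ^ (n + 2) * K := by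
      rw [mul_comm]
      gcongr
      push_cast
      rw [add_sub_cancel_left, abs_of_pos hs.1]
      nlinarith [hs.2]
    linarith

end SplineError

end

section

open MeasureTheory intervalIntegral

/-! ### Inverse inequality and oscillatory integrals on cells. -/

section CellPolynomials

open Polynomial

theorem intervalIntegral_abs_le_mul {f : ℝ → ℝ} {q : ℝ[X]} {K : ℝ}
    (h : ∀ s ∈ Icc (0 : ℝ) 1, |f s| ≤ K * |q.eval s|) :
    |∫ s in (0 : ℝ)..1, f s| ≤ K * ∫ s in (0 : ℝ)..1, |q.eval s| := by
  rw [← intervalIntegral.integral_const_mul]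
  refine norm_integral_le_of_norm_le (f := f) zero_le_one ?_ ?_
  · exact Filter.Eventually.of_forall fun s hs => h s ⟨hs.1.le, hs.2⟩
  · exact (continuous_const.mul q.continuous.abs).intervalIntegrable _ _

theorem exists_bound_eval (p : ℝ[X]) : ∃ B, 0 ≤ B ∧ ∀ s ∈ Icc (0 : ℝ) 1, |p.eval s| ≤ B := by
  obtain ⟨B, hB⟩ := isCompact_Icc.exists_bound_of_continuousOn (s := Icc (0 : ℝ) 1)
    p.continuous.continuousOn
  exact ⟨B, (abs_nonneg _).trans (hB 0 (by simp)), hB⟩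

/-- Inverse inequality on the reference cell. -/
theorem exists_inverse_inequality (k : ℕ) : ∃ C, 0 ≤ C ∧ ∀ q ∈ degreeLT ℝ k,
    ∀ s ∈ Icc (0 : ℝ) 1, |q.eval s| ≤ C * ∫ y in (0 : ℝ)..1, |q.eval y| ∧
      |(derivative q).eval s| ≤ C * ∫ y in (0 : ℝ)..1, |q.eval y| := by
  have cont : ∀ p q : ℝ[X], IntervalIntegrable (fun y => p.eval y * q.eval y) volume 0 1 :=
    fun p q => (p.continuous.mul q.continuous).intervalIntegrable _ _
  let B : degreeLT ℝ k →ₗ[ℝ] degreeLT ℝ k →ₗ[ℝ] ℝ := LinearMap.mk₂ ℝ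
    (fun p q => ∫ y in (0 : ℝ)..1, (p : ℝ[X]).eval y * (q : ℝ[X]).eval y)
    (fun p p' q => by
      rw [← intervalIntegral.integral_add (cont _ _) (cont _ _)]
      simp [add_mul])
    (fun c p q => by
      rw [smul_eq_mul, ← intervalIntegral.integral_const_mul]
      simp [mul_assoc])
    (fun p q q' => by
      rw [← intervalIntegral.integral_add (cont _ _) (cont _ _)]
      simp [mul_add])
    (fun c p q => by
      rw [smul_eq_mul, ← intervalIntegral.integral_const_mul]
      simp [mul_left_comm])
  have hB : ∀ p q, B p q = ∫ y in (0 : ℝ)..1, (p : ℝ[X]).eval y * (q : ℝ[X]).eval y :=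
    fun _ _ => rfl
  have hnn : ∀ p, 0 ≤ B p p := fun p => by
    rw [hB]
    exact integral_nonneg zero_le_one fun y _ => mul_self_nonneg _
  have hpos : ∀ p ≠ 0, 0 < B p p := by
    intro p hp
    refine lt_of_le_of_ne (hnn p) fun h => hp ?_
    rw [hB] at h
    have hz : ∀ y ∈ Ioo (0 : ℝ) 1, (p : ℝ[X]).eval y = 0 := by
      intro y hy
      by_contra hne
      have : 0 < ∫ y in (0 : ℝ)..1, (p : ℝ[X]).eval y * (p : ℝ[X]).eval y := by
        refine integral_pos zero_lt_one ((p : ℝ[X]).continuous.mul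
          (p : ℝ[X]).continuous).continuousOn (fun y _ => mul_self_nonneg _)
          ⟨y, Ioo_subset_Icc_self hy, mul_self_pos.2 hne⟩
      exact this.ne h
    have : (p : ℝ[X]) = 0 := by
      apply Polynomial.eq_zero_of_infinite_isRoot
      exact (Ioo_infinite zero_lt_one).mono hz
    exact Subtype.ext this
  have hsymm : ∀ x y, B x y = B y x := fun x y => by simp only [hB, mul_comm]
  have : FiniteDimensional ℝ (degreeLT ℝ k) :=
    Module.Finite.equiv (degreeLTEquiv ℝ k).symm
  obtain ⟨e, he⟩ := exists_linearEquiv_dual B hpos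
  -- A coefficient is a linear form, represented in the `L²` inner product; Cauchy–Schwarz bounds it
  -- by the `L²` norm.
  have hcoef : ∀ j, ∃ c, 0 ≤ c ∧ ∀ q : degreeLT ℝ k, |(q : ℝ[X]).coeff j| ≤ c * √(B q q) := by
    intro j
    let l : Module.Dual ℝ (degreeLT ℝ k) := (lcoeff ℝ j) ∘ₗ (degreeLT ℝ k).subtype
    refine ⟨√(B (e.symm l) (e.symm l)), Real.sqrt_nonneg _, fun q => ?_⟩
    have := abs_le_sqrt_mul_sqrt B hsymm hnn (e.symm l) q
    rw [← he, e.apply_symm_apply] at this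
    exact this
  choose c hc0 hc using hcoef
  -- The factor `k + 1` absorbs the exponents produced by differentiating monomials, so one constant
  -- serves `q` and its derivative.
  set D := (k + 1 : ℝ) * ∑ j ∈ Finset.range k, c j with hD
  have hsum0 : 0 ≤ ∑ j ∈ Finset.range k, c j := Finset.sum_nonneg fun j _ => hc0 j
  have hD0 : 0 ≤ D := by positivity
  have hle : ∑ j ∈ Finset.range k, c j ≤ D := by
    rw [hD]
    have : (0 : ℝ) ≤ k := k.cast_nonneg
    nlinarith
  have hdeg : ∀ q : degreeLT ℝ k, (q : ℝ[X]) = ∑ j ∈ Finset.range k, monomial j ((q : ℝ[X]).coeff j) := by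
    intro q
    ext m
    rw [finsetSum_coeff]
    simp only [coeff_monomial, Finset.sum_ite_eq', Finset.mem_range]
    split_ifs with h
    · rfl
    · exact mem_degreeLT_iff_coeff.1 q.2 m (by omega)
  have heval : ∀ q : degreeLT ℝ k, ∀ s ∈ Icc (0 : ℝ) 1, |(q : ℝ[X]).eval s| ≤ D * √(B q q) ∧
      |(derivative (q : ℝ[X])).eval s| ≤ D * √(B q q) := by
    intro q s hs
    have hpow : ∀ j, |s ^ j| ≤ 1 := fun j => by
      rw [abs_of_nonneg (pow_nonneg hs.1 j)]; exact pow_le_one₀ hs.1 hs.2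
    constructor
    · conv_lhs => rw [hdeg q, eval_finsetSum]
      refine (Finset.abs_sum_le_sum_abs _ _).trans ?_
      refine le_trans ?_ (mul_le_mul_of_nonneg_right hle (Real.sqrt_nonneg _))
      rw [Finset.sum_mul]
      refine Finset.sum_le_sum fun j _ => ?_
      rw [eval_monomial, abs_mul]
      exact (mul_le_of_le_one_right (abs_nonneg _) (hpow j)).trans (hc j q)
    · conv_lhs => rw [hdeg q, derivative_sum, eval_finsetSum]
      refine (Finset.abs_sum_le_sum_abs _ _).trans ?_
      rw [hD, mul_assoc, Finset.sum_mul, Finset.mul_sum]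
      refine Finset.sum_le_sum fun j hj => ?_
      rw [derivative_monomial, eval_monomial, abs_mul]
      refine (mul_le_of_le_one_right (abs_nonneg _) (hpow _)).trans ?_
      rw [abs_mul, mul_comm, Nat.abs_cast]
      have : (j : ℝ) ≤ k + 1 := by
        exact_mod_cast (Finset.mem_range.1 hj).le.trans (Nat.le_succ k)
      exact mul_le_mul this (hc j q) (abs_nonneg _) (by positivity)
  -- From `L²` to `L¹`: the square of the `L²` norm is at most the sup norm times the `L¹` norm, and
  -- the sup norm is at most `D` times the `L²` norm.
  have hL1 : ∀ q : degreeLT ℝ k, √(B q q) ≤ D * ∫ y in (0 : ℝ)..1, |(q : ℝ[X]).eval y| := by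
    intro q
    have h1 : B q q ≤ (D * √(B q q)) * ∫ y in (0 : ℝ)..1, |(q : ℝ[X]).eval y| := by
      refine (le_abs_self _).trans ?_
      rw [hB q q]
      refine intervalIntegral_abs_le_mul fun s hs => ?_
      rw [abs_mul]
      exact mul_le_mul_of_nonneg_right (heval q s hs).1 (abs_nonneg _)
    rcases (Real.sqrt_nonneg (B q q)).eq_or_lt with h0 | h0
    · rw [← h0]
      exact mul_nonneg hD0 (integral_nonneg zero_le_one fun y _ => abs_nonneg _)
    · have h2 := Real.mul_self_sqrt (hnn q)
      refine le_of_mul_le_mul_left ?_ h0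
      linarith
  refine ⟨D * D, by positivity, fun q hq s hs => ?_⟩
  have h1 := mul_le_mul_of_nonneg_left (hL1 ⟨q, hq⟩) hD0
  rw [← mul_assoc] at h1
  exact ⟨(heval ⟨q, hq⟩ s hs).1.trans h1, (heval ⟨q, hq⟩ s hs).2.trans h1⟩

/-- The cell polynomials, in the local variable `s ∈ [0, 1]`, of a smooth periodic spline of order
`k` with `N` cells. -/
structure IsCellSpline (N k : ℕ) (q : ℕ → ℝ[X]) : Prop where
  mem : ∀ i, q i ∈ degreeLT ℝ k
  smooth : ∀ i j, j + 1 < k → (derivative^[j] (q i)).eval 1 = (derivative^[j] (q (i + 1))).eval 0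
  periodic : q N = q 0

theorem IsCellSpline.derivative {N k : ℕ} {q : ℕ → ℝ[X]} (h : IsCellSpline N (k + 1) q) :
    IsCellSpline N k fun i => Polynomial.derivative (q i) where
  mem i := derivative_mem_degreeLT (h.mem i)
  smooth i j hj := h.smooth i (j + 1) (by omega)
  periodic := by rw [h.periodic]

/-- Splines are nearly orthogonal to rapidly oscillating functions of mean zero. -/
theorem exists_abs_sum_integral_le (k : ℕ) (p : ℝ[X]) (hp : ∫ s in (0 : ℝ)..1, p.eval s = 0) :
    ∃ C, 0 ≤ C ∧ ∀ (N : ℕ) (q : ℕ → ℝ[X]) (g g' : ℕ → ℝ → ℝ) (G : ℝ),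
      IsCellSpline N (k + 1) q → (∀ i s, HasDerivAt (g i) (g' i s) s) →
      (∀ i, Continuous (g' i)) → (∀ i, ∀ s ∈ Icc (0 : ℝ) 1, |g' i s| ≤ G) →
      (∀ i, g i 1 = g (i + 1) 0) → g N 0 = g 0 0 →
      |∑ i ∈ Finset.range N, ∫ s in (0 : ℝ)..1, p.eval s * (g i s * (q i).eval s)| ≤
        C * G * ∑ i ∈ Finset.range N, ∫ s in (0 : ℝ)..1, |(q i).eval s| := by
  induction k generalizing p with
  | zero =>
    obtain ⟨B, hB0, hB⟩ := exists_bound_eval p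
    refine ⟨B, hB0, fun N q g g' G hq hg hg' hG _ _ => ?_⟩
    rw [Finset.mul_sum]
    refine (Finset.abs_sum_le_sum_abs _ _).trans (Finset.sum_le_sum fun i _ => ?_)
    obtain ⟨c, hc⟩ := exists_eq_C_of_mem_degreeLT_one (hq.mem i)
    have hgc : Continuous (g i) :=
      continuous_iff_continuousAt.2 fun s => (hg i s).continuousAt
    -- The spline is constant on the cell and `p` has mean zero, so `g` may be replaced by its
    -- increment, which is at most `G`.
    have h1 : ∫ s in (0 : ℝ)..1, p.eval s * (g i s * (q i).eval s) =
        ∫ s in (0 : ℝ)..1, p.eval s * ((g i s - g i 0) * (q i).eval s) := by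
      have h2 : ∫ s in (0 : ℝ)..1, p.eval s * (g i 0 * (q i).eval s) = 0 := by
        simp only [hc, eval_C]
        rw [intervalIntegral.integral_mul_const, hp, zero_mul]
      refine Eq.trans (Eq.trans (sub_zero _).symm (congrArg _ h2.symm)) ?_
      rw [← intervalIntegral.integral_sub]
      · congr 1; ext s; ring
      · exact (p.continuous.mul (hgc.mul (q i).continuous)).intervalIntegrable _ _
      · exact (p.continuous.mul (continuous_const.mul (q i).continuous)).intervalIntegrable _ _
    rw [h1]
    refine intervalIntegral_abs_le_mul fun s hs => ?_
    have h3 : |g i s - g i 0| ≤ G := by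
      have := (convex_Icc (0 : ℝ) 1).norm_image_sub_le_of_norm_hasDerivWithin_le
        (fun z _ => (hg i z).hasDerivWithinAt) (fun z hz => hG i z hz)
        (show (0 : ℝ) ∈ Icc (0 : ℝ) 1 by simp) hs
      refine this.trans ?_
      have hG0 : 0 ≤ G := (abs_nonneg _).trans (hG i s hs)
      rw [sub_zero, Real.norm_of_nonneg hs.1]
      exact mul_le_of_le_one_right hG0 hs.2
    rw [abs_mul, abs_mul, ← mul_assoc]
    exact mul_le_mul_of_nonneg_right (mul_le_mul (hB s hs) h3 (abs_nonneg _) hB0) (abs_nonneg _)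
  | succ k ih =>
    -- The antiderivative is normalised to mean zero so that the induction hypothesis applies to it.
    -- Since `p` has mean zero, `P` takes equal values at 0 and 1.
    obtain ⟨P, hPd, hPi⟩ : ∃ P : ℝ[X], derivative P = p ∧ ∫ s in (0 : ℝ)..1, P.eval s = 0 := by
      obtain ⟨P, -, hPd, -⟩ := exists_antiderivative (k := p.natDegree + 1) (p := p)
        (mem_degreeLT.2 (degree_le_natDegree.trans_lt (by exact_mod_cast Nat.lt_succ_self _))) 0
      refine ⟨P - C (∫ s in (0 : ℝ)..1, P.eval s), by simp [hPd], ?_⟩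
      simp only [eval_sub, eval_C]
      rw [intervalIntegral.integral_sub (P.continuous.intervalIntegrable _ _) (by simp)]
      simp
    have hP01 : P.eval 1 = P.eval 0 := by
      have := integral_eq_sub_of_hasDerivAt (a := 0) (b := 1) (f := fun y => P.eval y)
        (f' := fun y => p.eval y) (fun y _ => hPd ▸ P.hasDerivAt y)
        (p.continuous.intervalIntegrable _ _)
      rw [hp] at this
      exact sub_eq_zero.1 this.symm
    obtain ⟨B, hB0, hB⟩ := exists_bound_eval P
    obtain ⟨C₁, hC₁, h₁⟩ := ih P hPi
    obtain ⟨C₂, hC₂, h₂⟩ := exists_inverse_inequality (k + 2)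
    refine ⟨B + C₁ * C₂, by positivity, fun N q g g' G hq hg hg' hG hgs hgN => ?_⟩
    rcases N.eq_zero_or_pos with rfl | hN
    · simp
    have hG0 : 0 ≤ G := (abs_nonneg _).trans (hG 0 0 (by simp))
    have hgc : ∀ i, Continuous (g i) := fun i =>
      continuous_iff_continuousAt.2 fun s => (hg i s).continuousAt
    -- Integration by parts on one cell. Because `P(1) = P(0)` and both `g` and `q` match across
    -- knots, the boundary term is an increment that telescopes to zero around the period.
    have key : ∀ i, ∫ s in (0 : ℝ)..1, p.eval s * (g i s * (q i).eval s) =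
        P.eval 0 * (g (i + 1) 0 * (q (i + 1)).eval 0 - g i 0 * (q i).eval 0) -
        (∫ s in (0 : ℝ)..1, P.eval s * (g' i s * (q i).eval s)) -
        ∫ s in (0 : ℝ)..1, P.eval s * (g i s * (derivative (q i)).eval s) := by
      intro i
      have hq1 := hq.smooth i 0 (by omega)
      simp only [Function.iterate_zero, id] at hq1
      have i1 : IntervalIntegrable (fun s => p.eval s * (g i s * (q i).eval s)) volume 0 1 :=
        (p.continuous.mul ((hgc i).mul (q i).continuous)).intervalIntegrable _ _
      have i2 : IntervalIntegrable (fun s => P.eval s * (g' i s * (q i).eval s)) volume 0 1 :=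
        (P.continuous.mul ((hg' i).mul (q i).continuous)).intervalIntegrable _ _
      have i3 : IntervalIntegrable (fun s => P.eval s * (g i s * (derivative (q i)).eval s))
          volume 0 1 :=
        (P.continuous.mul ((hgc i).mul (derivative (q i)).continuous)).intervalIntegrable _ _
      have := integral_eq_sub_of_hasDerivAt (a := 0) (b := 1)
        (f := fun s => P.eval s * (g i s * (q i).eval s))
        (f' := fun s => p.eval s * (g i s * (q i).eval s) + P.eval s * (g' i s * (q i).eval s)
          + P.eval s * (g i s * (derivative (q i)).eval s))
        (fun s _ => by
          have := (P.hasDerivAt s).mul ((hg i s).mul ((q i).hasDerivAt s))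
          refine this.congr_deriv ?_
          rw [hPd]; simp only [Pi.mul_apply]; ring)
        ((i1.add i2).add i3)
      rw [intervalIntegral.integral_add (i1.add i2) i3, intervalIntegral.integral_add i1 i2, hP01, hgs i, hq1] at this
      linarith
    have hsum : ∑ i ∈ Finset.range N, ∫ s in (0 : ℝ)..1, p.eval s * (g i s * (q i).eval s) =
        -(∑ i ∈ Finset.range N, ∫ s in (0 : ℝ)..1, P.eval s * (g' i s * (q i).eval s)) -
        ∑ i ∈ Finset.range N, ∫ s in (0 : ℝ)..1, P.eval s * (g i s * (derivative (q i)).eval s) := by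
      simp only [key, Finset.sum_sub_distrib, ← Finset.mul_sum]
      have tel := Finset.sum_range_sub (fun i => g i 0 * (q i).eval 0) N
      rw [Finset.sum_sub_distrib, hgN, hq.periodic, sub_self] at tel
      rw [tel]
      ring
    have b1 : |∑ i ∈ Finset.range N, ∫ s in (0 : ℝ)..1, P.eval s * (g' i s * (q i).eval s)| ≤
        B * G * ∑ i ∈ Finset.range N, ∫ s in (0 : ℝ)..1, |(q i).eval s| := by
      rw [Finset.mul_sum]
      refine (Finset.abs_sum_le_sum_abs _ _).trans (Finset.sum_le_sum fun i _ => ?_)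
      refine intervalIntegral_abs_le_mul fun s hs => ?_
      rw [abs_mul, abs_mul, ← mul_assoc]
      exact mul_le_mul_of_nonneg_right (mul_le_mul (hB s hs) (hG i s hs) (abs_nonneg _) hB0)
        (abs_nonneg _)
    have b2 := h₁ N (fun i => derivative (q i)) g g' G hq.derivative hg hg' hG hgs hgN
    -- Differentiation in the cell variable costs only a constant, by the inverse inequality on the
    -- reference cell.
    have b3 : ∑ i ∈ Finset.range N, ∫ s in (0 : ℝ)..1, |(derivative (q i)).eval s| ≤
        C₂ * ∑ i ∈ Finset.range N, ∫ s in (0 : ℝ)..1, |(q i).eval s| := by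
      rw [Finset.mul_sum]
      refine Finset.sum_le_sum fun i _ => ?_
      have := integral_mono_on (μ := volume) (a := 0) (b := 1) zero_le_one
        ((Polynomial.derivative (q i)).continuous.abs.intervalIntegrable _ _)
        intervalIntegrable_const (fun s hs => (h₂ (q i) (hq.mem i) s hs).2)
      simpa using this
    have b4 := mul_le_mul_of_nonneg_left b3 (mul_nonneg hC₁ hG0)
    rw [hsum]
    refine (abs_sub _ _).trans ?_
    rw [abs_neg]
    linarith

end CellPolynomials

end

section

open MeasureTheory intervalIntegral

/-! ### Piecewise continuous functions, `L²` calculus and integration by parts. -/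

section PiecewiseContinuous

/-- Functions that are continuous on each open mesh cell, with continuous extensions. -/
def pcSpace (N : ℕ) : Submodule ℝ (ℝ → ℝ) where
  carrier := {F | ∀ i : ℕ, i < N → ∃ G : ℝ → ℝ, Continuous G ∧
    ∀ s ∈ Ioo (0 : ℝ) 1, F ((i + s) / N) = G s}
  zero_mem' := fun _ _ => ⟨0, continuous_const, fun _ _ => rfl⟩
  add_mem' := fun hf hg i hi => by
    obtain ⟨F, hF, hFe⟩ := hf i hi
    obtain ⟨G, hG, hGe⟩ := hg i hi
    exact ⟨F + G, hF.add hG, fun s hs => by simp [hFe s hs, hGe s hs]⟩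
  smul_mem' := fun c f hf i hi => by
    obtain ⟨F, hF, hFe⟩ := hf i hi
    exact ⟨c • F, hF.const_smul c, fun s hs => by simp [hFe s hs]⟩

variable {N : ℕ}

theorem mul_mem_pcSpace {f g : ℝ → ℝ} (hf : f ∈ pcSpace N) (hg : g ∈ pcSpace N) :
    (fun x => f x * g x) ∈ pcSpace N := fun i hi => by
  obtain ⟨F, hF, hFe⟩ := hf i hi
  obtain ⟨G, hG, hGe⟩ := hg i hi
  exact ⟨F * G, hF.mul hG, fun s hs => by simp [hFe s hs, hGe s hs]⟩

theorem add_mem_pcSpace {f g : ℝ → ℝ} (hf : f ∈ pcSpace N) (hg : g ∈ pcSpace N) :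
    (fun x => f x + g x) ∈ pcSpace N := (pcSpace N).add_mem hf hg

theorem sub_mem_pcSpace {f g : ℝ → ℝ} (hf : f ∈ pcSpace N) (hg : g ∈ pcSpace N) :
    (fun x => f x - g x) ∈ pcSpace N := (pcSpace N).sub_mem hf hg

theorem const_mul_mem_pcSpace {f : ℝ → ℝ} (c : ℝ) (hf : f ∈ pcSpace N) :
    (fun x => c * f x) ∈ pcSpace N := (pcSpace N).smul_mem c hf

theorem abs_mem_pcSpace {f : ℝ → ℝ} (hf : f ∈ pcSpace N) : (fun x => |f x|) ∈ pcSpace N :=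
  fun i hi => by
    obtain ⟨F, hF, hFe⟩ := hf i hi
    exact ⟨fun x => |F x|, hF.abs, fun s hs => congrArg _ (hFe s hs)⟩

theorem continuous_mem_pcSpace {f : ℝ → ℝ} (hf : Continuous f) : f ∈ pcSpace N := fun i _ =>
  ⟨fun s => f ((i + s) / N), hf.comp ((continuous_const.add continuous_id).div_const _),
    fun _ _ => rfl⟩

theorem mem_pcSpace_congr {f g : ℝ → ℝ} (hf : f ∈ pcSpace N)
    (h : ∀ i : ℕ, i < N → ∀ s ∈ Ioo (0 : ℝ) 1, g ((i + s) / N) = f ((i + s) / N)) :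
    g ∈ pcSpace N := fun i hi => by
  obtain ⟨F, hF, hFe⟩ := hf i hi
  exact ⟨F, hF, fun s hs => by rw [h i hi s hs, hFe s hs]⟩

theorem integral_cell (hN : 0 < N) (f : ℝ → ℝ) (i : ℕ) :
    ∫ x in ((i : ℝ) / N)..(((i + 1 : ℕ) : ℝ) / N), f x =
      (1 / N) * ∫ s in (0 : ℝ)..1, f ((i + s) / N) := by
  have hN' : (N : ℝ) ≠ 0 := by positivity
  have := integral_comp_add_left (a := 0) (b := 1) (fun s => f (s / N)) (i : ℝ)
  rw [this, integral_comp_div _ hN']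
  simp only [add_zero, smul_eq_mul]
  rw [← mul_assoc, one_div_mul_cancel hN', one_mul]
  push_cast
  rfl

theorem intervalIntegrable_cell (hN : 0 < N) {f : ℝ → ℝ} (hf : f ∈ pcSpace N) {i : ℕ} (hi : i < N) :
    IntervalIntegrable f volume ((i : ℝ) / N) (((i + 1 : ℕ) : ℝ) / N) := by
  obtain ⟨F, hF, hFe⟩ := hf i hi
  have hN' : (0 : ℝ) < N := by exact_mod_cast hN
  have hc : Continuous fun x : ℝ => F (N * x - i) :=
    hF.comp ((continuous_const.mul continuous_id).sub continuous_const)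
  refine (hc.intervalIntegrable _ _).congr_uIoo fun x hx => ?_
  rw [uIoo_of_le (by gcongr; simp)] at hx
  have h1 := (div_lt_iff₀ hN').1 hx.1
  have h2 := (lt_div_iff₀ hN').1 hx.2
  push_cast at h2
  have := hFe (N * x - i) ⟨by linarith, by linarith⟩
  change F (N * x - i) = f x
  rw [← this]
  congr 1
  field_simp
  ring

theorem intervalIntegrable_of_mem_pcSpace (hN : 0 < N) {f : ℝ → ℝ} (hf : f ∈ pcSpace N) :
    IntervalIntegrable f volume 0 1 := by
  have := IntervalIntegrable.trans_iterate (f := f) (μ := volume) (a := fun k : ℕ => (k : ℝ) / N)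
    (n := N) fun k hk => intervalIntegrable_cell hN hf hk
  simpa [hN.ne'] using this

theorem integral_eq_sum_cells (hN : 0 < N) {f : ℝ → ℝ} (hf : f ∈ pcSpace N) :
    ∫ x in (0 : ℝ)..1, f x =
      (1 / N) * ∑ i ∈ Finset.range N, ∫ s in (0 : ℝ)..1, f ((i + s) / N) := by
  have := sum_integral_adjacent_intervals (f := f) (μ := volume) (a := fun k : ℕ => (k : ℝ) / N)
    (n := N) fun k hk => intervalIntegrable_cell hN hf hk
  rw [Finset.mul_sum]
  simp only [integral_cell hN] at this
  rw [this]
  simp [hN.ne']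

theorem exists_cell (hN : 0 < N) {x : ℝ} (hx : x ∈ Ico (0 : ℝ) 1) :
    ∃ i : ℕ, i < N ∧ ∃ s ∈ Ico (0 : ℝ) 1, x = (i + s) / N := by
  have hN' : (0 : ℝ) < N := by exact_mod_cast hN
  have h0 : 0 ≤ x * N := mul_nonneg hx.1 hN'.le
  refine ⟨⌊x * N⌋₊, ?_, x * N - ⌊x * N⌋₊, ⟨?_, ?_⟩, ?_⟩
  · rw [Nat.floor_lt h0]
    nlinarith [hx.2]
  · linarith [Nat.floor_le h0]
  · linarith [Nat.lt_floor_add_one (x * N)]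
  · field_simp; ring

theorem ae_exists_cell (hN : 0 < N) :
    ∀ᵐ x : ℝ, x ∈ Icc (0 : ℝ) 1 → ∃ i : ℕ, i < N ∧ ∃ s ∈ Ioo (0 : ℝ) 1, x = (i + s) / N := by
  have hc : (range fun i : ℕ => (i : ℝ) / N).Countable := countable_range _
  filter_upwards [hc.ae_notMem volume] with x hx hx01
  have h1 : x ≠ 1 := fun h => hx ⟨N, by
    have : (N : ℝ) ≠ 0 := by positivity
    simp [h, this]⟩
  obtain ⟨i, hi, s, hs, rfl⟩ := exists_cell hN ⟨hx01.1, lt_of_le_of_ne hx01.2 h1⟩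
  refine ⟨i, hi, s, ⟨lt_of_le_of_ne hs.1 fun h => hx ⟨i, ?_⟩, hs.2⟩, rfl⟩
  simp [← h]

theorem integral_congr_cells (hN : 0 < N) {f g : ℝ → ℝ}
    (h : ∀ i : ℕ, i < N → ∀ s ∈ Ioo (0 : ℝ) 1, f ((i + s) / N) = g ((i + s) / N)) :
    ∫ x in (0 : ℝ)..1, f x = ∫ x in (0 : ℝ)..1, g x := by
  refine integral_congr_ae ?_
  filter_upwards [ae_exists_cell hN] with x hx hx'
  rw [uIoc_of_le zero_le_one] at hx'
  obtain ⟨i, hi, s, hs, rfl⟩ := hx (Ioc_subset_Icc_self hx')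
  exact h i hi s hs

theorem integral_mono_cells (hN : 0 < N) {f g : ℝ → ℝ} (hf : f ∈ pcSpace N) (hg : g ∈ pcSpace N)
    (h : ∀ i : ℕ, i < N → ∀ s ∈ Ioo (0 : ℝ) 1, f ((i + s) / N) ≤ g ((i + s) / N)) :
    ∫ x in (0 : ℝ)..1, f x ≤ ∫ x in (0 : ℝ)..1, g x := by
  refine integral_mono_ae_restrict zero_le_one (intervalIntegrable_of_mem_pcSpace hN hf)
    (intervalIntegrable_of_mem_pcSpace hN hg) ?_
  rw [Filter.EventuallyLE, ae_restrict_iff' measurableSet_Icc]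
  filter_upwards [ae_exists_cell hN] with x hx hx'
  obtain ⟨i, hi, s, hs, rfl⟩ := hx hx'
  exact h i hi s hs

theorem l2Inner_comm (f g : ℝ → ℝ) : l2Inner f g = l2Inner g f := by
  simp only [l2Inner, mul_comm]

theorem l2Inner_congr (hN : 0 < N) {f f' g g' : ℝ → ℝ}
    (h : ∀ i : ℕ, i < N → ∀ s ∈ Ioo (0 : ℝ) 1, f ((i + s) / N) = f' ((i + s) / N))
    (h' : ∀ i : ℕ, i < N → ∀ s ∈ Ioo (0 : ℝ) 1, g ((i + s) / N) = g' ((i + s) / N)) :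
    l2Inner f g = l2Inner f' g' :=
  integral_congr_cells hN fun i hi s hs => by rw [h i hi s hs, h' i hi s hs]

theorem l2Inner_add_left (hN : 0 < N) {f g k : ℝ → ℝ} (hf : f ∈ pcSpace N) (hg : g ∈ pcSpace N)
    (hk : k ∈ pcSpace N) : l2Inner (fun x => f x + g x) k = l2Inner f k + l2Inner g k := by
  simp only [l2Inner, add_mul]
  exact intervalIntegral.integral_add (intervalIntegrable_of_mem_pcSpace hN (mul_mem_pcSpace hf hk))
    (intervalIntegrable_of_mem_pcSpace hN (mul_mem_pcSpace hg hk))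

theorem l2Inner_sub_left (hN : 0 < N) {f g k : ℝ → ℝ} (hf : f ∈ pcSpace N) (hg : g ∈ pcSpace N)
    (hk : k ∈ pcSpace N) : l2Inner (fun x => f x - g x) k = l2Inner f k - l2Inner g k := by
  simp only [l2Inner, sub_mul]
  exact intervalIntegral.integral_sub (intervalIntegrable_of_mem_pcSpace hN (mul_mem_pcSpace hf hk))
    (intervalIntegrable_of_mem_pcSpace hN (mul_mem_pcSpace hg hk))

theorem l2Inner_const_mul_left (c : ℝ) (f k : ℝ → ℝ) :
    l2Inner (fun x => c * f x) k = c * l2Inner f k := by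
  simp only [l2Inner, mul_assoc]
  exact intervalIntegral.integral_const_mul _ _

theorem l2Inner_add_right (hN : 0 < N) {f g k : ℝ → ℝ} (hf : f ∈ pcSpace N) (hg : g ∈ pcSpace N)
    (hk : k ∈ pcSpace N) : l2Inner k (fun x => f x + g x) = l2Inner k f + l2Inner k g := by
  rw [l2Inner_comm, l2Inner_add_left hN hf hg hk, l2Inner_comm f, l2Inner_comm g]

theorem l2Inner_const_mul_right (c : ℝ) (f k : ℝ → ℝ) :
    l2Inner k (fun x => c * f x) = c * l2Inner k f := by
  rw [l2Inner_comm, l2Inner_const_mul_left, l2Inner_comm]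

theorem l2Inner_self_nonneg (f : ℝ → ℝ) : 0 ≤ l2Inner f f :=
  integral_nonneg zero_le_one fun _ _ => mul_self_nonneg _

theorem l2Norm_nonneg (f : ℝ → ℝ) : 0 ≤ l2Norm f := Real.sqrt_nonneg _

theorem l2Norm_mul_self (f : ℝ → ℝ) : l2Norm f * l2Norm f = l2Inner f f :=
  Real.mul_self_sqrt (l2Inner_self_nonneg f)

theorem abs_l2Inner_le (hN : 0 < N) {f g : ℝ → ℝ} (hf : f ∈ pcSpace N) (hg : g ∈ pcSpace N) :
    |l2Inner f g| ≤ l2Norm f * l2Norm g := by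
  let B : pcSpace N →ₗ[ℝ] pcSpace N →ₗ[ℝ] ℝ := LinearMap.mk₂ ℝ
    (fun f g => l2Inner f g)
    (fun f f' g => l2Inner_add_left hN f.2 f'.2 g.2)
    (fun c f g => l2Inner_const_mul_left c f g)
    (fun f g g' => l2Inner_add_right hN g.2 g'.2 f.2)
    (fun c f g => l2Inner_const_mul_right c g f)
  exact abs_le_sqrt_mul_sqrt B (fun f g => l2Inner_comm _ _) (fun f => l2Inner_self_nonneg _)
    ⟨f, hf⟩ ⟨g, hg⟩

theorem l2Norm_add_le (hN : 0 < N) {f g : ℝ → ℝ} (hf : f ∈ pcSpace N) (hg : g ∈ pcSpace N) :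
    l2Norm (fun x => f x + g x) ≤ l2Norm f + l2Norm g := by
  rw [l2Norm, Real.sqrt_le_left (add_nonneg (l2Norm_nonneg _) (l2Norm_nonneg _)),
    l2Inner_add_left hN hf hg (add_mem_pcSpace hf hg), l2Inner_add_right hN hf hg hf,
    l2Inner_add_right hN hf hg hg, l2Inner_comm g f, ← l2Norm_mul_self f, ← l2Norm_mul_self g]
  have := (abs_le.1 (abs_l2Inner_le hN hf hg)).2
  linarith

theorem l2Norm_le_of_abs_le (hN : 0 < N) {f g : ℝ → ℝ} {K : ℝ} (hK : 0 ≤ K) (hf : f ∈ pcSpace N)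
    (hg : g ∈ pcSpace N)
    (h : ∀ i : ℕ, i < N → ∀ s ∈ Ioo (0 : ℝ) 1, |f ((i + s) / N)| ≤ K * |g ((i + s) / N)|) :
    l2Norm f ≤ K * l2Norm g := by
  rw [l2Norm, Real.sqrt_le_left (mul_nonneg hK (l2Norm_nonneg _)), mul_pow, sq (l2Norm g),
    l2Norm_mul_self, ← l2Inner_const_mul_left]
  refine integral_mono_cells hN (mul_mem_pcSpace hf hf)
    (mul_mem_pcSpace (const_mul_mem_pcSpace _ hg) hg) fun i hi s hs => ?_
  have := mul_self_le_mul_self (abs_nonneg _) (h i hi s hs)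
  rw [abs_mul_abs_self, mul_mul_mul_comm, abs_mul_abs_self] at this
  linarith

theorem l2Norm_one : l2Norm (fun _ => 1) = 1 := by simp [l2Norm, l2Inner]

theorem l2Norm_le_const (hN : 0 < N) {f : ℝ → ℝ} {K : ℝ} (hK : 0 ≤ K) (hf : f ∈ pcSpace N)
    (h : ∀ i : ℕ, i < N → ∀ s ∈ Ioo (0 : ℝ) 1, |f ((i + s) / N)| ≤ K) : l2Norm f ≤ K := by
  have := l2Norm_le_of_abs_le hN hK hf (continuous_mem_pcSpace (continuous_const (y := (1 : ℝ))))
    (fun i hi s hs => by simpa using h i hi s hs)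
  rwa [l2Norm_one, mul_one] at this

theorem l2Norm_abs (f : ℝ → ℝ) : l2Norm (fun x => |f x|) = l2Norm f := by
  simp [l2Norm, l2Inner, abs_mul_abs_self]

theorem integral_abs_le_l2Norm (hN : 0 < N) {f : ℝ → ℝ} (hf : f ∈ pcSpace N) :
    ∫ x in (0 : ℝ)..1, |f x| ≤ l2Norm f := by
  have := abs_l2Inner_le hN (abs_mem_pcSpace hf)
    (continuous_mem_pcSpace (N := N) (continuous_const (y := (1 : ℝ))))
  rw [l2Norm_one, mul_one, l2Norm_abs] at this
  refine le_trans (le_of_eq ?_) ((le_abs_self _).trans this)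
  simp [l2Inner]

/-- Continuous functions that take the same values at `0` and `1` and are continuously
differentiable on the mesh cells. -/
structure IsPiecewiseC1 (N : ℕ) (f : ℝ → ℝ) : Prop where
  continuous : Continuous f
  periodic : f 1 = f 0
  differentiableAt : ∀ i : ℕ, i < N → ∀ s ∈ Ioo (0 : ℝ) 1, DifferentiableAt ℝ f ((i + s) / N)
  deriv_mem : deriv f ∈ pcSpace N

namespace IsPiecewiseC1

theorem mem {f : ℝ → ℝ} (hf : IsPiecewiseC1 N f) : f ∈ pcSpace N :=
  continuous_mem_pcSpace hf.continuous

theorem of_contDiff {f : ℝ → ℝ} (hf : ContDiff ℝ 1 f) (hp : Function.Periodic f 1) :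
    IsPiecewiseC1 N f where
  continuous := hf.continuous
  periodic := by simpa using hp 0
  differentiableAt _ _ _ _ := (hf.differentiable one_ne_zero).differentiableAt
  deriv_mem := continuous_mem_pcSpace (hf.continuous_deriv le_rfl)

theorem mul {f g : ℝ → ℝ} (hf : IsPiecewiseC1 N f) (hg : IsPiecewiseC1 N g) :
    IsPiecewiseC1 N fun x => f x * g x where
  continuous := hf.continuous.mul hg.continuous
  periodic := by rw [hf.periodic, hg.periodic]
  differentiableAt i hi s hs := (hf.differentiableAt i hi s hs).mul (hg.differentiableAt i hi s hs)
  deriv_mem := mem_pcSpace_congr (add_mem_pcSpace (mul_mem_pcSpace hf.deriv_mem hg.mem)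
    (mul_mem_pcSpace hf.mem hg.deriv_mem)) fun i hi s hs =>
      deriv_fun_mul (hf.differentiableAt i hi s hs) (hg.differentiableAt i hi s hs)

theorem sub {f g : ℝ → ℝ} (hf : IsPiecewiseC1 N f) (hg : IsPiecewiseC1 N g) :
    IsPiecewiseC1 N fun x => f x - g x where
  continuous := hf.continuous.sub hg.continuous
  periodic := by rw [hf.periodic, hg.periodic]
  differentiableAt i hi s hs := (hf.differentiableAt i hi s hs).sub (hg.differentiableAt i hi s hs)
  deriv_mem := mem_pcSpace_congr (sub_mem_pcSpace hf.deriv_mem hg.deriv_mem) fun i hi s hs =>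
      deriv_fun_sub (hf.differentiableAt i hi s hs) (hg.differentiableAt i hi s hs)

/-- The fundamental theorem of calculus off the countable set of knots; continuity leaves no jump
terms and periodicity cancels the end points. -/
theorem integral_deriv (hN : 0 < N) {f : ℝ → ℝ} (hf : IsPiecewiseC1 N f) :
    ∫ x in (0 : ℝ)..1, deriv f x = 0 := by
  rw [integral_eq_of_hasDerivAt_off_countable f (deriv f)
    (countable_range fun i : ℕ => (i : ℝ) / N) hf.continuous.continuousOn ?_
    (intervalIntegrable_of_mem_pcSpace hN hf.deriv_mem), hf.periodic, sub_self]
  rintro x ⟨hx, hx'⟩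
  rw [min_eq_left zero_le_one, max_eq_right zero_le_one] at hx
  obtain ⟨i, hi, s, hs, rfl⟩ := exists_cell hN (Ioo_subset_Ico_self hx)
  have hs0 : 0 < s := lt_of_le_of_ne hs.1 fun h => hx' ⟨i, by simp [← h]⟩
  exact (hf.differentiableAt i hi s ⟨hs0, hs.2⟩).hasDerivAt

/-- Integration by parts. -/
theorem l2Inner_deriv (hN : 0 < N) {f g : ℝ → ℝ} (hf : IsPiecewiseC1 N f)
    (hg : IsPiecewiseC1 N g) : l2Inner (deriv f) g = -l2Inner f (deriv g) := by
  have h := (hf.mul hg).integral_deriv hN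
  rw [integral_congr_cells hN (g := fun x => deriv f x * g x + f x * deriv g x) fun i hi s hs =>
      deriv_fun_mul (hf.differentiableAt i hi s hs) (hg.differentiableAt i hi s hs),
    intervalIntegral.integral_add (intervalIntegrable_of_mem_pcSpace hN
      (mul_mem_pcSpace hf.deriv_mem hg.mem)) (intervalIntegrable_of_mem_pcSpace hN
      (mul_mem_pcSpace hf.mem hg.deriv_mem))] at h
  exact eq_neg_of_add_eq_zero_left h

end IsPiecewiseC1

end PiecewiseContinuous

end

section

open MeasureTheory intervalIntegral

/-! ### Splines through their cell polynomials. -/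

section SplineCells

open Polynomial

variable {n N : ℕ} {φ : ℝ → ℝ}

theorem comp_linear_mem_degreeLT {k : ℕ} {p : ℝ[X]} (h : p ∈ degreeLT ℝ k) (a b : ℝ) :
    p.comp (C a * X + C b) ∈ degreeLT ℝ k := by
  induction k generalizing p with
  | zero =>
    have : p = 0 := by simpa [degreeLT] using (mem_degreeLT.1 h)
    simp [this]
  | succ k ih =>
    apply mem_degreeLT_succ_of_derivative
    rw [derivative_comp]
    have := (degreeLT ℝ k).smul_mem a (ih (derivative_mem_degreeLT h))
    simpa [smul_eq_C_mul] using this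

/-- The identity holds on the open cell by differentiation and extends to the end points by
continuity. Applied from both sides of a knot, it turns global smoothness into matching conditions.
-/
theorem iteratedDeriv_eq_of_eqOn_cell {ψ : ℝ → ℝ} {q : ℝ[X]} {i : ℝ} {j : ℕ}
    (hψ : ContDiff ℝ j ψ) (h : ∀ s ∈ Ioo (0 : ℝ) 1, ψ (i + s) = q.eval s) :
    ∀ s ∈ Icc (0 : ℝ) 1, iteratedDeriv j ψ (i + s) = (derivative^[j] q).eval s := by
  have hopen : ∀ j : ℕ, ∀ s ∈ Ioo (0 : ℝ) 1,
      iteratedDeriv j ψ (i + s) = (derivative^[j] q).eval s := by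
    intro j
    induction j with
    | zero => simpa using h
    | succ j ih =>
      intro s hs
      rw [iteratedDeriv_succ, Function.iterate_succ_apply', ← Polynomial.deriv,
        ← deriv_comp_const_add (f := iteratedDeriv j ψ)]
      refine Filter.EventuallyEq.deriv_eq ?_
      filter_upwards [isOpen_Ioo.mem_nhds hs] with y hy using ih y hy
  have hc : Continuous fun s : ℝ => iteratedDeriv j ψ (i + s) :=
    (hψ.continuous_iteratedDeriv' j).comp (continuous_const.add continuous_id)
  have h0 : EqOn (fun s : ℝ => iteratedDeriv j ψ (i + s)) (fun s => (derivative^[j] q).eval s)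
      (Ioo 0 1) := fun s hs => hopen j s hs
  have := h0.closure hc (Polynomial.continuous _)
  rwa [closure_Ioo zero_ne_one] at this

theorem exists_isCellSpline (hN : 0 < N) (hφ : φ ∈ splineSpace (n + 2) N) :
    ∃ q, IsCellSpline N (n + 2) q ∧
      ∀ i : ℕ, ∀ s ∈ Icc (0 : ℝ) 1, φ ((i + s) / N) = (q i).eval s := by
  obtain ⟨hper, hsm, hpoly⟩ := hφ
  have hN' : (0 : ℝ) < N := by exact_mod_cast hN
  choose! p hp hpe using hpoly
  -- Indexing the cells modulo `N` extends them to all natural numbers, so the matching condition at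
  -- the end of the period needs no separate treatment.
  have hq : ∀ i : ℕ, ∀ s ∈ Icc (0 : ℝ) 1,
      φ ((i + s) / N) = ((p (i % N)).comp (C (1 / (N : ℝ)) * X + C (((i % N : ℕ) : ℝ) / N))).eval s := by
    intro i s hs
    have h1 : ((i : ℝ) + s) / N = (((i % N : ℕ) : ℝ) + s) / N + ((i / N : ℕ) : ℝ) * 1 := by
      have : (i : ℝ) = ((i % N : ℕ) : ℝ) + N * ((i / N : ℕ) : ℝ) := by
        exact_mod_cast (Nat.mod_add_div i N).symm
      rw [this]
      field_simp
      ring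
    have h2 := hper.nat_mul (i / N) ((((i % N : ℕ) : ℝ) + s) / N)
    rw [h1, h2, hpe (i % N) (Nat.mod_lt _ hN)]
    · simp only [eval_comp, eval_add, eval_mul, eval_C, eval_X]
      congr 1; ring
    · constructor
      · gcongr; linarith [hs.1]
      · gcongr; exact hs.2
  refine ⟨_, ⟨fun i => comp_linear_mem_degreeLT (hp _ (Nat.mod_lt _ hN)) _ _, ?_, ?_⟩, hq⟩
  · intro i j hj
    have hψ : ContDiff ℝ j fun y => φ (y / N) := by
      have : ContDiff ℝ n φ := by simpa using hsm
      exact (this.of_le (by exact_mod_cast (show j ≤ n by omega))).comp (contDiff_id.div_const _)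
    have e1 := iteratedDeriv_eq_of_eqOn_cell hψ (i := i)
      (fun s hs => hq i s (Ioo_subset_Icc_self hs)) 1 (by simp)
    have e2 := iteratedDeriv_eq_of_eqOn_cell hψ (i := (i + 1 : ℕ))
      (fun s hs => hq (i + 1) s (Ioo_subset_Icc_self hs)) 0 (by simp)
    rw [← e1, ← e2]
    push_cast
    rw [add_zero]
  · simp

theorem hasDerivAt_of_cell (hN : 0 < N) {f : ℝ → ℝ} {q : ℝ[X]} {i : ℕ}
    (hq : ∀ s ∈ Icc (0 : ℝ) 1, f ((i + s) / N) = q.eval s) {s : ℝ} (hs : s ∈ Ioo (0 : ℝ) 1) :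
    HasDerivAt f (N * (derivative q).eval s) ((i + s) / N) := by
  have hN' : (0 : ℝ) < N := by exact_mod_cast hN
  have h1 : HasDerivAt (fun x : ℝ => q.eval (x * N - i)) ((derivative q).eval s * N)
      (((i : ℝ) + s) / N) := by
    have h2 : HasDerivAt (fun x : ℝ => x * N - i) N (((i : ℝ) + s) / N) := by
      simpa using ((hasDerivAt_id (((i : ℝ) + s) / N)).mul_const (N : ℝ)).sub_const (i : ℝ)
    have h3 : HasDerivAt (fun y => q.eval y) ((derivative q).eval s)
        (((i : ℝ) + s) / N * N - i) := by
      rw [div_mul_cancel₀ _ hN'.ne', add_sub_cancel_left]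
      exact q.hasDerivAt s
    exact HasDerivAt.comp (((i : ℝ) + s) / N) h3 h2
  rw [mul_comm]
  refine h1.congr_of_eventuallyEq ?_
  have hlt : (i : ℝ) / N < (i + s) / N := by gcongr; linarith [hs.1]
  have hlt' : ((i : ℝ) + s) / N < (i + 1) / N := by gcongr; exact hs.2
  filter_upwards [Ioo_mem_nhds hlt hlt'] with x hx
  have h4 := (div_lt_iff₀ hN').1 hx.1
  have h5 := (lt_div_iff₀ hN').1 hx.2
  rw [← hq (x * N - i) ⟨by linarith, by linarith⟩]
  congr 1
  field_simp
  ring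

theorem isPiecewiseC1_of_mem_splineSpace (hN : 0 < N) (hφ : φ ∈ splineSpace (n + 2) N) :
    IsPiecewiseC1 N φ := by
  obtain ⟨q, -, hqe⟩ := exists_isCellSpline hN hφ
  refine ⟨hφ.2.1.continuous, by simpa using hφ.1 0, fun i _ s hs =>
    (hasDerivAt_of_cell hN (hqe i) hs).differentiableAt, fun i _ => ⟨fun s =>
    N * (derivative (q i)).eval s, continuous_const.mul (Polynomial.continuous _), fun s hs =>
    (hasDerivAt_of_cell hN (hqe i) hs).deriv⟩⟩

theorem exists_cell_of_periodic (hN : 0 < N) {f : ℝ → ℝ} (hf : Function.Periodic f 1) (x : ℝ) :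
    ∃ i : ℕ, i < N ∧ ∃ s ∈ Ico (0 : ℝ) 1, f x = f ((i + s) / N) := by
  obtain ⟨i, hi, s, hs, h⟩ := exists_cell hN (x := Int.fract x) ⟨Int.fract_nonneg x, Int.fract_lt_one x⟩
  refine ⟨i, hi, s, hs, ?_⟩
  rw [← h, Int.fract]
  have := hf.sub_zsmul_eq (x := x) ⌊x⌋
  simpa using this.symm

/-- Evaluation of splines at finitely many points is injective. -/
theorem exists_injective_eval (hN : 0 < N) :
    ∃ e : splineSpace (n + 2) N →ₗ[ℝ] (Fin N × Fin (n + 2) → ℝ), Function.Injective e ∧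
      ∃ z : Fin N × Fin (n + 2) → ℝ, ∀ φ j, e φ j = φ.1 (z j) := by
  -- On each cell `n + 2` distinct points determine a polynomial of degree below `n + 2`.
  let z : Fin N × Fin (n + 2) → ℝ := fun j => ((j.1 : ℕ) + ((j.2 : ℕ) : ℝ) / (n + 2)) / N
  refine ⟨{ toFun := fun φ j => φ.1 (z j), map_add' := fun _ _ => rfl,
            map_smul' := fun _ _ => rfl }, ?_, z, fun _ _ => rfl⟩
  rw [injective_iff_map_eq_zero]
  intro φ h0
  obtain ⟨q, hq, hqe⟩ := exists_isCellSpline hN φ.2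
  have hn : (0 : ℝ) < n + 2 := by positivity
  have hz : ∀ i < N, q i = 0 := by
    intro i hi
    let s : Finset ℝ := Finset.univ.image fun j : Fin (n + 2) => ((j : ℕ) : ℝ) / (n + 2)
    have hcard : s.card = n + 2 := by
      rw [Finset.card_image_of_injective]
      · simp
      · intro a b hab
        have := (div_left_inj' hn.ne').1 hab
        exact Fin.ext (by exact_mod_cast this)
    refine eq_zero_of_degree_lt_of_eval_finset_eq_zero s ?_ ?_
    · rw [hcard]; exact mem_degreeLT.1 (hq.mem i)
    · intro x hx
      obtain ⟨j, -, rfl⟩ := Finset.mem_image.1 hx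
      rw [← hqe i _ ⟨by positivity, ?_⟩]
      · exact congrFun h0 (⟨i, hi⟩, j)
      · rw [div_le_one hn]
        exact_mod_cast j.2.le
  ext x
  obtain ⟨i, hi, s, hs, h⟩ := exists_cell_of_periodic hN φ.2.1 x
  rw [h, hqe i s (Ico_subset_Icc_self hs), hz i hi]
  simp

theorem finiteDimensional_splineSpace (hN : 0 < N) :
    FiniteDimensional ℝ (splineSpace (n + 2) N) := by
  obtain ⟨e, he, -⟩ := exists_injective_eval (n := n) hN
  exact Module.Finite.of_injective e he

theorem eq_zero_of_l2Inner_self (hφ : φ ∈ splineSpace (n + 2) N)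
    (h : l2Inner φ φ = 0) : φ = 0 := by
  have hz : ∀ y ∈ Icc (0 : ℝ) 1, φ y = 0 := by
    intro y hy
    by_contra hne
    have : 0 < ∫ y in (0 : ℝ)..1, φ y * φ y :=
      integral_pos zero_lt_one (hφ.2.1.continuous.mul hφ.2.1.continuous).continuousOn
        (fun y _ => mul_self_nonneg _) ⟨y, hy, mul_self_pos.2 hne⟩
    exact this.ne' h
  ext x
  have := hφ.1.sub_zsmul_eq (x := x) ⌊x⌋
  rw [← this]
  exact hz _ (by
    have : x - ⌊x⌋ • (1 : ℝ) = Int.fract x := by rw [zsmul_eq_mul, mul_one]; rfl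
    rw [this]
    exact ⟨Int.fract_nonneg x, (Int.fract_lt_one x).le⟩)

/-- Converts `L¹` norms in cell variables into the global `L²` norm. The scale `c` is 1 when `f` is
a spline and `N` when it is the derivative of one. -/
theorem sum_cells_abs_le (hN : 0 < N) {f : ℝ → ℝ} {q : ℕ → ℝ[X]} {c : ℝ} (hf : f ∈ pcSpace N)
    (hq : ∀ i : ℕ, i < N → ∀ s ∈ Ioo (0 : ℝ) 1, f ((i + s) / N) = c * (q i).eval s) (hc : 0 ≤ c) :
    c * ∑ i ∈ Finset.range N, ∫ s in (0 : ℝ)..1, |(q i).eval s| ≤ N * l2Norm f := by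
  have h1 := integral_abs_le_l2Norm hN hf
  have hN' : (0 : ℝ) < N := by exact_mod_cast hN
  rw [integral_eq_sum_cells hN (abs_mem_pcSpace hf), one_div, inv_mul_le_iff₀ hN'] at h1
  refine le_trans (le_of_eq ?_) h1
  rw [Finset.mul_sum]
  refine Finset.sum_congr rfl fun i hi => ?_
  rw [← intervalIntegral.integral_const_mul]
  refine integral_congr_uIoo fun s hs => ?_
  rw [uIoo_of_le zero_le_one] at hs
  simp only [hq i (Finset.mem_range.1 hi) s hs, abs_mul, abs_of_nonneg hc]

/-- Inverse inequality for derivatives of splines. -/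
theorem exists_abs_deriv_le (n : ℕ) : ∃ C, 0 ≤ C ∧ ∀ (N : ℕ), 0 < N → ∀ φ ∈ splineSpace (n + 2) N,
    ∀ i : ℕ, i < N → ∀ s ∈ Ioo (0 : ℝ) 1,
      |deriv φ ((i + s) / N)| ≤ C * N * l2Norm (deriv φ) := by
  obtain ⟨C, hC, h⟩ := exists_inverse_inequality (n + 1)
  refine ⟨C, hC, fun N hN φ hφ i hi s hs => ?_⟩
  obtain ⟨q, hq, hqe⟩ := exists_isCellSpline hN hφ
  have hd : ∀ i : ℕ, i < N → ∀ s ∈ Ioo (0 : ℝ) 1,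
      deriv φ ((i + s) / N) = N * (derivative (q i)).eval s := fun i _ s hs =>
    (hasDerivAt_of_cell hN (hqe i) hs).deriv
  have h1 := sum_cells_abs_le hN (isPiecewiseC1_of_mem_splineSpace hN hφ).deriv_mem
    (q := fun i => derivative (q i)) hd (by positivity)
  -- Bounding one cell by the sum over all cells is crude, but the resulting factor `N` is
  -- affordable because `r ≥ 2`.
  have h2 : ∫ s in (0 : ℝ)..1, |(derivative (q i)).eval s| ≤
      ∑ i ∈ Finset.range N, ∫ s in (0 : ℝ)..1, |(derivative (q i)).eval s| :=
    Finset.single_le_sum (f := fun i => ∫ s in (0 : ℝ)..1, |(derivative (q i)).eval s|)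
      (fun i _ => integral_nonneg zero_le_one fun _ _ => abs_nonneg _) (Finset.mem_range.2 hi)
  have h3 := (h _ (derivative_mem_degreeLT (hq.mem i)) s (Ioo_subset_Icc_self hs)).1
  rw [hd i hi s hs, abs_mul, Nat.abs_cast]
  calc (N : ℝ) * |(derivative (q i)).eval s|
      ≤ N * (C * ∑ i ∈ Finset.range N, ∫ s in (0 : ℝ)..1, |(derivative (q i)).eval s|) := by
        gcongr; exact h3.trans (by gcongr)
    _ = C * (N * ∑ i ∈ Finset.range N, ∫ s in (0 : ℝ)..1, |(derivative (q i)).eval s|) := by ring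
    _ ≤ C * (N * l2Norm (deriv φ)) := by gcongr
    _ = _ := by ring

end SplineCells

end

section

open MeasureTheory intervalIntegral

/-! ### Quasi-interpolation on the mesh of width `1 / N` and superconvergence. -/

section MeshQuasi

open Polynomial

/-- The quasi-interpolant of order `n + 2` on the mesh of width `1 / N`. -/
def meshQuasi (n N : ℕ) (v : ℝ → ℝ) : ℝ → ℝ :=
  fun x => quasi (n + 1) (fun y => v (y / N)) (x * N)

variable {n N : ℕ} {v : ℝ → ℝ}

theorem meshQuasi_mem (hN : 0 < N) (hv : Function.Periodic v 1) :
    meshQuasi n N v ∈ splineSpace (n + 2) N := by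
  have hN' : (N : ℝ) ≠ 0 := by positivity
  refine ⟨fun x => ?_, ?_, fun i _ => ?_⟩
  · have h1 : (fun y => v (y / N)) = fun y => (fun z => v (z / N)) (y + (N : ℤ)) := by
      ext y
      simp only [Int.cast_natCast, add_div, div_self hN', hv _]
    simp only [meshQuasi]
    have h2 := (congrArg (fun f => quasi (n + 1) f (x * N)) h1).trans
      (quasi_shift (n + 1) (fun z => v (z / N)) (N : ℤ) (x * N))
    rw [add_mul, one_mul]
    exact h2.symm
  · exact (contDiff_quasi n _).comp (contDiff_id.mul contDiff_const)
  · obtain ⟨q, hq, hqe⟩ := exists_quasi_eq_eval n (fun y => v (y / N)) i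
    refine ⟨_, comp_linear_mem_degreeLT hq N (-i), fun x hx => ?_⟩
    have hN0 : (0 : ℝ) < N := by positivity
    have h1 := (div_le_iff₀ hN0).1 hx.1
    have h2 := (le_div_iff₀ hN0).1 hx.2
    have := hqe (x * N - i) ⟨by linarith, by linarith⟩
    simp only [Int.cast_natCast, add_sub_cancel] at this
    simp only [meshQuasi, this, eval_comp, eval_add, eval_mul, eval_C, eval_X]
    congr 1; ring

open Classical in
-- Only nodal values matter, so a periodic function may be replaced by a combination of indicators
-- of the classes `j / N + ℤ`. The resulting finite sum is what makes quasi-interpolation commute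
-- with time differentiation.
theorem meshQuasi_eq_sum (hN : 0 < N) :
    ∃ β : ℕ → ℝ → ℝ, (∀ j, β j ∈ splineSpace (n + 2) N) ∧
      ∀ v : ℝ → ℝ, Function.Periodic v 1 →
        meshQuasi n N v = ∑ j ∈ Finset.range N, v (j / N) • β j := by
  have hN' : (N : ℝ) ≠ 0 := by positivity
  let δ : ℕ → ℝ → ℝ := fun j x => if ∃ k : ℤ, x = j / N + k then 1 else 0
  have hδ : ∀ j, Function.Periodic (δ j) 1 := fun j x => by
    simp only [δ]
    refine if_congr ⟨?_, ?_⟩ rfl rfl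
    · rintro ⟨k, hk⟩; exact ⟨k - 1, by push_cast; linarith⟩
    · rintro ⟨k, hk⟩; exact ⟨k + 1, by push_cast; linarith⟩
  refine ⟨fun j => meshQuasi n N (δ j), fun j => meshQuasi_mem hN (hδ j), fun v hv => ?_⟩
  have key : quasi (n + 1) (fun y => v (y / N)) =
      quasi (n + 1) (∑ j ∈ Finset.range N, v (j / N) • fun y => δ j (y / N)) := by
    refine quasi_congr fun i => ?_
    simp only [Finset.sum_apply, Pi.smul_apply, smul_eq_mul]
    have hNz : (N : ℤ) ≠ 0 := by exact_mod_cast hN.ne'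
    have hmod0 := Int.emod_nonneg i hNz
    have hmodlt := Int.emod_lt_of_pos i (by exact_mod_cast hN : (0 : ℤ) < N)
    obtain ⟨m, hm⟩ := Int.eq_ofNat_of_zero_le hmod0
    have hi : (i : ℝ) / N = (m : ℝ) / N + ((i / N : ℤ) : ℝ) := by
      have h1 : (i : ℝ) = (m : ℝ) + N * ((i / N : ℤ) : ℝ) := by
        have := Int.emod_add_mul_ediv i N
        rw [hm] at this
        exact_mod_cast this.symm
      rw [h1, add_div, mul_div_cancel_left₀ _ hN']
    have hmN : m < N := by omega
    rw [Finset.sum_eq_single m]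
    · have h1 : δ m ((i : ℝ) / N) = 1 := if_pos ⟨_, hi⟩
      rw [h1, mul_one, hi]
      have := hv.int_mul (i / N) (m / N)
      rw [mul_one] at this
      exact this
    · intro j hj hjm
      have h1 : δ j ((i : ℝ) / N) = 0 := if_neg fun ⟨k, hk⟩ => hjm <| by
        rw [hi] at hk
        have h2 : (m : ℝ) + N * ((i / N : ℤ) : ℝ) = j + N * k := by
          field_simp at hk
          linarith
        have h3 : (m : ℤ) + N * (i / N) = j + N * k := by exact_mod_cast h2
        have h4 := congrArg (· % (N : ℤ)) h3
        simp only [Int.add_mul_emod_self_left] at h4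
        have := Finset.mem_range.1 hj
        rw [Int.emod_eq_of_lt (by omega) (by omega), Int.emod_eq_of_lt (by omega) (by omega)] at h4
        omega
      rw [h1, mul_zero]
    · intro h; exact absurd (Finset.mem_range.2 hmN) h
  ext x
  simp only [meshQuasi]
  rw [key, map_sum]
  simp [meshQuasi, Finset.sum_apply]

theorem iteratedDeriv_comp_div {k : ℕ} (hv : ContDiff ℝ k v) (N : ℕ) :
    iteratedDeriv k (fun y => v (y / N)) =
      fun y => (1 / (N : ℝ)) ^ k * iteratedDeriv k v (y / N) := by
  have := iteratedDeriv_comp_const_mul hv (1 / (N : ℝ))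
  simpa only [one_div_mul_eq_div] using this

theorem exists_abs_sub_meshQuasi_le (n : ℕ) : ∃ C, 0 ≤ C ∧ ∀ (N : ℕ) (v : ℝ → ℝ) (K : ℝ), 0 < N →
    ContDiff ℝ (n + 2 : ℕ) v → (∀ x, |iteratedDeriv (n + 2) v x| ≤ K) →
    ∀ x, |v x - meshQuasi n N v x| ≤ C * K * (1 / (N : ℝ)) ^ (n + 2) := by
  obtain ⟨C, hC, h⟩ := exists_abs_splineErr_le (n + 1)
  refine ⟨C, hC, fun N v K hN hv hK x => ?_⟩
  have hN' : (N : ℝ) ≠ 0 := by positivity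
  have := h (fun y => v (y / N)) ((1 / (N : ℝ)) ^ (n + 2) * K) (hv.comp (contDiff_id.div_const _))
    (fun y => by
      rw [iteratedDeriv_comp_div hv, abs_mul, abs_of_nonneg (by positivity)]
      gcongr
      exact hK _) (x * N)
  rw [splineErr_eq, mul_div_cancel_right₀ _ hN'] at this
  refine this.trans (le_of_eq (by ring))

/-- Rescaling: the `n + 2` derivatives of the leading term give `h^(n+2)` and the chain rule costs
`N`. The lost order sits entirely in a multiple of `b'`, whose cell mean vanishes because `b(0) =
b(1)`. -/
theorem exists_deriv_sub_meshQuasi (n : ℕ) : ∃ (C : ℝ) (b : ℝ[X]), 0 ≤ C ∧ b.eval 0 = b.eval 1 ∧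
    ∀ (N : ℕ) (v : ℝ → ℝ) (K : ℝ), 0 < N → ContDiff ℝ (n + 3 : ℕ) v →
    (∀ x, |iteratedDeriv (n + 3) v x| ≤ K) → ∀ i : ℕ, ∀ s ∈ Ioo (0 : ℝ) 1,
      |deriv (fun x => v x - meshQuasi n N v x) ((i + s) / N) -
        (1 / (N : ℝ)) ^ (n + 1) * iteratedDeriv (n + 2) v (i / N) * (derivative b).eval s| ≤
        C * K * (1 / (N : ℝ)) ^ (n + 2) := by
  obtain ⟨C, b, hC, hb, h⟩ := exists_hasDerivAt_splineErr n
  refine ⟨C, b, hC, hb, fun N v K hN hv hK i s hs => ?_⟩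
  have hN' : (N : ℝ) ≠ 0 := by positivity
  obtain ⟨d, hd, hdb⟩ := h (fun y => v (y / N)) ((1 / (N : ℝ)) ^ (n + 3) * K)
    (hv.comp (contDiff_id.div_const _))
    (fun y => by
      rw [iteratedDeriv_comp_div hv, abs_mul, abs_of_nonneg (by positivity)]
      gcongr
      exact hK _) i s hs
  rw [iteratedDeriv_comp_div (hv.of_le (by exact_mod_cast Nat.le_succ _))] at hdb
  have h1 : HasDerivAt (fun x => v x - meshQuasi n N v x) (d * N) (((i : ℝ) + s) / N) := by
    have h2 : (fun x => v x - meshQuasi n N v x) =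
        fun x => splineErr (n + 1) (fun y => v (y / N)) (x * N) := by
      ext x
      rw [splineErr_eq, mul_div_cancel_right₀ _ hN', meshQuasi]
    rw [h2]
    have h3 : HasDerivAt (splineErr (n + 1) (fun y => v (y / N))) d (((i : ℝ) + s) / N * N) := by
      rw [div_mul_cancel₀ _ hN']
      exact_mod_cast hd
    have h4 : HasDerivAt (fun x : ℝ => x * N) N (((i : ℝ) + s) / N) := by
      simpa using (hasDerivAt_id (((i : ℝ) + s) / N)).mul_const (N : ℝ)
    exact HasDerivAt.comp (((i : ℝ) + s) / N) h3 h4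
  rw [h1.deriv]
  push_cast at hdb
  have h5 : d * N - (1 / (N : ℝ)) ^ (n + 1) * iteratedDeriv (n + 2) v (i / N) *
      (derivative b).eval s = N * (d - (1 / (N : ℝ)) ^ (n + 2) * iteratedDeriv (n + 2) v (i / N) *
      (derivative b).eval s) := by
    rw [pow_succ (1 / (N : ℝ)) (n + 1)]
    field_simp
  rw [h5, abs_mul, Nat.abs_cast]
  calc _ ≤ (N : ℝ) * (C * ((1 / (N : ℝ)) ^ (n + 3) * K)) := by gcongr
    _ = _ := by
      rw [pow_succ (1 / (N : ℝ)) (n + 2)]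
      field_simp

theorem intervalIntegral_abs_le_mul_of_Ioo {f : ℝ → ℝ} {q : ℝ[X]} {K : ℝ}
    (h : ∀ s ∈ Ioo (0 : ℝ) 1, |f s| ≤ K * |q.eval s|) :
    |∫ s in (0 : ℝ)..1, f s| ≤ K * ∫ s in (0 : ℝ)..1, |q.eval s| := by
  have h1 : ∫ s in (0 : ℝ)..1, f s = ∫ s in (0 : ℝ)..1, if s ∈ Ioo (0 : ℝ) 1 then f s else 0 :=
    integral_congr_uIoo fun s hs => by
      rw [uIoo_of_le zero_le_one] at hs
      simp only [if_pos hs]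
  have hK : 0 ≤ K * |q.eval (1 / 2)| := (abs_nonneg _).trans (h (1 / 2) (by norm_num))
  rw [h1]
  rw [← intervalIntegral.integral_const_mul]
  have hae : ∀ᵐ s : ℝ, s ≠ 1 := by simp [ae_iff]
  refine norm_integral_le_of_norm_le (f := fun s => if s ∈ Ioo (0 : ℝ) 1 then f s else 0)
    zero_le_one ?_ ?_
  · filter_upwards [hae] with s hs1 hs
    have : s ∈ Ioo (0 : ℝ) 1 := ⟨hs.1, lt_of_le_of_ne hs.2 hs1⟩
    rw [if_pos this]
    exact h s this
  · exact (continuous_const.mul q.continuous.abs).intervalIntegrable _ _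

theorem abs_sub_le_of_abs_deriv_le {f : ℝ → ℝ} {K : ℝ} (hf : Differentiable ℝ f)
    (hK : ∀ x, |deriv f x| ≤ K) (x y : ℝ) : |f x - f y| ≤ K * |x - y| :=
  convex_univ.norm_image_sub_le_of_norm_deriv_le (fun z _ => hf z) (fun z _ => hK z)
    (mem_univ y) (mem_univ x)

/-- Superconvergence of the derivative of the quasi-interpolation error in the weak sense. -/
theorem exists_abs_l2Inner_deriv_sub_le (n k : ℕ) : ∃ C, 0 ≤ C ∧
    ∀ (N : ℕ) (v g f : ℝ → ℝ) (q : ℕ → ℝ[X]) (c K₂ K₃ G₀ G₁ : ℝ), 0 < N →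
    ContDiff ℝ (n + 3 : ℕ) v → Function.Periodic v 1 → ContDiff ℝ 1 g → Function.Periodic g 1 →
    (∀ x, |iteratedDeriv (n + 2) v x| ≤ K₂) → (∀ x, |iteratedDeriv (n + 3) v x| ≤ K₃) →
    (∀ x, |g x| ≤ G₀) → (∀ x, |deriv g x| ≤ G₁) → IsCellSpline N (k + 1) q → 0 ≤ c →
    f ∈ pcSpace N →
    (∀ i : ℕ, i < N → ∀ s ∈ Ioo (0 : ℝ) 1, f ((i + s) / N) = c * (q i).eval s) →
      |l2Inner (fun x => g x * deriv (fun x => v x - meshQuasi n N v x) x) f| ≤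
        C * (G₀ * K₃ + G₁ * K₂) * (1 / (N : ℝ)) ^ (n + 2) * l2Norm f := by
  obtain ⟨C₁, b, hC₁, hb, h₁⟩ := exists_deriv_sub_meshQuasi n
  have hb0 : ∫ s in (0 : ℝ)..1, (derivative b).eval s = 0 := by
    rw [integral_eq_sub_of_hasDerivAt (fun s _ => b.hasDerivAt s)
      ((derivative b).continuous.intervalIntegrable _ _), hb, sub_self]
  obtain ⟨C₂, hC₂, h₂⟩ := exists_abs_sum_integral_le k (derivative b) hb0
  obtain ⟨B, hB, hBb⟩ := exists_bound_eval (derivative b)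
  refine ⟨C₁ + B + C₂, by positivity, ?_⟩
  intro N v g f q c K₂ K₃ G₀ G₁ hN hv hvp hg hgp hK₂ hK₃ hG₀ hG₁ hq hc hf hfq
  have hN' : (0 : ℝ) < N := by exact_mod_cast hN
  have hK₂0 : 0 ≤ K₂ := (abs_nonneg _).trans (hK₂ 0)
  have hK₃0 : 0 ≤ K₃ := (abs_nonneg _).trans (hK₃ 0)
  have hG₀0 : 0 ≤ G₀ := (abs_nonneg _).trans (hG₀ 0)
  have hG₁0 : 0 ≤ G₁ := (abs_nonneg _).trans (hG₁ 0)
  set H : ℝ := 1 / (N : ℝ) with hH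
  have hH0 : 0 < H := by positivity
  set w := iteratedDeriv (n + 2) v with hw
  have hw1 : ContDiff ℝ 1 w := by
    have h := ContDiff.iterate_deriv' 1 (n + 2) (f := v)
      (by rw [show 1 + (n + 2) = n + 3 by ring]; exact hv)
    rw [hw, iteratedDeriv_eq_iterate]
    exact_mod_cast h
  have hwd : deriv w = iteratedDeriv (n + 3) v := iteratedDeriv_succ.symm
  have hwp : Function.Periodic w 1 := by
    intro x
    have : v = fun y => v (y + 1) := funext fun y => (hvp y).symm
    conv_rhs => rw [hw, this]
    rw [iteratedDeriv_comp_add_const]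
  set e' := deriv (fun x => v x - meshQuasi n N v x) with he'
  have hv1 : IsPiecewiseC1 N v :=
    IsPiecewiseC1.of_contDiff (hv.of_le (by exact_mod_cast (show 1 ≤ n + 3 by omega))) hvp
  have he'mem : e' ∈ pcSpace N :=
    (hv1.sub (isPiecewiseC1_of_mem_splineSpace hN (meshQuasi_mem hN hvp))).deriv_mem
  -- The smooth weight `g v^(n+2)` in cell variables. Its derivative carries the factor `H`, the
  -- order gained by superconvergence.
  set γ : ℕ → ℝ → ℝ := fun i s => g ((i + s) / N) * w ((i + s) / N) with hγ
  set γ' : ℕ → ℝ → ℝ := fun i s => (deriv g ((i + s) / N) * w ((i + s) / N) +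
    g ((i + s) / N) * deriv w ((i + s) / N)) * H with hγ'
  have hcell : ∀ i : ℕ, Continuous fun s : ℝ => ((i : ℝ) + s) / N := fun i =>
    (continuous_const.add continuous_id).div_const _
  have hγd : ∀ i s, HasDerivAt (γ i) (γ' i s) s := by
    intro i s
    have h1 : HasDerivAt (fun s : ℝ => ((i : ℝ) + s) / N) H s := by
      simpa [hH] using ((hasDerivAt_id s).const_add (i : ℝ)).div_const (N : ℝ)
    have h2 := ((hg.differentiable one_ne_zero).differentiableAt
      (x := ((i : ℝ) + s) / N)).hasDerivAt
    have h3 := ((hw1.differentiable one_ne_zero).differentiableAt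
      (x := ((i : ℝ) + s) / N)).hasDerivAt
    exact HasDerivAt.comp s (h2.mul h3) h1
  have hγc : ∀ i, Continuous (γ' i) := fun i => by
    refine Continuous.mul (Continuous.add ?_ ?_) continuous_const
    · exact ((hg.continuous_deriv le_rfl).comp (hcell i)).mul (hw1.continuous.comp (hcell i))
    · exact (hg.continuous.comp (hcell i)).mul ((hw1.continuous_deriv le_rfl).comp (hcell i))
  have hM0 : 0 ≤ G₀ * K₃ + G₁ * K₂ := by positivity
  have hγb : ∀ i, ∀ s ∈ Icc (0 : ℝ) 1, |γ' i s| ≤ (G₀ * K₃ + G₁ * K₂) * H := by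
    intro i s _
    rw [hγ', abs_mul, abs_of_pos hH0]
    refine mul_le_mul_of_nonneg_right ((abs_add_le _ _).trans ?_) hH0.le
    rw [abs_mul, abs_mul, add_comm]
    refine add_le_add (mul_le_mul (hG₀ _) ?_ (abs_nonneg _) hG₀0)
      (mul_le_mul (hG₁ _) (hK₂ _) (abs_nonneg _) hG₁0)
    rw [hwd]; exact hK₃ _
  have hγs : ∀ i, γ i 1 = γ (i + 1) 0 := fun i => by simp [hγ]
  have hγN : γ N 0 = γ 0 0 := by
    have h1 := hgp 0
    have h2 := hwp 0
    rw [zero_add] at h1 h2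
    simp [hγ, hN'.ne', h1, h2]
  have hmain := h₂ N q γ γ' _ hq hγd hγc hγb hγs hγN
  -- Moving `v^(n+2)` from the knot to the running point costs a further factor `H`, so it joins the
  -- remainder and leaves a weight that is continuous across cells.
  have hcellbound : ∀ i < N, |(∫ s in (0 : ℝ)..1, g ((i + s) / N) * e' ((i + s) / N) * (q i).eval s) -
      H ^ (n + 1) * ∫ s in (0 : ℝ)..1, (derivative b).eval s * (γ i s * (q i).eval s)| ≤
      ((C₁ + B) * (G₀ * K₃) * H ^ (n + 2)) * ∫ s in (0 : ℝ)..1, |(q i).eval s| := by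
    intro i hi
    obtain ⟨E, hE, hEe⟩ := he'mem i hi
    have h1 : ∫ s in (0 : ℝ)..1, g ((i + s) / N) * e' ((i + s) / N) * (q i).eval s =
        ∫ s in (0 : ℝ)..1, g ((i + s) / N) * E s * (q i).eval s :=
      integral_congr_uIoo fun s hs => by
        rw [uIoo_of_le zero_le_one] at hs
        simp only [hEe s hs]
    have hγic : Continuous (γ i) :=
      (hg.continuous.comp (hcell i)).mul (hw1.continuous.comp (hcell i))
    rw [h1, ← intervalIntegral.integral_const_mul, ← intervalIntegral.integral_sub]
    · refine intervalIntegral_abs_le_mul_of_Ioo fun s hs => ?_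
      rw [← hEe s hs]
      have e1 := h₁ N v K₃ hN hv hK₃ i s hs
      have e2 : |w (i / N) - w ((i + s) / N)| ≤ K₃ * H := by
        refine (abs_sub_le_of_abs_deriv_le (hw1.differentiable one_ne_zero) (K := K₃)
          (fun x => by rw [hwd]; exact hK₃ x) _ _).trans ?_
        gcongr
        rw [hH, ← sub_div, abs_div, Nat.abs_cast]
        gcongr
        rw [abs_le]; constructor <;> linarith [hs.1, hs.2]
      have e3 : g ((i + s) / N) * e' ((i + s) / N) * (q i).eval s -
          H ^ (n + 1) * ((derivative b).eval s * (γ i s * (q i).eval s)) =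
          g ((i + s) / N) * ((e' ((i + s) / N) - H ^ (n + 1) * w (i / N) * (derivative b).eval s) +
          H ^ (n + 1) * (derivative b).eval s * (w (i / N) - w ((i + s) / N))) * (q i).eval s := by
        simp only [hγ]; ring
      rw [e3, abs_mul]
      refine mul_le_mul_of_nonneg_right ?_ (abs_nonneg _)
      rw [abs_mul]
      have e4 : |H ^ (n + 1) * (derivative b).eval s * (w (i / N) - w ((i + s) / N))| ≤
          H ^ (n + 1) * B * (K₃ * H) := by
        rw [abs_mul, abs_mul, abs_of_nonneg (pow_nonneg hH0.le _)]
        gcongr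
        exact hBb s (Ioo_subset_Icc_self hs)
      calc _ ≤ G₀ * (C₁ * K₃ * H ^ (n + 2) + H ^ (n + 1) * B * (K₃ * H)) :=
            mul_le_mul (hG₀ _) ((abs_add_le _ _).trans (add_le_add e1 e4)) (abs_nonneg _) hG₀0
        _ = _ := by ring
    · exact (((hg.continuous.comp (hcell i)).mul hE).mul (q i).continuous).intervalIntegrable _ _
    · exact (continuous_const.mul ((derivative b).continuous.mul
        (hγic.mul (q i).continuous))).intervalIntegrable _ _
  have hsum : |∑ i ∈ Finset.range N,
      ∫ s in (0 : ℝ)..1, g ((i + s) / N) * e' ((i + s) / N) * (q i).eval s| ≤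
      (C₁ + B + C₂) * (G₀ * K₃ + G₁ * K₂) * H ^ (n + 2) *
        ∑ i ∈ Finset.range N, ∫ s in (0 : ℝ)..1, |(q i).eval s| := by
    set Sq := ∑ i ∈ Finset.range N, ∫ s in (0 : ℝ)..1, |(q i).eval s| with hS
    have hS0 : 0 ≤ Sq := Finset.sum_nonneg fun i _ =>
      integral_nonneg zero_le_one fun _ _ => abs_nonneg _
    have e1 : |∑ i ∈ Finset.range N,
        ((∫ s in (0 : ℝ)..1, g ((i + s) / N) * e' ((i + s) / N) * (q i).eval s) -
        H ^ (n + 1) * ∫ s in (0 : ℝ)..1, (derivative b).eval s * (γ i s * (q i).eval s))| ≤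
        (C₁ + B) * (G₀ * K₃) * H ^ (n + 2) * Sq := by
      rw [hS, Finset.mul_sum]
      exact (Finset.abs_sum_le_sum_abs _ _).trans
        (Finset.sum_le_sum fun i hi => hcellbound i (Finset.mem_range.1 hi))
    rw [Finset.sum_sub_distrib, ← Finset.mul_sum] at e1
    have e2 : |H ^ (n + 1) * ∑ i ∈ Finset.range N,
        ∫ s in (0 : ℝ)..1, (derivative b).eval s * (γ i s * (q i).eval s)| ≤
        H ^ (n + 1) * (C₂ * ((G₀ * K₃ + G₁ * K₂) * H) * Sq) := by
      rw [abs_mul, abs_of_nonneg (pow_nonneg hH0.le _)]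
      gcongr
    have e3 := (abs_add_le _ _).trans (add_le_add e1 e2)
    rw [sub_add_cancel] at e3
    refine e3.trans ?_
    have e4 : (C₁ + B) * (G₀ * K₃) * H ^ (n + 2) * Sq ≤
        (C₁ + B) * (G₀ * K₃ + G₁ * K₂) * H ^ (n + 2) * Sq := by
      gcongr
      have := mul_nonneg hG₁0 hK₂0
      linarith
    refine (add_le_add_left e4 _).trans (le_of_eq ?_)
    ring
  have hl2 : l2Inner (fun x => g x * e' x) f = H * (c * ∑ i ∈ Finset.range N,
      ∫ s in (0 : ℝ)..1, g ((i + s) / N) * e' ((i + s) / N) * (q i).eval s) := by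
    rw [l2Inner, integral_eq_sum_cells hN
      (mul_mem_pcSpace (mul_mem_pcSpace (continuous_mem_pcSpace hg.continuous) he'mem) hf)]
    congr 1
    rw [Finset.mul_sum]
    refine Finset.sum_congr rfl fun i hi => ?_
    rw [← intervalIntegral.integral_const_mul]
    refine integral_congr_uIoo fun s hs => ?_
    rw [uIoo_of_le zero_le_one] at hs
    simp only [hfq i (Finset.mem_range.1 hi) s hs]
    ring
  have hqf := sum_cells_abs_le hN hf hfq hc
  rw [hl2, abs_mul, abs_mul, abs_of_pos hH0, abs_of_nonneg hc]
  calc _ ≤ H * (c * ((C₁ + B + C₂) * (G₀ * K₃ + G₁ * K₂) * H ^ (n + 2) *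
        ∑ i ∈ Finset.range N, ∫ s in (0 : ℝ)..1, |(q i).eval s|)) := by gcongr
    _ = (C₁ + B + C₂) * (G₀ * K₃ + G₁ * K₂) * H ^ (n + 2) * (H *
        (c * ∑ i ∈ Finset.range N, ∫ s in (0 : ℝ)..1, |(q i).eval s|)) := by ring
    _ ≤ (C₁ + B + C₂) * (G₀ * K₃ + G₁ * K₂) * H ^ (n + 2) * (H * (N * l2Norm f)) := by gcongr
    _ = _ := by
      rw [hH]; field_simp

end MeshQuasi

end

section

open MeasureTheory intervalIntegral

/-! ### The mass, energy and flux forms and the passage to the abstract system. -/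

section Forms

variable {n N : ℕ}

theorem spline_mem_pcSpace (hN : 0 < N) (φ : splineSpace (n + 2) N) : φ.1 ∈ pcSpace N :=
  (isPiecewiseC1_of_mem_splineSpace hN φ.2).mem

theorem deriv_spline_mem_pcSpace (hN : 0 < N) (φ : splineSpace (n + 2) N) :
    deriv φ.1 ∈ pcSpace N :=
  (isPiecewiseC1_of_mem_splineSpace hN φ.2).deriv_mem

theorem deriv_spline_add (hN : 0 < N) (φ ψ : splineSpace (n + 2) N) :
    ∀ i : ℕ, i < N → ∀ s ∈ Ioo (0 : ℝ) 1, deriv (φ.1 + ψ.1) ((i + s) / N) =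
      deriv φ.1 ((i + s) / N) + deriv ψ.1 ((i + s) / N) := fun i hi s hs =>
  deriv_add ((isPiecewiseC1_of_mem_splineSpace hN φ.2).differentiableAt i hi s hs)
    ((isPiecewiseC1_of_mem_splineSpace hN ψ.2).differentiableAt i hi s hs)

theorem deriv_spline_smul (c : ℝ) (φ : splineSpace (n + 2) N) (x : ℝ) :
    deriv (c • φ.1) x = c * deriv φ.1 x := by
  change deriv (fun x => c * φ.1 x) x = _
  exact deriv_const_mul_field c

/-- The `L²` inner product on the spline space. -/
def massForm (n : ℕ) (hN : 0 < N) :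
    splineSpace (n + 2) N →ₗ[ℝ] splineSpace (n + 2) N →ₗ[ℝ] ℝ :=
  LinearMap.mk₂ ℝ (fun φ ψ => l2Inner φ ψ)
    (fun φ φ' ψ => l2Inner_add_left hN (spline_mem_pcSpace hN φ) (spline_mem_pcSpace hN φ')
      (spline_mem_pcSpace hN ψ))
    (fun c φ ψ => l2Inner_const_mul_left c φ ψ)
    (fun φ ψ ψ' => l2Inner_add_right hN (spline_mem_pcSpace hN ψ) (spline_mem_pcSpace hN ψ')
      (spline_mem_pcSpace hN φ))
    (fun c φ ψ => l2Inner_const_mul_right c ψ φ)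

theorem l2Inner_deriv_add_right (hN : 0 < N) {f : ℝ → ℝ} (hf : f ∈ pcSpace N)
    (φ ψ : splineSpace (n + 2) N) : l2Inner f (deriv (φ + ψ).1) =
      l2Inner f (deriv φ.1) + l2Inner f (deriv ψ.1) := by
  rw [Submodule.coe_add, l2Inner_congr hN (g' := fun x => deriv φ.1 x + deriv ψ.1 x) (fun _ _ _ _ => rfl)
    (deriv_spline_add hN φ ψ)]
  exact l2Inner_add_right hN (deriv_spline_mem_pcSpace hN φ) (deriv_spline_mem_pcSpace hN ψ) hf

theorem l2Inner_deriv_smul_right (f : ℝ → ℝ) (c : ℝ) (φ : splineSpace (n + 2) N) :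
    l2Inner f (deriv (c • φ).1) = c * l2Inner f (deriv φ.1) := by
  rw [show deriv (c • φ).1 = _ from funext (deriv_spline_smul c φ), l2Inner_const_mul_right]

/-- The `L²` inner product of the derivatives on the spline space. -/
def stiffnessForm (n : ℕ) (hN : 0 < N) :
    splineSpace (n + 2) N →ₗ[ℝ] splineSpace (n + 2) N →ₗ[ℝ] ℝ :=
  LinearMap.mk₂ ℝ (fun φ ψ => l2Inner (deriv φ.1) (deriv ψ.1))
    (fun φ φ' ψ => by
      rw [l2Inner_comm, l2Inner_deriv_add_right hN (deriv_spline_mem_pcSpace hN ψ),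
        l2Inner_comm, l2Inner_comm (deriv ψ.1)])
    (fun c φ ψ => by rw [l2Inner_comm, l2Inner_deriv_smul_right, l2Inner_comm, smul_eq_mul])
    (fun φ ψ ψ' => l2Inner_deriv_add_right hN (deriv_spline_mem_pcSpace hN φ) ψ ψ')
    (fun c φ ψ => l2Inner_deriv_smul_right _ c ψ)

/-- The `H¹` inner product on the spline space. -/
def energyForm (n : ℕ) (hN : 0 < N) :
    splineSpace (n + 2) N →ₗ[ℝ] splineSpace (n + 2) N →ₗ[ℝ] ℝ :=
  massForm n hN + stiffnessForm n hN

/-- The nonlinearity `m_x u + 2 m u_x` of the Camassa-Holm system. -/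
def flux (m u : ℝ → ℝ) : ℝ → ℝ := fun x => deriv m x * u x + 2 * (m x * deriv u x)

theorem flux_mem_pcSpace (hN : 0 < N) (m u : splineSpace (n + 2) N) :
    flux m u ∈ pcSpace N :=
  add_mem_pcSpace (mul_mem_pcSpace (deriv_spline_mem_pcSpace hN m) (spline_mem_pcSpace hN u))
    (const_mul_mem_pcSpace _
      (mul_mem_pcSpace (spline_mem_pcSpace hN m) (deriv_spline_mem_pcSpace hN u)))

/-- The trilinear form of the nonlinearity on the spline space. -/
def fluxForm (n : ℕ) (hN : 0 < N) : splineSpace (n + 2) N →ₗ[ℝ] splineSpace (n + 2) N →ₗ[ℝ]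
    splineSpace (n + 2) N →ₗ[ℝ] ℝ :=
  LinearMap.mk₂ ℝ (fun m u =>
    { toFun := fun φ => l2Inner (flux m u) φ
      map_add' := fun φ ψ => l2Inner_add_right hN (spline_mem_pcSpace hN φ)
        (spline_mem_pcSpace hN ψ) (flux_mem_pcSpace hN m u)
      map_smul' := fun c φ => l2Inner_const_mul_right c φ _ })
    (fun m m' u => LinearMap.ext fun φ => by
      refine Eq.trans ?_ (l2Inner_add_left hN (flux_mem_pcSpace hN m u) (flux_mem_pcSpace hN m' u)
        (spline_mem_pcSpace hN φ))
      refine l2Inner_congr hN (fun i hi s hs => ?_) fun _ _ _ _ => rfl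
      simp only [flux, Submodule.coe_add, deriv_spline_add hN m m' i hi s hs, Pi.add_apply]
      ring)
    (fun c m u => LinearMap.ext fun φ => by
      refine Eq.trans ?_ (l2Inner_const_mul_left c (flux m u) φ)
      refine l2Inner_congr hN (fun i hi s hs => ?_) fun _ _ _ _ => rfl
      simp only [flux, Submodule.coe_smul, deriv_spline_smul, Pi.smul_apply, smul_eq_mul]
      ring)
    (fun m u u' => LinearMap.ext fun φ => by
      refine Eq.trans ?_ (l2Inner_add_left hN (flux_mem_pcSpace hN m u) (flux_mem_pcSpace hN m u')
        (spline_mem_pcSpace hN φ))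
      refine l2Inner_congr hN (fun i hi s hs => ?_) fun _ _ _ _ => rfl
      simp only [flux, Submodule.coe_add, deriv_spline_add hN u u' i hi s hs, Pi.add_apply]
      ring)
    (fun c m u => LinearMap.ext fun φ => by
      refine Eq.trans ?_ (l2Inner_const_mul_left c (flux m u) φ)
      refine l2Inner_congr hN (fun i hi s hs => ?_) fun _ _ _ _ => rfl
      simp only [flux, Submodule.coe_smul, deriv_spline_smul, Pi.smul_apply, smul_eq_mul]
      ring)

theorem massForm_apply (hN : 0 < N) (φ ψ : splineSpace (n + 2) N) :
    massForm n hN φ ψ = l2Inner φ ψ := rfl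

theorem energyForm_apply (hN : 0 < N) (φ ψ : splineSpace (n + 2) N) :
    energyForm n hN φ ψ = l2Inner φ ψ + l2Inner (deriv φ.1) (deriv ψ.1) := rfl

theorem fluxForm_apply (hN : 0 < N) (m u φ : splineSpace (n + 2) N) :
    fluxForm n hN m u φ = l2Inner (flux m u) φ := rfl

theorem massForm_symm (hN : 0 < N) (φ ψ : splineSpace (n + 2) N) :
    massForm n hN φ ψ = massForm n hN ψ φ := l2Inner_comm _ _

theorem energyForm_symm (hN : 0 < N) (φ ψ : splineSpace (n + 2) N) :
    energyForm n hN φ ψ = energyForm n hN ψ φ := by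
  rw [energyForm_apply, energyForm_apply, l2Inner_comm, l2Inner_comm (deriv φ.1)]

theorem massForm_nonneg (hN : 0 < N) (φ : splineSpace (n + 2) N) : 0 ≤ massForm n hN φ φ :=
  l2Inner_self_nonneg _

theorem massForm_le_energyForm (hN : 0 < N) (φ : splineSpace (n + 2) N) :
    massForm n hN φ φ ≤ energyForm n hN φ φ :=
  le_add_of_nonneg_right (l2Inner_self_nonneg _)

theorem massForm_pos (hN : 0 < N) (φ : splineSpace (n + 2) N) (hφ : φ ≠ 0) :
    0 < massForm n hN φ φ :=
  lt_of_le_of_ne (massForm_nonneg hN φ) fun h =>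
    hφ (Subtype.ext (eq_zero_of_l2Inner_self φ.2 h.symm))

theorem energyForm_pos (hN : 0 < N) (φ : splineSpace (n + 2) N) (hφ : φ ≠ 0) :
    0 < energyForm n hN φ φ :=
  (massForm_pos hN φ hφ).trans_le (massForm_le_energyForm hN φ)

/-- `(θ_x u + 2 θ u_x, θ) = (3/2) (u_x θ, θ)`. -/
theorem fluxForm_self (hN : 0 < N) (θ u : splineSpace (n + 2) N) :
    fluxForm n hN θ u θ = 3 / 2 * l2Inner (fun x => deriv u.1 x * θ.1 x) θ := by
  have hθ := isPiecewiseC1_of_mem_splineSpace hN θ.2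
  have hu := isPiecewiseC1_of_mem_splineSpace hN u.2
  -- Integration by parts of `(θ²)_x` against `u` trades `θ_x` for `u_x`.
  have h := ((hθ.mul hθ)).l2Inner_deriv hN hu
  rw [l2Inner_congr hN (f' := fun x => 2 * (deriv θ.1 x * θ.1 x)) (fun i hi s hs => by
    rw [deriv_fun_mul (hθ.differentiableAt i hi s hs) (hθ.differentiableAt i hi s hs)]
    ring) fun _ _ _ _ => rfl, l2Inner_const_mul_left] at h
  have e1 : l2Inner (fun x => deriv θ.1 x * θ.1 x) u.1 = l2Inner (fun x => deriv θ.1 x * u.1 x) θ.1 := by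
    simp only [l2Inner]; congr 1; ext x; ring
  have e2 : l2Inner (fun x => θ.1 x * θ.1 x) (deriv u.1) =
      l2Inner (fun x => deriv u.1 x * θ.1 x) θ.1 := by
    simp only [l2Inner]; congr 1; ext x; ring
  have e3 : l2Inner (fun x => θ.1 x * deriv u.1 x) θ.1 =
      l2Inner (fun x => deriv u.1 x * θ.1 x) θ.1 := by
    simp only [l2Inner]; congr 1; ext x; ring
  rw [e1, e2] at h
  rw [fluxForm_apply, show flux θ.1 u.1 = fun x => deriv θ.1 x * u.1 x + 2 * (θ.1 x * deriv u.1 x) from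
    rfl, l2Inner_add_left hN (mul_mem_pcSpace hθ.deriv_mem hu.mem)
    (const_mul_mem_pcSpace _ (mul_mem_pcSpace hθ.mem hu.deriv_mem)) hθ.mem,
    l2Inner_const_mul_left, e3]
  linarith

/-- `(m_x u + 2 m u_x, u) = 0`. -/
theorem fluxForm_eq_zero (hN : 0 < N) (m u : splineSpace (n + 2) N) :
    fluxForm n hN m u u = 0 := by
  have hm := isPiecewiseC1_of_mem_splineSpace hN m.2
  have hu := isPiecewiseC1_of_mem_splineSpace hN u.2
  -- The integrand is the exact derivative `(m u²)_x`.
  have h := (hm.mul (hu.mul hu)).integral_deriv hN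
  rw [integral_congr_cells hN (g := fun x => flux m u x * u.1 x) fun i hi s hs => ?_] at h
  · exact h
  · rw [deriv_fun_mul (hm.differentiableAt i hi s hs) ((hu.mul hu).differentiableAt i hi s hs),
      deriv_fun_mul (hu.differentiableAt i hi s hs) (hu.differentiableAt i hi s hs), flux]
    ring

theorem fluxForm_eq (hN : 0 < N) (m u φ : splineSpace (n + 2) N) :
    fluxForm n hN m u φ = l2Inner (deriv fun x => m.1 x * u.1 x) φ +
      l2Inner (fun x => m.1 x * deriv u.1 x) φ := by
  have hm := isPiecewiseC1_of_mem_splineSpace hN m.2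
  have hu := isPiecewiseC1_of_mem_splineSpace hN u.2
  rw [← l2Inner_add_left hN (hm.mul hu).deriv_mem (mul_mem_pcSpace hm.mem hu.deriv_mem)
    (spline_mem_pcSpace hN φ), fluxForm_apply]
  refine l2Inner_congr hN (fun i hi s hs => ?_) fun _ _ _ _ => rfl
  rw [deriv_fun_mul (hm.differentiableAt i hi s hs) (hu.differentiableAt i hi s hs), flux]
  ring

/-- The functional `φ ↦ (u₀, φ) + (u₀', φ')`. -/
def initialForm (n : ℕ) (hN : 0 < N) {u₀ : ℝ → ℝ} (hu₀ : ContDiff ℝ 1 u₀) :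
    splineSpace (n + 2) N →ₗ[ℝ] ℝ where
  toFun φ := l2Inner u₀ φ + l2Inner (deriv u₀) (deriv φ.1)
  map_add' φ ψ := by
    rw [l2Inner_deriv_add_right hN (continuous_mem_pcSpace (hu₀.continuous_deriv le_rfl))]
    have := l2Inner_add_right hN (spline_mem_pcSpace hN φ) (spline_mem_pcSpace hN ψ)
      (continuous_mem_pcSpace hu₀.continuous)
    rw [show ((φ + ψ : splineSpace (n + 2) N) : ℝ → ℝ) = fun x => φ.1 x + ψ.1 x from rfl, this]
    ring
  map_smul' c φ := by
    rw [l2Inner_deriv_smul_right]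
    have := l2Inner_const_mul_right c φ.1 u₀
    rw [show ((c • φ : splineSpace (n + 2) N) : ℝ → ℝ) = fun x => c * φ.1 x from rfl, this]
    simp [mul_add]

/-- Evaluation at a point. -/
def evalForm (n N : ℕ) (x : ℝ) : splineSpace (n + 2) N →ₗ[ℝ] ℝ where
  toFun φ := φ.1 x
  map_add' _ _ := rfl
  map_smul' _ _ := rfl

/-- A spline is recovered linearly from finitely many of its values, so differentiability at each
point yields a derivative of the curve in the spline space. -/
theorem hasWeakDerivWithinAt_of_eval (hN : 0 < N) {T : ℝ} {m : ℝ → splineSpace (n + 2) N}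
    (hm : ∀ x, DifferentiableOn ℝ (fun s => (m s).1 x) (Icc 0 T)) :
    ∃ m' : ℝ → splineSpace (n + 2) N, ∀ t ∈ Icc 0 T,
      HasWeakDerivWithinAt m (m' t) (Icc 0 T) t := by
  obtain ⟨e, he, z, hz⟩ := exists_injective_eval (n := n) hN
  obtain ⟨L, hL⟩ := LinearMap.exists_leftInverse_of_injective e (LinearMap.ker_eq_bot.2 he)
  have hL' : ∀ φ, L (e φ) = φ := fun φ => DFunLike.congr_fun hL φ
  refine ⟨fun t => L fun j => derivWithin (fun s => (m s).1 (z j)) (Icc 0 T) t, fun t ht l => ?_⟩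
  have h1 : ∀ y, l (L y) = ∑ j, y j • (l ∘ₗ L) (Pi.single j 1) := fun y => by
    have := LinearMap.pi_apply_eq_sum_univ (l ∘ₗ L) y
    simp only [LinearMap.comp_apply] at this ⊢
    rw [this]
    refine Finset.sum_congr rfl fun j _ => ?_
    congr 3
    ext k
    simp [Pi.single_apply, eq_comm]
  have h2 : (fun τ => l (m τ)) = fun τ => ∑ j, (m τ).1 (z j) • (l ∘ₗ L) (Pi.single j 1) := by
    ext τ
    conv_lhs => rw [← hL' (m τ), h1]
    simp only [hz]
  rw [h2, h1]
  exact HasDerivWithinAt.fun_sum fun j _ =>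
    ((hm (z j) t ht).hasDerivWithinAt).smul_const _

theorem IsGalerkin.isModifiedGalerkin (hN : 0 < N) {T : ℝ} (hT : 0 < T) {u₀ : ℝ → ℝ}
    (hu₀ : ContDiff ℝ 1 u₀) {m u m' : ℝ → splineSpace (n + 2) N}
    (h : IsGalerkin (massForm n hN) (energyForm n hN) (fluxForm n hN) (initialForm n hN hu₀) T
      m u m') :
    IsModifiedGalerkin (n + 2) N T u₀ (fun t => (m t).1) (fun t => (u t).1) where
  mem_m t _ := (m t).2
  mem_u t _ := (u t).2
  differentiable_m x t ht := (h.deriv t ht (evalForm n N x)).differentiableWithinAt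
  m_eq t ht φ hφ := h.eq t ht ⟨φ, hφ⟩
  evolution t ht φ hφ := by
    have h1 := h.evolution t ht ⟨φ, hφ⟩
    rw [fluxForm_eq] at h1
    have h2 : (fun x => derivWithin (fun s => (m s).1 x) (Icc 0 T) t) = (m' t).1 := by
      ext x
      exact (h.deriv t ht (evalForm n N x)).derivWithin (uniqueDiffOn_Icc hT t ht)
    rw [h2, add_assoc]
    exact h1
  initial φ hφ := h.initial ⟨φ, hφ⟩

theorem IsModifiedGalerkin.exists_isGalerkin (hN : 0 < N) {T : ℝ} (hT : 0 < T) {u₀ : ℝ → ℝ}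
    (hu₀ : ContDiff ℝ 1 u₀) {mh uh : ℝ → ℝ → ℝ}
    (h : IsModifiedGalerkin (n + 2) N T u₀ mh uh) :
    ∃ m u m' : ℝ → splineSpace (n + 2) N,
      IsGalerkin (massForm n hN) (energyForm n hN) (fluxForm n hN) (initialForm n hN hu₀) T
        m u m' ∧ ∀ t ∈ Icc 0 T, (m t).1 = mh t ∧ (u t).1 = uh t := by
  classical
  -- The spline condition is imposed only on `[0, T]`; the curves are set to zero elsewhere so that
  -- they take values in the space for all times.
  let m : ℝ → splineSpace (n + 2) N := fun t =>
    if ht : t ∈ Icc 0 T then ⟨mh t, h.mem_m t ht⟩ else 0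
  let u : ℝ → splineSpace (n + 2) N := fun t =>
    if ht : t ∈ Icc 0 T then ⟨uh t, h.mem_u t ht⟩ else 0
  have hm : ∀ t ∈ Icc 0 T, (m t).1 = mh t := fun t ht => by simp only [m, dif_pos ht]
  have hu : ∀ t ∈ Icc 0 T, (u t).1 = uh t := fun t ht => by simp only [u, dif_pos ht]
  obtain ⟨m', hm'⟩ := hasWeakDerivWithinAt_of_eval hN (m := m) (T := T) fun x =>
    (h.differentiable_m x).congr fun s hs => by rw [hm s hs]
  refine ⟨m, u, m', ⟨hm', fun t ht φ => ?_, fun t ht φ => ?_, fun φ => ?_⟩,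
    fun t ht => ⟨hm t ht, hu t ht⟩⟩
  · rw [massForm_apply, energyForm_apply, hm t ht, hu t ht]
    exact h.m_eq t ht φ.1 φ.2
  · have h1 := h.evolution t ht φ.1 φ.2
    have h2 : (fun x => derivWithin (fun s => mh s x) (Icc 0 T) t) = (m' t).1 := by
      ext x
      have := (hm' t ht (evalForm n N x)).congr (f₁ := fun s => mh s x)
        (fun s hs => by rw [← hm s hs]; rfl) (by rw [← hm t ht]; rfl)
      exact this.derivWithin (uniqueDiffOn_Icc hT t ht)
    rw [h2, add_assoc] at h1
    rw [fluxForm_eq, hm t ht, hu t ht]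
    exact h1
  · rw [massForm_apply, hm 0 ⟨le_rfl, hT.le⟩]
    exact h.initial φ.1 φ.2

end Forms

end

/-! ### Regularity and uniform bounds on the space-time strip. -/

section Strip

variable {T : ℝ} {f : ℝ → ℝ → ℝ} {k : ℕ}

theorem uniqueDiffOn_strip (hT : 0 < T) : UniqueDiffOn ℝ ((univ : Set ℝ) ×ˢ Icc 0 T) :=
  uniqueDiffOn_univ.prod (uniqueDiffOn_Icc hT)

theorem contDiff_slice (hf : ContDiffOn ℝ k (fun z : ℝ × ℝ => f z.2 z.1) (univ ×ˢ Icc 0 T))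
    {t : ℝ} (ht : t ∈ Icc 0 T) : ContDiff ℝ k (f t) := by
  have h : ContDiff ℝ k fun x : ℝ => ((x, t) : ℝ × ℝ) := contDiff_id.prodMk contDiff_const
  exact contDiffOn_univ.1 (hf.comp h.contDiffOn fun x _ => ⟨mem_univ _, ht⟩)

/-- The partial derivative is the derivative within the strip in the direction `(1, 0)`; unique
differentiability of the strip, which uses `0 < T`, transfers the regularity. -/
theorem contDiffOn_deriv_space (hT : 0 < T)
    (hf : ContDiffOn ℝ (k + 1 : ℕ) (fun z : ℝ × ℝ => f z.2 z.1) (univ ×ˢ Icc 0 T)) :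
    ContDiffOn ℝ k (fun z : ℝ × ℝ => deriv (f z.2) z.1) (univ ×ˢ Icc 0 T) := by
  have h1 := (hf.fderivWithin (uniqueDiffOn_strip hT) (m := k) (by push_cast; exact le_rfl)).clm_apply
    (contDiffOn_const (c := ((1, 0) : ℝ × ℝ)))
  refine h1.congr fun z hz => ?_
  have h2 := (hf.differentiableOn (by simp) z hz).hasFDerivWithinAt
  have h3 : HasDerivWithinAt (fun x : ℝ => ((x, z.2) : ℝ × ℝ)) (1, 0) univ z.1 :=
    ((hasDerivAt_id z.1).prodMk (hasDerivAt_const z.1 z.2)).hasDerivWithinAt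
  have hmaps : MapsTo (fun x : ℝ => ((x, z.2) : ℝ × ℝ)) univ ((univ : Set ℝ) ×ˢ Icc 0 T) :=
    fun x _ => ⟨mem_univ _, hz.2⟩
  have h4 := h2.comp_hasDerivWithinAt z.1 h3 hmaps
  exact (hasDerivWithinAt_univ.1 h4).deriv

theorem hasDerivWithinAt_time
    (hf : ContDiffOn ℝ (k + 1 : ℕ) (fun z : ℝ × ℝ => f z.2 z.1) (univ ×ˢ Icc 0 T))
    {z : ℝ × ℝ} (hz : z ∈ (univ : Set ℝ) ×ˢ Icc 0 T) :
    HasDerivWithinAt (fun τ => f τ z.1)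
      (fderivWithin ℝ (fun z : ℝ × ℝ => f z.2 z.1) (univ ×ˢ Icc 0 T) z (0, 1)) (Icc 0 T) z.2 := by
  have h2 := (hf.differentiableOn (by simp) z hz).hasFDerivWithinAt
  have h3 : HasDerivWithinAt (fun τ : ℝ => ((z.1, τ) : ℝ × ℝ)) (0, 1) (Icc 0 T) z.2 :=
    ((hasDerivAt_const z.2 z.1).prodMk (hasDerivAt_id z.2)).hasDerivWithinAt
  have hmaps : MapsTo (fun τ : ℝ => ((z.1, τ) : ℝ × ℝ)) (Icc 0 T) ((univ : Set ℝ) ×ˢ Icc 0 T) :=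
    fun x hx => ⟨mem_univ _, hx⟩
  exact h2.comp_hasDerivWithinAt z.2 h3 hmaps

theorem contDiffOn_deriv_time (hT : 0 < T)
    (hf : ContDiffOn ℝ (k + 1 : ℕ) (fun z : ℝ × ℝ => f z.2 z.1) (univ ×ˢ Icc 0 T)) :
    ContDiffOn ℝ k (fun z : ℝ × ℝ => derivWithin (fun τ => f τ z.1) (Icc 0 T) z.2)
      (univ ×ˢ Icc 0 T) := by
  have h1 := (hf.fderivWithin (uniqueDiffOn_strip hT) (m := k) (by push_cast; exact le_rfl)).clm_apply
    (contDiffOn_const (c := ((0, 1) : ℝ × ℝ)))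
  exact h1.congr fun z hz =>
    (hasDerivWithinAt_time hf hz).derivWithin (uniqueDiffOn_Icc hT _ hz.2)

theorem contDiffOn_iteratedDeriv_space (hT : 0 < T) (j : ℕ)
    (hf : ContDiffOn ℝ (k + j : ℕ) (fun z : ℝ × ℝ => f z.2 z.1) (univ ×ˢ Icc 0 T)) :
    ContDiffOn ℝ k (fun z : ℝ × ℝ => iteratedDeriv j (f z.2) z.1) (univ ×ˢ Icc 0 T) := by
  induction j generalizing k with
  | zero => simpa using hf
  | succ j ih =>
    simp only [iteratedDeriv_succ]
    refine contDiffOn_deriv_space (f := fun t => iteratedDeriv j (f t)) hT (ih (k := k + 1) ?_)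
    rwa [show k + 1 + j = k + (j + 1) by ring]

theorem periodic_iteratedDeriv {v : ℝ → ℝ} (hv : Function.Periodic v 1) (j : ℕ) :
    Function.Periodic (iteratedDeriv j v) 1 := fun x => by
  conv_rhs => rw [show v = fun y => v (y + 1) from funext fun y => (hv y).symm]
  rw [iteratedDeriv_comp_add_const]

/-- Periodicity reduces the supremum to the compact rectangle `[0, 1] × [0, T]`. -/
theorem exists_bound_strip (hf : ContinuousOn (fun z : ℝ × ℝ => f z.2 z.1) (univ ×ˢ Icc 0 T))
    (hp : ∀ t ∈ Icc 0 T, Function.Periodic (f t) 1) :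
    ∃ K, 0 ≤ K ∧ ∀ t ∈ Icc 0 T, ∀ x, |f t x| ≤ K := by
  obtain ⟨K, hK⟩ := (isCompact_Icc.prod isCompact_Icc).exists_bound_of_continuousOn
    (hf.mono (prod_mono_left (subset_univ (Icc (0 : ℝ) 1))))
  refine ⟨max K 0, le_max_right _ _, fun t ht x => ?_⟩
  have h1 : f t x = f t (Int.fract x) := by
    have := (hp t ht).sub_zsmul_eq (x := x) ⌊x⌋
    rw [zsmul_eq_mul, mul_one] at this
    exact this.symm
  rw [h1]
  exact (hK (Int.fract x, t) ⟨⟨Int.fract_nonneg x, (Int.fract_lt_one x).le⟩, ht⟩).trans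
    (le_max_left _ _)

/-- Smooth 1-periodic functions with a common bound on their derivatives. -/
structure IsSmoothBounded (k : ℕ) (K : ℝ) (v : ℝ → ℝ) : Prop where
  contDiff : ContDiff ℝ k v
  periodic : Function.Periodic v 1
  bound : ∀ j ≤ k, ∀ x, |iteratedDeriv j v x| ≤ K

theorem IsSmoothBounded.mono {K K' : ℝ} {v : ℝ → ℝ} (h : IsSmoothBounded k K v) (hK : K ≤ K') :
    IsSmoothBounded k K' v :=
  ⟨h.contDiff, h.periodic, fun j hj x => (h.bound j hj x).trans hK⟩

theorem exists_isSmoothBounded (hT : 0 < T)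
    (hf : ContDiffOn ℝ k (fun z : ℝ × ℝ => f z.2 z.1) (univ ×ˢ Icc 0 T))
    (hp : ∀ t ∈ Icc 0 T, Function.Periodic (f t) 1) :
    ∃ K, 0 ≤ K ∧ ∀ t ∈ Icc 0 T, IsSmoothBounded k K (f t) := by
  have h : ∀ j : ℕ, ∃ K, 0 ≤ K ∧ (j ≤ k → ∀ t ∈ Icc 0 T, ∀ x, |iteratedDeriv j (f t) x| ≤ K) := by
    intro j
    by_cases hj : j ≤ k
    · have h1 := contDiffOn_iteratedDeriv_space (k := k - j) hT j (by rwa [Nat.sub_add_cancel hj])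
      obtain ⟨K, hK0, hK⟩ := exists_bound_strip (f := fun t x => iteratedDeriv j (f t) x)
        h1.continuousOn fun t ht => periodic_iteratedDeriv (hp t ht) j
      exact ⟨K, hK0, fun _ => hK⟩
    · exact ⟨0, le_rfl, fun h => absurd h hj⟩
  choose K hK0 hK using h
  refine ⟨∑ j ∈ Finset.range (k + 1), K j, Finset.sum_nonneg fun j _ => hK0 j, fun t ht =>
    ⟨contDiff_slice hf ht, hp t ht, fun j hj x => (hK j hj t ht x).trans ?_⟩⟩
  exact Finset.single_le_sum (fun j _ => hK0 j) (Finset.mem_range.2 (by omega))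

end Strip

/-! ### Consistency of the quasi-interpolants and bounds on the flux form. -/

section Consistency

open Polynomial

/-- Stability and accuracy of the quasi-interpolant. -/
theorem exists_meshQuasi_bounds (n : ℕ) : ∃ C, 0 ≤ C ∧ ∀ (N : ℕ) (v : ℝ → ℝ) (K : ℝ), 0 < N →
    IsSmoothBounded (n + 3) K v →
    (∀ x, |v x - meshQuasi n N v x| ≤ C * K * (1 / (N : ℝ)) ^ (n + 2)) ∧
    (∀ x, |meshQuasi n N v x| ≤ C * K) ∧
    ∀ i : ℕ, i < N → ∀ s ∈ Ioo (0 : ℝ) 1, |deriv (meshQuasi n N v) ((i + s) / N)| ≤ C * K := by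
  obtain ⟨C₁, hC₁, h₁⟩ := exists_abs_sub_meshQuasi_le n
  obtain ⟨C₂, b, hC₂, -, h₂⟩ := exists_deriv_sub_meshQuasi n
  obtain ⟨B, hB, hBb⟩ := exists_bound_eval (derivative b)
  refine ⟨C₁ + C₂ + B + 1, by positivity, fun N v K hN hv => ?_⟩
  have hN1 : (1 : ℝ) ≤ N := by exact_mod_cast hN
  have hK : 0 ≤ K := (abs_nonneg _).trans (hv.bound 0 (by omega) 0)
  set H : ℝ := 1 / (N : ℝ) with hH
  have hH0 : 0 ≤ H := by positivity
  have hH1 : H ≤ 1 := by rw [hH, div_le_one (by linarith)]; exact hN1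
  have hpow : ∀ j, H ^ j ≤ 1 := fun j => pow_le_one₀ hH0 hH1
  have a1 : ∀ x, |v x - meshQuasi n N v x| ≤ C₁ * K * H ^ (n + 2) :=
    h₁ N v K hN (hv.contDiff.of_le (by exact_mod_cast Nat.le_succ _)) (hv.bound (n + 2) (by omega))
  refine ⟨fun x => (a1 x).trans ?_, fun x => ?_, fun i hi s hs => ?_⟩
  · gcongr; linarith
  · have e1 : |meshQuasi n N v x| ≤ |v x| + |v x - meshQuasi n N v x| := by
      have := abs_sub (v x) (v x - meshQuasi n N v x)
      rwa [sub_sub_cancel] at this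
    have e2 : |v x| ≤ K := by simpa using hv.bound 0 (by omega) x
    have e3 : C₁ * K * H ^ (n + 2) ≤ C₁ * K := mul_le_of_le_one_right (by positivity) (hpow _)
    have e4 : 0 ≤ C₂ * K := by positivity
    have e5 : 0 ≤ B * K := by positivity
    linarith [a1 x]
  · have hvd : DifferentiableAt ℝ v ((i + s) / N) :=
      (hv.contDiff.differentiable (by simp)).differentiableAt
    have hQd := (isPiecewiseC1_of_mem_splineSpace hN
      (meshQuasi_mem (n := n) hN hv.periodic)).differentiableAt i hi s hs
    have e1 := h₂ N v K hN hv.contDiff (hv.bound (n + 3) le_rfl) i s hs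
    rw [deriv_fun_sub hvd hQd] at e1
    have e2 : |deriv v ((i + s) / N)| ≤ K := by
      have := hv.bound 1 (by omega) ((i + s) / N)
      rwa [iteratedDeriv_one] at this
    have e3 : |H ^ (n + 1) * iteratedDeriv (n + 2) v (i / N) * (derivative b).eval s| ≤
        1 * K * B := by
      rw [abs_mul, abs_mul, abs_of_nonneg (pow_nonneg hH0 _)]
      gcongr
      · exact hpow _
      · exact hv.bound (n + 2) (by omega) _
      · exact hBb s (Ioo_subset_Icc_self hs)
    have e4 : C₂ * K * H ^ (n + 2) ≤ C₂ * K := mul_le_of_le_one_right (by positivity) (hpow _)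
    have e5 : 0 ≤ C₁ * K := by positivity
    rw [abs_le] at *
    constructor <;> linarith [e1.1, e1.2, e2.1, e2.2, e3.1, e3.2]

variable {n N : ℕ}

theorem abs_l2Inner_le_of_abs_le (hN : 0 < N) {f φ : ℝ → ℝ} {K : ℝ} (hK : 0 ≤ K)
    (hf : f ∈ pcSpace N) (hφ : φ ∈ pcSpace N)
    (h : ∀ i : ℕ, i < N → ∀ s ∈ Ioo (0 : ℝ) 1, |f ((i + s) / N)| ≤ K) :
    |l2Inner f φ| ≤ K * l2Norm φ :=
  (abs_l2Inner_le hN hf hφ).trans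
    (mul_le_mul_of_nonneg_right (l2Norm_le_const hN hK hf h) (l2Norm_nonneg _))

/-- Superconvergence against splines. -/
theorem exists_abs_l2Inner_mul_deriv_err_le (n : ℕ) : ∃ C, 0 ≤ C ∧
    ∀ (N : ℕ) (v g : ℝ → ℝ) (K : ℝ), 0 < N → IsSmoothBounded (n + 3) K v →
    IsSmoothBounded (n + 3) K g → ∀ φ ∈ splineSpace (n + 2) N,
      |l2Inner (fun x => g x * deriv (fun x => v x - meshQuasi n N v x) x) φ| ≤
        C * K ^ 2 * (1 / (N : ℝ)) ^ (n + 2) * l2Norm φ := by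
  obtain ⟨C, hC, h⟩ := exists_abs_l2Inner_deriv_sub_le n (n + 1)
  refine ⟨2 * C, by positivity, fun N v g K hN hv hg φ hφ => ?_⟩
  obtain ⟨q, hq, hqe⟩ := exists_isCellSpline hN hφ
  have := h N v g φ q 1 K K K K hN hv.contDiff hv.periodic
    (hg.contDiff.of_le (by exact_mod_cast (show 1 ≤ n + 3 by omega))) hg.periodic
    (hv.bound _ (by omega)) (hv.bound _ le_rfl) (fun x => by simpa using hg.bound 0 (by omega) x)
    (fun x => by simpa using hg.bound 1 (by omega) x) hq zero_le_one
    (isPiecewiseC1_of_mem_splineSpace hN hφ).mem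
    (fun i _ s hs => by rw [one_mul, hqe i s (Ioo_subset_Icc_self hs)])
  refine this.trans (le_of_eq (by ring))

/-- Superconvergence against derivatives of splines. -/
theorem exists_abs_l2Inner_deriv_err_deriv_le (n : ℕ) : ∃ C, 0 ≤ C ∧
    ∀ (N : ℕ) (v : ℝ → ℝ) (K : ℝ), 0 < N → IsSmoothBounded (n + 3) K v →
    ∀ φ ∈ splineSpace (n + 2) N,
      |l2Inner (deriv (fun x => v x - meshQuasi n N v x)) (deriv φ)| ≤
        C * K * (1 / (N : ℝ)) ^ (n + 2) * l2Norm (deriv φ) := by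
  obtain ⟨C, hC, h⟩ := exists_abs_l2Inner_deriv_sub_le n n
  refine ⟨C, hC, fun N v K hN hv φ hφ => ?_⟩
  obtain ⟨q, hq, hqe⟩ := exists_isCellSpline hN hφ
  -- The derivative of a spline has scale `N` and cell polynomials of order one less; the constant
  -- weight has derivative bound 0.
  have := h N v (fun _ => 1) (deriv φ) (fun i => derivative (q i)) N K K 1 0 hN hv.contDiff
    hv.periodic contDiff_const (fun _ => rfl) (hv.bound _ (by omega)) (hv.bound _ le_rfl)
    (by simp) (by simp) hq.derivative (by positivity)
    (isPiecewiseC1_of_mem_splineSpace hN hφ).deriv_mem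
    (fun i _ s hs => (hasDerivAt_of_cell hN (hqe i) hs).deriv)
  simpa using this

theorem IsSmoothBounded.isPiecewiseC1 {K : ℝ} {v : ℝ → ℝ} (h : IsSmoothBounded (n + 3) K v) :
    IsPiecewiseC1 N v :=
  IsPiecewiseC1.of_contDiff (h.contDiff.of_le (by exact_mod_cast (show 1 ≤ n + 3 by omega)))
    h.periodic

/-- Consistency of the nonlinear evolution equation. -/
theorem exists_evolution_consistency (n : ℕ) : ∃ C, 0 ≤ C ∧
    ∀ (N : ℕ) (m u μ : ℝ → ℝ) (K : ℝ), 0 < N → IsSmoothBounded (n + 3) K m →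
    IsSmoothBounded (n + 3) K u → IsSmoothBounded (n + 3) K μ → (∀ x, μ x + flux m u x = 0) →
    ∀ φ ∈ splineSpace (n + 2) N,
      |l2Inner (meshQuasi n N μ) φ + l2Inner (flux (meshQuasi n N m) (meshQuasi n N u)) φ| ≤
        C * (K + K ^ 2) * (1 / (N : ℝ)) ^ (n + 2) * l2Norm φ := by
  obtain ⟨C₁, hC₁, h₁⟩ := exists_meshQuasi_bounds n
  obtain ⟨C₂, hC₂, h₂⟩ := exists_abs_l2Inner_mul_deriv_err_le n
  refine ⟨C₁ + 3 * C₁ ^ 2 + 3 * C₂, by positivity, fun N m u μ K hN hm hu hμ heq φ hφ => ?_⟩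
  have hK : 0 ≤ K := (abs_nonneg _).trans (hm.bound 0 (by omega) 0)
  obtain ⟨m1, m2, m3⟩ := h₁ N m K hN hm
  obtain ⟨u1, u2, u3⟩ := h₁ N u K hN hu
  obtain ⟨μ1, μ2, μ3⟩ := h₁ N μ K hN hμ
  have em := h₂ N m u K hN hm hu φ hφ
  have eu := h₂ N u m K hN hu hm φ hφ
  set H : ℝ := 1 / (N : ℝ) with hH
  have hH0 : 0 ≤ H := by positivity
  set M := meshQuasi n N m
  set U := meshQuasi n N u
  set Λ := meshQuasi n N μ
  have pm : IsPiecewiseC1 N m := hm.isPiecewiseC1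
  have pu : IsPiecewiseC1 N u := hu.isPiecewiseC1
  have pμ : IsPiecewiseC1 N μ := hμ.isPiecewiseC1
  have pM : IsPiecewiseC1 N M := isPiecewiseC1_of_mem_splineSpace hN (meshQuasi_mem hN hm.periodic)
  have pU : IsPiecewiseC1 N U := isPiecewiseC1_of_mem_splineSpace hN (meshQuasi_mem hN hu.periodic)
  have pΛ : IsPiecewiseC1 N Λ := isPiecewiseC1_of_mem_splineSpace hN (meshQuasi_mem hN hμ.periodic)
  have pφ : φ ∈ pcSpace N := (isPiecewiseC1_of_mem_splineSpace hN hφ).mem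
  set Em := deriv (fun x => m x - M x)
  set Eu := deriv (fun x => u x - U x)
  have qm : (fun x => u x * Em x) ∈ pcSpace N := mul_mem_pcSpace pu.mem (pm.sub pM).deriv_mem
  have qu : (fun x => m x * Eu x) ∈ pcSpace N := mul_mem_pcSpace pm.mem (pu.sub pU).deriv_mem
  -- `R` collects the terms in which the interpolation error is not differentiated, bounded
  -- pointwise by `H^(n+2)`. The rest, `u (m - M)_x` and `2 m (u - U)_x`, need superconvergence.
  let R : ℝ → ℝ := fun x => (Λ x - μ x) +
    ((deriv M x * (U x - u x)) + 2 * ((M x - m x) * deriv U x))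
  have r1 : (fun x => Λ x - μ x) ∈ pcSpace N := sub_mem_pcSpace pΛ.mem pμ.mem
  have r2 : (fun x => deriv M x * (U x - u x)) ∈ pcSpace N :=
    mul_mem_pcSpace pM.deriv_mem (sub_mem_pcSpace pU.mem pu.mem)
  have r3 : (fun x => (M x - m x) * deriv U x) ∈ pcSpace N :=
    mul_mem_pcSpace (sub_mem_pcSpace pM.mem pm.mem) pU.deriv_mem
  have hR : R ∈ pcSpace N :=
    add_mem_pcSpace r1 (add_mem_pcSpace r2 (const_mul_mem_pcSpace 2 r3))
  have hflux : flux M U ∈ pcSpace N := add_mem_pcSpace (mul_mem_pcSpace pM.deriv_mem pU.mem)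
    (const_mul_mem_pcSpace _ (mul_mem_pcSpace pM.mem pU.deriv_mem))
  have key : l2Inner Λ φ + l2Inner (flux M U) φ =
      l2Inner R φ - l2Inner (fun x => u x * Em x) φ - 2 * l2Inner (fun x => m x * Eu x) φ := by
    rw [← l2Inner_add_left hN pΛ.mem hflux pφ, ← l2Inner_const_mul_left,
      ← l2Inner_sub_left hN hR qm pφ,
      ← l2Inner_sub_left hN (sub_mem_pcSpace hR qm) (const_mul_mem_pcSpace 2 qu) pφ]
    refine l2Inner_congr hN (fun i hi s hs => ?_) fun _ _ _ _ => rfl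
    have d1 : Em ((i + s) / N) = deriv m ((i + s) / N) - deriv M ((i + s) / N) :=
      deriv_fun_sub (pm.differentiableAt i hi s hs) (pM.differentiableAt i hi s hs)
    have d2 : Eu ((i + s) / N) = deriv u ((i + s) / N) - deriv U ((i + s) / N) :=
      deriv_fun_sub (pu.differentiableAt i hi s hs) (pU.differentiableAt i hi s hs)
    have h0 := heq ((i + s) / N)
    simp only [flux, R, d1, d2] at h0 ⊢
    linear_combination h0
  have hRb : |l2Inner R φ| ≤ (C₁ * K * H ^ (n + 2) + (C₁ * K * (C₁ * K * H ^ (n + 2)) +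
      2 * (C₁ * K * H ^ (n + 2) * (C₁ * K)))) * l2Norm φ := by
    refine abs_l2Inner_le_of_abs_le hN (by positivity) hR pφ fun i hi s hs => ?_
    refine (abs_add_le _ _).trans (add_le_add ?_ ((abs_add_le _ _).trans (add_le_add ?_ ?_)))
    · rw [abs_sub_comm]; exact μ1 _
    · rw [abs_mul]
      exact mul_le_mul (m3 i hi s hs) (by rw [abs_sub_comm]; exact u1 _) (abs_nonneg _)
        (by positivity)
    · rw [abs_mul, abs_mul, abs_two]
      refine mul_le_mul_of_nonneg_left ?_ zero_le_two
      exact mul_le_mul (by rw [abs_sub_comm]; exact m1 _) (u3 i hi s hs) (abs_nonneg _)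
        (by positivity)
  rw [key]
  set nφ := l2Norm φ
  have hn : 0 ≤ nφ := l2Norm_nonneg _
  have f1 : 0 ≤ C₁ * K ^ 2 * H ^ (n + 2) * nφ := by positivity
  have f2 : 0 ≤ 3 * C₁ ^ 2 * K * H ^ (n + 2) * nφ := by positivity
  have f3 : 0 ≤ 3 * C₂ * K * H ^ (n + 2) * nφ := by positivity
  rw [abs_le] at *
  constructor <;> nlinarith [hRb.1, hRb.2, em.1, em.2, eu.1, eu.2]

/-- Consistency of the elliptic equation. -/
theorem exists_elliptic_consistency (n : ℕ) : ∃ C, 0 ≤ C ∧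
    ∀ (N : ℕ) (m u : ℝ → ℝ) (K : ℝ), 0 < N → IsSmoothBounded (n + 3) K m →
    IsSmoothBounded (n + 3) K u → ∀ φ ∈ splineSpace (n + 2) N,
    l2Inner u φ + l2Inner (deriv u) (deriv φ) = l2Inner m φ →
      |l2Inner (meshQuasi n N u) φ + l2Inner (deriv (meshQuasi n N u)) (deriv φ) -
        l2Inner (meshQuasi n N m) φ| ≤
        C * K * (1 / (N : ℝ)) ^ (n + 2) * (l2Norm φ + l2Norm (deriv φ)) := by
  obtain ⟨C₁, hC₁, h₁⟩ := exists_meshQuasi_bounds n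
  obtain ⟨C₂, hC₂, h₂⟩ := exists_abs_l2Inner_deriv_err_deriv_le n
  refine ⟨2 * C₁ + C₂, by positivity, fun N m u K hN hm hu φ hφ heq => ?_⟩
  have hK : 0 ≤ K := (abs_nonneg _).trans (hm.bound 0 (by omega) 0)
  obtain ⟨m1, -, -⟩ := h₁ N m K hN hm
  obtain ⟨u1, -, -⟩ := h₁ N u K hN hu
  have eu := h₂ N u K hN hu φ hφ
  set H : ℝ := 1 / (N : ℝ) with hH
  have hH0 : 0 ≤ H := by positivity
  set M := meshQuasi n N m
  set U := meshQuasi n N u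
  have pm : IsPiecewiseC1 N m := hm.isPiecewiseC1
  have pu : IsPiecewiseC1 N u := hu.isPiecewiseC1
  have pM : IsPiecewiseC1 N M := isPiecewiseC1_of_mem_splineSpace hN (meshQuasi_mem hN hm.periodic)
  have pU : IsPiecewiseC1 N U := isPiecewiseC1_of_mem_splineSpace hN (meshQuasi_mem hN hu.periodic)
  have pφ := isPiecewiseC1_of_mem_splineSpace hN hφ
  have e1 := l2Inner_sub_left hN pm.mem pM.mem pφ.mem
  have e2 := l2Inner_sub_left hN pu.mem pU.mem pφ.mem
  have e3 : l2Inner (deriv (fun x => u x - U x)) (deriv φ) =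
      l2Inner (deriv u) (deriv φ) - l2Inner (deriv U) (deriv φ) := by
    rw [← l2Inner_sub_left hN pu.deriv_mem pU.deriv_mem pφ.deriv_mem]
    exact l2Inner_congr hN (fun i hi s hs =>
      deriv_fun_sub (pu.differentiableAt i hi s hs) (pU.differentiableAt i hi s hs))
      fun _ _ _ _ => rfl
  have b1 := abs_l2Inner_le_of_abs_le hN (K := C₁ * K * H ^ (n + 2)) (by positivity)
    (sub_mem_pcSpace pm.mem pM.mem) pφ.mem fun i _ s _ => m1 _
  have b2 := abs_l2Inner_le_of_abs_le hN (K := C₁ * K * H ^ (n + 2)) (by positivity)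
    (sub_mem_pcSpace pu.mem pU.mem) pφ.mem fun i _ s _ => u1 _
  rw [e1] at b1
  rw [e2] at b2
  rw [e3] at eu
  have f1 : 0 ≤ C₁ * K * H ^ (n + 2) * l2Norm (deriv φ) :=
    mul_nonneg (by positivity) (l2Norm_nonneg _)
  have f2 : 0 ≤ C₂ * K * H ^ (n + 2) * l2Norm φ := mul_nonneg (by positivity) (l2Norm_nonneg _)
  rw [abs_le] at *
  constructor <;> nlinarith [b1.1, b1.2, b2.1, b2.2, eu.1, eu.2]

/-- By `fluxForm_self` no derivative of `θ` remains. It serves both for the smooth comparison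
velocity and, through the inverse estimate, for the velocity error. -/
theorem abs_fluxForm_self_le (hN : 0 < N) (θ u : splineSpace (n + 2) N) {K : ℝ} (hK : 0 ≤ K)
    (h : ∀ i : ℕ, i < N → ∀ s ∈ Ioo (0 : ℝ) 1, |deriv u.1 ((i + s) / N)| ≤ K) :
    |fluxForm n hN θ u θ| ≤ 3 / 2 * K * massForm n hN θ θ := by
  have hm := mul_mem_pcSpace (deriv_spline_mem_pcSpace hN u) (spline_mem_pcSpace hN θ)
  have h1 := l2Norm_le_of_abs_le hN hK hm (spline_mem_pcSpace hN θ) fun i hi s hs => by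
    rw [abs_mul]; exact mul_le_mul_of_nonneg_right (h i hi s hs) (abs_nonneg _)
  have h2 := (abs_l2Inner_le hN hm (spline_mem_pcSpace hN θ)).trans
    (mul_le_mul_of_nonneg_right h1 (l2Norm_nonneg _))
  rw [mul_assoc K, l2Norm_mul_self] at h2
  rw [fluxForm_self, abs_mul, massForm_apply, abs_of_pos (by norm_num : (0 : ℝ) < 3 / 2), mul_assoc]
  gcongr

/-- For the term in which the first argument is the quasi-interpolant, bounded together with its
derivative, and the second is the velocity error. -/
theorem abs_fluxForm_le (hN : 0 < N) (m u φ : splineSpace (n + 2) N) {K : ℝ} (hK : 0 ≤ K)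
    (h : ∀ i : ℕ, i < N → ∀ s ∈ Ioo (0 : ℝ) 1, |m.1 ((i + s) / N)| ≤ K)
    (h' : ∀ i : ℕ, i < N → ∀ s ∈ Ioo (0 : ℝ) 1, |deriv m.1 ((i + s) / N)| ≤ K) :
    |fluxForm n hN m u φ| ≤ K * (l2Norm u + 2 * l2Norm (deriv u.1)) * l2Norm φ := by
  have h1 := mul_mem_pcSpace (deriv_spline_mem_pcSpace hN m) (spline_mem_pcSpace hN u)
  have h2 := mul_mem_pcSpace (spline_mem_pcSpace hN m) (deriv_spline_mem_pcSpace hN u)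
  have h3 := const_mul_mem_pcSpace 2 h2
  refine (abs_l2Inner_le hN (flux_mem_pcSpace hN m u) (spline_mem_pcSpace hN φ)).trans
    (mul_le_mul_of_nonneg_right ?_ (l2Norm_nonneg _))
  have e1 := l2Norm_le_of_abs_le hN hK h1 (spline_mem_pcSpace hN u) fun i hi s hs => by
    rw [abs_mul]; exact mul_le_mul_of_nonneg_right (h' i hi s hs) (abs_nonneg _)
  have e2 := l2Norm_le_of_abs_le hN (mul_nonneg zero_le_two hK) h3 (deriv_spline_mem_pcSpace hN u)
    fun i hi s hs => by
      rw [abs_mul, abs_mul, abs_two, mul_assoc]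
      exact mul_le_mul_of_nonneg_left
        (mul_le_mul_of_nonneg_right (h i hi s hs) (abs_nonneg _)) zero_le_two
  calc _ ≤ _ := l2Norm_add_le hN h1 h3
    _ ≤ _ := add_le_add e1 e2
    _ = _ := by ring

end Consistency

/-! ### Convergence of the semidiscrete solutions. -/

section Convergence

variable {n N : ℕ} {T : ℝ} {u₀ : ℝ → ℝ} {m u : ℝ → ℝ → ℝ}

/-- A fixed finite combination of nodal values, defined for every function; differentiating its
coefficients in time shows that `Q` maps the time derivative of `m` to that of `Q m`. -/
theorem exists_splineQuasi (n : ℕ) (hN : 0 < N) : ∃ Q : (ℝ → ℝ) → splineSpace (n + 2) N,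
    (∀ v, Function.Periodic v 1 → (Q v).1 = meshQuasi n N v) ∧
    ∀ (f : ℝ → ℝ → ℝ) (f' : ℝ → ℝ) (s : Set ℝ) (t : ℝ),
      (∀ x, HasDerivWithinAt (fun τ => f τ x) (f' x) s t) →
      HasWeakDerivWithinAt (fun τ => Q (f τ)) (Q f') s t := by
  obtain ⟨β, hβ, h⟩ := meshQuasi_eq_sum (n := n) hN
  refine ⟨fun v => ∑ j ∈ Finset.range N, v (j / N) • ⟨β j, hβ j⟩, fun v hv => ?_,
    fun f f' s t hf l => ?_⟩
  · rw [h v hv]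
    simp
  · simp only [map_sum, map_smul]
    exact HasDerivWithinAt.fun_sum fun j _ => (hf (j / N)).smul_const _

/-- Here `μ` is the time derivative of `m`. Class `n + 4` is assumed because `μ` must still have `n
+ 3` bounded space derivatives. -/
theorem IsSolution.exists_bounds (hT : 0 < T) (h : IsSolution (n + 4) T u₀ m u) :
    ∃ (K : ℝ) (μ : ℝ → ℝ → ℝ), 0 ≤ K ∧ ∀ t ∈ Icc 0 T, IsSmoothBounded (n + 3) K (m t) ∧
      IsSmoothBounded (n + 3) K (u t) ∧ IsSmoothBounded (n + 3) K (μ t) ∧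
      (∀ x, HasDerivWithinAt (fun τ => m τ x) (μ t x) (Icc 0 T) t) ∧
      (∀ x, μ t x + flux (m t) (u t) x = 0) ∧
      ∀ N, 0 < N → ∀ φ, IsPiecewiseC1 N φ →
        l2Inner (u t) φ + l2Inner (deriv (u t)) (deriv φ) = l2Inner (m t) φ := by
  have hle : ((n + 3 : ℕ) : WithTop ℕ∞) ≤ ((n + 4 : ℕ) : WithTop ℕ∞) := by
    exact_mod_cast Nat.le_succ _
  obtain ⟨K₁, hK₁, h₁⟩ := exists_isSmoothBounded hT (h.smooth_m.of_le hle) h.periodic_m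
  obtain ⟨K₂, hK₂, h₂⟩ := exists_isSmoothBounded hT (h.smooth_u.of_le hle) h.periodic_u
  let μ : ℝ → ℝ → ℝ := fun t x => derivWithin (fun τ => m τ x) (Icc 0 T) t
  obtain ⟨K₃, hK₃, h₃⟩ := exists_isSmoothBounded (f := μ) hT
    (contDiffOn_deriv_time (k := n + 3) hT h.smooth_m) fun t ht x =>
      derivWithin_congr (fun τ hτ => h.periodic_m τ hτ x) (h.periodic_m t ht x)
  refine ⟨K₁ + K₂ + K₃, μ, by positivity, fun t ht => ?_⟩
  have hm : ContDiff ℝ (n + 4 : ℕ) (m t) := contDiff_slice h.smooth_m ht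
  have hu : ContDiff ℝ (n + 4 : ℕ) (u t) := contDiff_slice h.smooth_u ht
  refine ⟨(h₁ t ht).mono (by linarith), (h₂ t ht).mono (by linarith), (h₃ t ht).mono (by linarith),
    fun x => ?_, fun x => ?_, fun N hN φ hφ => ?_⟩
  · exact (hasDerivWithinAt_time (k := n + 3) h.smooth_m (z := (x, t))
      ⟨mem_univ _, ht⟩).differentiableWithinAt.hasDerivWithinAt
  · have := h.evolution t ht x
    rw [deriv_fun_mul (hm.differentiable (by simp)).differentiableAt
      (hu.differentiable (by simp)).differentiableAt] at this
    simp only [flux, μ]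
    linarith
  · have hu2 : ContDiff ℝ 2 (u t) := hu.of_le (by exact_mod_cast (show 2 ≤ n + 4 by omega))
    have hu' : ContDiff ℝ 1 (deriv (u t)) := ((contDiff_succ_iff_deriv (n := 1)).1 hu2).2.2
    have hp' : Function.Periodic (deriv (u t)) 1 := by
      simpa using periodic_iteratedDeriv (h.periodic_u t ht) 1
    have e1 := (IsPiecewiseC1.of_contDiff hu' hp').l2Inner_deriv hN hφ
    have e2 := l2Inner_sub_left hN (continuous_mem_pcSpace hu2.continuous)
      (continuous_mem_pcSpace (hu'.continuous_deriv le_rfl)) hφ.mem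
    rw [show m t = fun x => u t x - deriv (deriv (u t)) x from funext (h.m_eq t ht), e2, e1]
    ring

theorem IsSolution.eq_initial (h : IsSolution (n + 4) T u₀ m u) : u 0 = u₀ := funext h.initial_u

theorem IsSolution.contDiff_initial (hT : 0 < T) (h : IsSolution (n + 4) T u₀ m u) :
    ContDiff ℝ 1 u₀ := by
  rw [← h.eq_initial]
  exact (contDiff_slice h.smooth_u ⟨le_rfl, hT.le⟩).of_le
    (by exact_mod_cast (show 1 ≤ n + 4 by omega))

theorem l2Norm_le_sqrt_energyForm (hN : 0 < N) (φ : splineSpace (n + 2) N) :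
    l2Norm φ ≤ √(energyForm n hN φ φ) :=
  Real.sqrt_le_sqrt (massForm_le_energyForm hN φ)

theorem l2Norm_deriv_le_sqrt_energyForm (hN : 0 < N) (φ : splineSpace (n + 2) N) :
    l2Norm (deriv φ.1) ≤ √(energyForm n hN φ φ) :=
  Real.sqrt_le_sqrt (le_add_of_nonneg_left (l2Inner_self_nonneg _))

theorem l2Norm_sub_le_of_quasi (hN : 0 < N) {v : ℝ → ℝ} (hv : Continuous v)
    (w V : splineSpace (n + 2) N) {δ : ℝ} (hδ : 0 ≤ δ) (h : ∀ x, |v x - V.1 x| ≤ δ) :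
    l2Norm (fun x => v x - w.1 x) ≤ δ + l2Norm (w - V).1 := by
  have hv' := continuous_mem_pcSpace (N := N) hv
  have hV := spline_mem_pcSpace hN V
  have hw := spline_mem_pcSpace hN w
  have e1 := l2Norm_add_le hN (sub_mem_pcSpace hv' hV) (sub_mem_pcSpace hV hw)
  have e2 := l2Norm_le_const hN hδ (sub_mem_pcSpace hv' hV) fun i _ s _ => h ((i + s) / N)
  have e3 : l2Norm (fun x => V.1 x - w.1 x) = l2Norm (w - V).1 := by
    rw [l2Norm, l2Norm]
    congr 1
    simp only [l2Inner, Submodule.coe_sub, Pi.sub_apply]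
    congr 1
    ext x
    ring
  simp only [sub_add_sub_cancel] at e1
  linarith

/-- Optimal order convergence of the semidiscrete Galerkin solutions. -/
theorem IsSolution.exists_error_bound (hT : 0 < T) (h : IsSolution (n + 4) T u₀ m u) :
    ∃ C h₀ : ℝ, 0 < h₀ ∧ ∀ (N : ℕ) (hN : 0 < N), 1 / (N : ℝ) ≤ h₀ →
      ∀ mh uh m' : ℝ → splineSpace (n + 2) N,
      IsGalerkin (massForm n hN) (energyForm n hN) (fluxForm n hN)
        (initialForm n hN (h.contDiff_initial hT)) T mh uh m' →
      ∀ t ∈ Icc 0 T, l2Norm (fun x => m t x - (mh t).1 x) + l2Norm (fun x => u t x - (uh t).1 x) ≤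
        C * (1 / (N : ℝ)) ^ (n + 2) := by
  obtain ⟨K, μ, hK, hs⟩ := h.exists_bounds hT
  obtain ⟨C₁, hC₁, h₁⟩ := exists_meshQuasi_bounds n
  obtain ⟨C₂, hC₂, h₂⟩ := exists_evolution_consistency n
  obtain ⟨C₃, hC₃, h₃⟩ := exists_elliptic_consistency n
  obtain ⟨C₄, hC₄, h₄⟩ := exists_abs_deriv_le n
  -- `A` dominates the constants of the initial error and of the evolution and elliptic residuals,
  -- the factor 2 coming from `‖φ‖ + ‖φ'‖` against the energy norm; the 1 keeps `ε` positive.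
  set A : ℝ := C₁ * K + C₂ * (K + K ^ 2) + 2 * (C₃ * K) + 1 with hA
  have hA0 : 0 < A := by positivity
  -- The factor 3 covers `3 / 2` from `abs_fluxForm_self_le` and `1 + 2` from `abs_fluxForm_le`.
  set κ : ℝ := 3 * (C₁ * K) with hκ
  have hκ0 : 0 ≤ κ := by positivity
  set E : ℝ := Real.exp ((3 * κ + 3) * T) with hE
  have hE0 : 0 < E := Real.exp_pos _
  -- Chosen so that `c * η ≤ 1` implies the smallness condition of `IsGalerkin.error_le`.
  set c : ℝ := 3 / 2 * C₄ * (A * (E + 1)) with hc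
  have hc0 : 0 ≤ c := by positivity
  refine ⟨2 * (C₁ * K) + A * E + A * (E + 1), 1 / (c + 1), by positivity,
    fun N hN hh mh uh m' hG => ?_⟩
  have hN0 : (0 : ℝ) < N := by exact_mod_cast hN
  have hN1 : (1 : ℝ) ≤ N := by exact_mod_cast hN
  set η : ℝ := 1 / (N : ℝ) with hη
  have hη0 : 0 < η := by positivity
  have hη1 : η ≤ 1 := by rw [hη, div_le_one hN0]; exact hN1
  have hNη : (N : ℝ) * η = 1 := by rw [hη]; field_simp
  have hcη : c * η ≤ 1 := by
    have : η * (c + 1) ≤ 1 := by rwa [le_div_iff₀ (by positivity)] at hh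
    linarith
  have := finiteDimensional_splineSpace (n := n) hN
  obtain ⟨Q, hQ, hQ'⟩ := exists_splineQuasi n hN
  have hp0 : 0 < η ^ (n + 2) := by positivity
  have hQm : ∀ t ∈ Icc 0 T, (Q (m t)).1 = meshQuasi n N (m t) := fun t ht =>
    hQ _ (hs t ht).1.periodic
  have hQu : ∀ t ∈ Icc 0 T, (Q (u t)).1 = meshQuasi n N (u t) := fun t ht =>
    hQ _ (hs t ht).2.1.periodic
  have hQμ : ∀ t ∈ Icc 0 T, (Q (μ t)).1 = meshQuasi n N (μ t) := fun t ht =>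
    hQ _ (hs t ht).2.2.1.periodic
  have key := hG.error_le (M := fun t => Q (m t)) (U := fun t => Q (u t)) (M' := fun t => Q (μ t))
    (K := κ) (H := 3 / 2 * (C₄ * N)) (ε := A * η ^ (n + 2)) (massForm_symm hN)
    (massForm_nonneg hN) (massForm_le_energyForm hN) hκ0 (by positivity) (by positivity)
    (fun t ht => hQ' m (μ t) _ t (hs t ht).2.2.2.1) (fun t ht φ => ?_) (fun t ht φ => ?_)
    (fun t ht θ => ?_) (fun t ht ξ θ => ?_) (fun ξ θ => ?_) ?_ ?_
  · intro t ht
    obtain ⟨k1, k2⟩ := key t ht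
    have hm := hs t ht
    have e1 := l2Norm_sub_le_of_quasi hN hm.1.contDiff.continuous (mh t) (Q (m t))
      (δ := C₁ * K * η ^ (n + 2)) (by positivity)
      (fun x => by rw [hQm t ht]; exact (h₁ N _ K hN hm.1).1 x)
    have e2 := l2Norm_sub_le_of_quasi hN hm.2.1.contDiff.continuous (uh t) (Q (u t))
      (δ := C₁ * K * η ^ (n + 2)) (by positivity)
      (fun x => by rw [hQu t ht]; exact (h₁ N _ K hN hm.2.1).1 x)
    have k1' : l2Norm (mh t - Q (m t)).1 ≤ A * η ^ (n + 2) * E := k1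
    have k2' : l2Norm (uh t - Q (u t)).1 ≤ A * η ^ (n + 2) * (E + 1) :=
      (l2Norm_le_sqrt_energyForm hN _).trans k2
    linarith
  · have hm := hs t ht
    have e := h₃ N (m t) (u t) K hN hm.1 hm.2.1 φ.1 φ.2
      (hm.2.2.2.2.2 N hN _ (isPiecewiseC1_of_mem_splineSpace hN φ.2))
    rw [energyForm_apply, massForm_apply, hQu t ht, hQm t ht]
    refine e.trans ?_
    have e1 := l2Norm_le_sqrt_energyForm hN φ
    have e2 := l2Norm_deriv_le_sqrt_energyForm hN φ
    calc C₃ * K * η ^ (n + 2) * (l2Norm φ.1 + l2Norm (deriv φ.1))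
        ≤ C₃ * K * η ^ (n + 2) * (√(energyForm n hN φ φ) + √(energyForm n hN φ φ)) := by gcongr
      _ = 2 * (C₃ * K) * η ^ (n + 2) * √(energyForm n hN φ φ) := by ring
      _ ≤ A * η ^ (n + 2) * √(energyForm n hN φ φ) := by
        gcongr
        have : 0 ≤ C₁ * K + C₂ * (K + K ^ 2) := by positivity
        linarith
  · have hm := hs t ht
    have e := h₂ N (m t) (u t) (μ t) K hN hm.1 hm.2.1 hm.2.2.1 hm.2.2.2.2.1 φ.1 φ.2
    rw [massForm_apply, fluxForm_apply, hQμ t ht, hQu t ht, hQm t ht]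
    refine e.trans (mul_le_mul_of_nonneg_right ?_ (Real.sqrt_nonneg _))
    gcongr
    have : 0 ≤ C₁ * K + 2 * (C₃ * K) := by positivity
    linarith
  · refine (abs_fluxForm_self_le hN θ (Q (u t)) (K := C₁ * K) (by positivity)
      (by rw [hQu t ht]; exact (h₁ N _ K hN (hs t ht).2.1).2.2)).trans ?_
    refine mul_le_mul_of_nonneg_right ?_ (massForm_nonneg hN θ)
    have : 0 ≤ C₁ * K := by positivity
    linarith
  · refine (abs_fluxForm_le hN (Q (m t)) ξ θ (K := C₁ * K) (by positivity)
      (fun i _ s _ => by rw [hQm t ht]; exact (h₁ N _ K hN (hs t ht).1).2.1 _)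
      (by rw [hQm t ht]; exact (h₁ N _ K hN (hs t ht).1).2.2)).trans ?_
    refine mul_le_mul_of_nonneg_right ?_ (Real.sqrt_nonneg _)
    have e1 := l2Norm_le_sqrt_energyForm hN ξ
    have e2 := l2Norm_deriv_le_sqrt_energyForm hN ξ
    have : C₁ * K * (l2Norm ξ.1 + 2 * l2Norm (deriv ξ.1)) ≤
        C₁ * K * (3 * √(energyForm n hN ξ ξ)) :=
      mul_le_mul_of_nonneg_left (by linarith) (by positivity)
    linarith
  · have e1 := l2Norm_nonneg (deriv ξ.1)
    refine (abs_fluxForm_self_le hN θ ξ (K := C₄ * N * l2Norm (deriv ξ.1)) (by positivity)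
      (h₄ N hN ξ.1 ξ.2)).trans ?_
    refine mul_le_mul_of_nonneg_right ?_ (massForm_nonneg hN θ)
    rw [← mul_assoc]
    exact mul_le_mul_of_nonneg_left (l2Norm_deriv_le_sqrt_energyForm hN ξ) (by positivity)
  · have ht : (0 : ℝ) ∈ Icc 0 T := ⟨le_rfl, hT.le⟩
    have hm := hs 0 ht
    set θ := mh 0 - Q (m 0) with hθ
    have p := isPiecewiseC1_of_mem_splineSpace hN θ.2
    have pm := continuous_mem_pcSpace (N := N) hm.1.contDiff.continuous
    have pM := spline_mem_pcSpace hN (Q (m 0))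
    -- Since `m_h(0)` is the `L²` projection of `m(0)`, testing with `θ` replaces `m_h(0)` by
    -- `m(0)`; the initial error is then at most the quasi-interpolation error.
    have e1 : massForm n hN θ θ = l2Inner (fun x => m 0 x - (Q (m 0)).1 x) θ.1 := by
      have i1 := hG.initial θ
      have i2 := hm.2.2.2.2.2 N hN _ p
      rw [h.eq_initial] at i2
      have i3 : massForm n hN (mh 0) θ = l2Inner (m 0) θ.1 := i1.trans i2
      rw [l2Inner_sub_left hN pm pM p.mem, ← i3, ← massForm_apply hN,
        ← LinearMap.sub_apply, ← map_sub]
    have e2 := abs_l2Inner_le_of_abs_le hN (K := C₁ * K * η ^ (n + 2)) (by positivity)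
      (sub_mem_pcSpace pm pM) p.mem fun i _ s _ => by
        rw [hQm 0 ht]; exact (h₁ N _ K hN hm.1).1 _
    rw [← e1] at e2
    have e3 : massForm n hN θ θ = l2Norm θ.1 * l2Norm θ.1 := (l2Norm_mul_self _).symm
    have e4 : l2Norm θ.1 ≤ C₁ * K * η ^ (n + 2) := by
      by_contra hcon
      push Not at hcon
      have hpos : 0 < l2Norm θ.1 := lt_of_le_of_lt (by positivity) hcon
      have := (le_abs_self _).trans e2
      rw [e3] at this
      exact absurd (le_of_mul_le_mul_right this hpos) (not_le.2 hcon)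
    refine (show l2Norm θ.1 ≤ _ from e4).trans ?_
    gcongr
    have : 0 ≤ C₂ * (K + K ^ 2) + 2 * (C₃ * K) := by positivity
    linarith
  -- One power of `η` pays for the `N` of the inverse estimate and a second one for `c`; both are
  -- present because `r = n + 2 ≥ 2`.
  · calc 3 / 2 * (C₄ * N) * (A * η ^ (n + 2) * (E + 1)) = c * η * η ^ n * (N * η) := by
          rw [hc]; ring
      _ = c * η * η ^ n := by rw [hNη, mul_one]
      _ ≤ 1 * 1 := mul_le_mul hcη (pow_le_one₀ hη0.le hη1) (by positivity) zero_le_one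
      _ = 1 := one_mul 1

end Convergence

end CamassaHolm

end

theorem mainTheorem2 (r : ℕ) (hr : 2 ≤ r) :
    ∃ k : ℕ, ∀ (T : ℝ) (u₀ : ℝ → ℝ) (m u : ℝ → ℝ → ℝ), 0 < T →
      CamassaHolm.IsSolution k T u₀ m u →
      ∃ (C h₀ : ℝ), 0 < h₀ ∧ ∀ N : ℕ, 0 < N → 1 / (N : ℝ) ≤ h₀ →
        ∃ mh uh : ℝ → ℝ → ℝ,
          CamassaHolm.IsModifiedGalerkin r N T u₀ mh uh ∧
          (∀ mh' uh' : ℝ → ℝ → ℝ, CamassaHolm.IsModifiedGalerkin r N T u₀ mh' uh' →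
            ∀ t ∈ Set.Icc 0 T, mh' t = mh t ∧ uh' t = uh t) ∧
          ∀ t ∈ Set.Icc 0 T,
            CamassaHolm.l2Norm (fun x => m t x - mh t x)
              + CamassaHolm.l2Norm (fun x => u t x - uh t x) ≤ C * (1 / (N : ℝ)) ^ r := by
  obtain ⟨n, rfl⟩ := Nat.exists_eq_add_of_le' hr
  refine ⟨n + 4, fun T u₀ m u hT h => ?_⟩
  obtain ⟨C, h₀, hh₀, hC⟩ := h.exists_error_bound hT
  refine ⟨C, h₀, hh₀, fun N hN hNh => ?_⟩
  have := CamassaHolm.finiteDimensional_splineSpace (n := n) hN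
  obtain ⟨⟨mh, uh, m', hG⟩, huniq⟩ := CamassaHolm.IsGalerkin.exists_unique
    (ℓ := CamassaHolm.initialForm n hN (h.contDiff_initial hT))
    (CamassaHolm.massForm_pos hN) (CamassaHolm.energyForm_pos hN) (CamassaHolm.energyForm_symm hN)
    (CamassaHolm.fluxForm_eq_zero hN) hT
  refine ⟨fun t => (mh t).1, fun t => (uh t).1, hG.isModifiedGalerkin hN hT _, fun p q hpq t ht => ?_,
    hC N hN hNh mh uh m' hG⟩
  obtain ⟨mp, up, m'', hG', hp⟩ := hpq.exists_isGalerkin hN hT (h.contDiff_initial hT)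
  obtain ⟨e1, e2⟩ := huniq _ _ _ _ _ _ hG' hG
  exact ⟨by rw [← (hp t ht).1, e1 ht], by rw [← (hp t ht).2, e2 ht]⟩
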